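/- **Setting.** Let $\mathcal A_{\mathbb Z}$ be the $C^*$-algebra of quasi-local observables of the spin-$\tfrac12$ chain on $\mathbb Z$ (norm closure of the observables of finite support), with lowering and raising operators $\sigma_x^\mp$ and number operators $n_x=\sigma_x^+\sigma_x^-$; $|1\rangle$ denotes an occupied and $|0\rangle$ an empty site. Let $\lambda\in\mathbb C$, $\kappa>0$, and $$H_{[a,b]}=\sum_{x=a}^{b-2}n_xn_{x+2}+\kappa\sum_{x=a}^{b-3}q_x^*q_x,\qquad q_x=\sigma^-_{x+1}\sigma^-_{x+2}-\lambda\,\sigma^-_x\sigma^-_{x+3}.$$ A state $\omega$ on $\mathcal A_{\mathbb Z}$ is a ground state if $\omega(A^*[H_{[-n,n]},A])\ge0$ for all local $A$ and all large $n$; it has zero energy if $\omega(H_{[a,b]})=0$ for all $a,b$. For $L\ge0$ let $\varphi_L$ be the vector on $3L$ consecutive sites given by the sum, over all tilings of these sites by monomers (three sites, occupation $100$) and dimers (six sites, occupation $011000$) starting at the left end, of $\lambda^{\#\text{dimers}}$ times the corresponding configuration vector. For $k\in\mathbb Z$, $n\ge|k|$, put $\psi^{(n)}_k=\varphi_{n+k}\otimes|0\rangle_{3k}\otimes\varphi_{n-k}$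 on $[-3n,3n]$ and $\widehat\psi=\psi/\|\psi\|$. Write $\mu_\pm=\tfrac12(1\pm\sqrt{1+4|\lambda|^2})$, $\mu=\mu_- /\mu_+$, $\Delta\mu=\mu_+-\mu_-$. **Single-void states.** For every $k\in\mathbb Z$ the limit $\omega_{3k}(A)=\lim_{n\to\infty}\langle\widehat\psi^{(n)}_k,A\,\widehat\psi^{(n)}_k\rangle$ exists for all $A\in\mathcal A_{\mathbb Z}$ and is a state. For all $k,j\in\mathbb Z$, $$\omega_{3k}(n_{3j})=\frac{1-\mu^{|j-k|}}{\Delta\mu}\times\begin{cases}1&j<k,\\0&j=k,\\|\lambda|^2/\mu_+&j>k,\end{cases}$$ and for $j>1$ $$\omega_{3k}(n_0n_{3j})=\begin{cases}\frac{1}{(\Delta\mu)^2}(1-\mu^j)(1-\mu^{k-j})&j<k,\\ \omega_{3k}(n_0)\,\omega_{3k}(n_{3j})&0\le k\le j,\\ \frac{|\lambda|^4}{\mu_+^2(\Delta\mu)^2}(1-\mu^{j-1})(1-\mu^{-k})&k<0.\end{cases}$$ Moreover $|\omega_{3k}(n_0n_{3j})-\omega_{3k}(n_0)\omega_{3k}(n_{3j})|\le\frac{4\max\{1,|\lambda|^2\}}{(\Delta\mu)^2}|\mu|^j$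 for $j>1$; and if $\lambda=0$, then $\omega_{3k}(n_xn_y)=\omega_{3k}(n_x)\omega_{3k}(n_y)$ for all $x\ne y$. **One GNS representation.** Let $(\pi_0,\mathcal H_0)$ be the GNS representation of $\omega_0$. There are vectors $\Omega_{3k}\in\mathcal H_0$ with $\omega_{3k}(A)=\langle\Omega_{3k},\pi_0(A)\Omega_{3k}\rangle$ for all $k\in\mathbb Z$ and $A\in\mathcal A_{\mathbb Z}$. Any such family is orthonormal and, for every $(c_k)\in\ell^2(\mathbb Z)$ with $\sum_k|c_k|^2=1$, the series $\Omega=\sum_kc_k\Omega_{3k}$ converges and $\omega(A)=\langle\Omega,\pi_0(A)\Omega\rangle$ has the following properties, where $C_j:=\omega(n_0n_{3j})-\omega(n_0)\omega(n_{3j})$. 1. $\omega$ is pure and is, for every $\kappa>0$, a zero-energy ground state. 2. $\omega(n_x)=\sum_k|c_k|^2\omega_{3k}(n_x)$ and $\omega(n_xn_y)=\sum_k|c_k|^2\omega_{3k}(n_xn_y)$ for all $x,y$. 3. If $\lambda=0$, then $C_j=p(0)(1-p(j))$ for $j\ge1$, where $p(j)=\sum_{k\le j}|c_k|^2$, so that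 $1-p(j)=\sum_{k>j}|c_k|^2$. 4. For $j>1$ the double series $F_j=\sum_{k,l}|c_k|^2|c_l|^2\,\omega_{3k}(n_{3j})\,(\omega_{3k}(n_0)-\omega_{3l}(n_0))$ converges absolutely and $|C_j-F_j|\le\frac{4\max\{1,|\lambda|^2\}}{(\Delta\mu)^2}|\mu|^j$. 5. Let $c_k=0$ for all $k<0$, $S_\mu=\sum_{l\ge0}|c_l|^2\mu^l$ and $T_j=\sum_{k>j}|c_k|^2$. Then for $j>1$ $$F_j=\frac1{(\Delta\mu)^2}\sum_{k\ge0}|c_k|^2(1-\mu^{|j-k|})(S_\mu-\mu^k)\Big(\delta_{k>j}+\tfrac{|\lambda|^2}{\mu_+}\delta_{k<j}\Big),$$ $$\Big|C_j-\frac{S_\mu}{(\Delta\mu)^2}\Big(T_j-\tfrac{|\lambda|^2}{\mu_+}T_j-\sum_{k>j}|c_k|^2\mu^{k-j}-\tfrac{|\lambda|^2}{\mu_+}\sum_{k\le j}|c_k|^2\mu^{j-k}\Big)\Big|\le\frac{8\max\{1,|\lambda|^2\}}{(\Delta\mu)^2}|\mu|^j,$$ and consequently, for small $\lambda$, $C_j$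 is to leading order $\frac{S_\mu}{(\Delta\mu)^2}\sum_{k>j}|c_k|^2$: $$\Big|C_j-\frac{S_\mu}{(\Delta\mu)^2}T_j\Big|\le\frac{8\max\{1,|\lambda|^2\}}{(\Delta\mu)^2}|\mu|^j+\frac{2|\lambda|^2}{(\Delta\mu)^2}\sum_k|c_k|^2|\mu|^{\max\{j-k,0\}}.$$ 6. $C_j\to0$ as $j\to\infty$. **Arbitrarily slow decay.** For every $\lambda\in\mathbb C$ and every real sequence $r_j\to0$ there is a normalized $(c_k)$ such that $|C_j|\ge r_j$ for infinitely many $j$; if $|\lambda|^2\ne2$, it can be chosen such that in addition $|C_j|\ge r_j$ for all sufficiently large $j$. In particular, for every $\lambda\in\mathbb C$ some of these pure ground states do not cluster exponentially: there are no $c>0$ and constants $C(\ell,m)$ with $|\omega(AB)-\omega(A)\omega(B)|\le C(|X|,|Y|)\,\|A\|\,\|B\|\,e^{-c\,d(X,Y)}$ for all finite intervals $X$ to the left of $Y$ and all observables $A$, $B$ supported in $X$, $Y$. -/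

import Mathlib

open Filter Topology
open scoped ComplexOrder InnerProductSpace ENNReal

noncomputable section

namespace SpinChain

/-! ### The quasi-local algebra of the spin-1/2 chain on `ℤ`

The algebra is realised concretely on the Hilbert space with orthonormal basis `|S⟩`, where `S`
runs over the finite subsets of `ℤ` (the set of sites carrying a particle, that is, spin up). -/

/-- `ℓ²` over the finite particle configurations on `ℤ`. -/
abbrev Config : Type := lp (fun _ : Finset ℤ => ℂ) 2

/-- The basis vector `|S⟩`. -/
def ket (S : Finset ℤ) : Config := lp.single 2 S 1

/-- The vector of all spins down. -/
def vacuum : Config := ket ∅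

/-- The action of the lowering operator at `x` on coefficients. -/
def lowerFun (x : ℤ) (f : Finset ℤ → ℂ) (S : Finset ℤ) : ℂ :=
  if x ∈ S then 0 else f (insert x S)

theorem sum_lowerFun_le (x : ℤ) (f : Config) (s : Finset (Finset ℤ)) :
    ∑ S ∈ s, ‖lowerFun x f S‖ ^ (2 : ℝ≥0∞).toReal ≤ ‖f‖ ^ (2 : ℝ≥0∞).toReal := by
  have h2 : (0 : ℝ) < (2 : ℝ≥0∞).toReal := by norm_num
  have hinj : Set.InjOn (fun S : Finset ℤ => insert x S) (s.filter (fun S => x ∉ S)) := by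
    intro S hS T hT h
    simp only [Finset.coe_filter, Set.mem_ofPred_eq] at hS hT
    have h' := congrArg (fun U : Finset ℤ => U.erase x) h
    simpa [Finset.erase_insert hS.2, Finset.erase_insert hT.2] using h'
  calc ∑ S ∈ s, ‖lowerFun x f S‖ ^ (2 : ℝ≥0∞).toReal
      = ∑ S ∈ s.filter (fun S => x ∉ S), ‖f (insert x S)‖ ^ (2 : ℝ≥0∞).toReal := by
        rw [Finset.sum_filter]
        refine Finset.sum_congr rfl fun S _ => ?_
        by_cases hx : x ∈ S <;> simp [lowerFun, hx]
    _ = ∑ T ∈ (s.filter (fun S => x ∉ S)).image (fun S => insert x S),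
          ‖f T‖ ^ (2 : ℝ≥0∞).toReal := 
        (Finset.sum_image (f := fun T => ‖f T‖ ^ (2 : ℝ≥0∞).toReal) hinj).symm
    _ ≤ ‖f‖ ^ (2 : ℝ≥0∞).toReal := lp.sum_rpow_le_norm_rpow h2 f _

/-- The spin lowering operator `σ⁻_x`: it removes a particle at `x`, and annihilates `|S⟩`
if `x ∉ S`. -/
def spinLower (x : ℤ) : Config →L[ℂ] Config :=
  LinearMap.mkContinuous
    { toFun := fun f => ⟨lowerFun x f, memℓp_gen' (sum_lowerFun_le x f)⟩
      map_add' := by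
        intro f g
        ext S
        change lowerFun x (f + g : Config) S = lowerFun x f S + lowerFun x g S
        by_cases h : x ∈ S <;> simp [lowerFun, h]
      map_smul' := by
        intro c f
        ext S
        change lowerFun x (c • f : Config) S = c • lowerFun x f S
        by_cases h : x ∈ S <;> simp [lowerFun, h] }
    1 (by
      intro f
      rw [one_mul]
      exact lp.norm_le_of_forall_sum_le (by norm_num) (norm_nonneg f) (sum_lowerFun_le x f))

theorem spinLower_ket (x : ℤ) (S : Finset ℤ) :
    spinLower x (ket S) = if x ∈ S then ket (S.erase x) else 0 := by
  ext T
  change lowerFun x (ket S) T = _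
  by_cases hS : x ∈ S
  · by_cases hT : x ∈ T
    · have : T ≠ S.erase x := fun h => by simp [h] at hT
      simp [lowerFun, hS, hT, ket, lp.single_apply, this]
    · have : insert x T = S ↔ T = S.erase x := by
        constructor
        · rintro rfl; simp [Finset.erase_insert hT]
        · rintro rfl; simp [Finset.insert_erase hS]
      simp [lowerFun, hS, hT, ket, lp.single_apply, Pi.single_apply, this]
  · have : insert x T ≠ S := fun h => hS (h ▸ Finset.mem_insert_self x T)
    by_cases hT : x ∈ T <;>
      simp [lowerFun, hS, hT, ket, lp.single_apply, this]

/-- The norm closure of the algebra of strictly local observables, as a subalgebra of the bounded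
operators. The operators `σ⁻_x`, `x ∈ X`, and their adjoints generate the full matrix algebra
on the sites of a finite set `X`. -/
def quasiLocalSubalgebra : StarSubalgebra ℂ (Config →L[ℂ] Config) :=
  (StarAlgebra.adjoin ℂ (Set.range spinLower)).topologicalClosure

instance isClosed_quasiLocalSubalgebra :
    IsClosed (quasiLocalSubalgebra : Set (Config →L[ℂ] Config)) :=
  StarSubalgebra.isClosed_topologicalClosure _

/-- The C⋆-algebra of quasi-local observables of the chain. -/
def QuasiLocal : Type := quasiLocalSubalgebra

instance : CStarAlgebra QuasiLocal := inferInstanceAs (CStarAlgebra quasiLocalSubalgebra)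

/-- `a ≤ b` if and only if `b - a` is positive. -/
instance : PartialOrder QuasiLocal := CStarAlgebra.spectralOrder QuasiLocal

instance : StarOrderedRing QuasiLocal := CStarAlgebra.spectralOrderedRing QuasiLocal

/-- A quasi-local observable as an operator on the configuration space. -/
def QuasiLocal.op (A : QuasiLocal) : Config →L[ℂ] Config := A.1

/-- The lowering operator `σ⁻_x` as an observable. -/
def lower (x : ℤ) : QuasiLocal :=
  ⟨spinLower x, StarSubalgebra.le_topologicalClosure _
    (StarAlgebra.subset_adjoin ℂ _ (Set.mem_range_self x))⟩

/-- The raising operator `σ⁺_x`. -/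
def raise (x : ℤ) : QuasiLocal := star (lower x)

/-- The number operator `n_x = σ⁺_x σ⁻_x`. -/
def number (x : ℤ) : QuasiLocal := raise x * lower x

/-- The algebra of all observables supported in the finite set `X`. -/
def localAlgebra (X : Finset ℤ) : StarSubalgebra ℂ QuasiLocal :=
  StarAlgebra.adjoin ℂ (lower '' (X : Set ℤ))

/-! ### States, ground states, clustering -/

/-- States: positive normalised linear functionals. -/
def IsState (f : QuasiLocal →ₗ[ℂ] ℂ) : Prop :=
  (∀ A, 0 ≤ f (star A * A)) ∧ f 1 = 1

/-- Pure states: the extreme points of the convex set of states. -/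
def IsPureState (f : QuasiLocal →ₗ[ℂ] ℂ) : Prop :=
  f ∈ Set.extremePoints ℝ {g : QuasiLocal →ₗ[ℂ] ℂ | IsState g}

/-- `q_x = σ⁻_{x+1} σ⁻_{x+2} - λ σ⁻_x σ⁻_{x+3}`. -/
def pairOp (lam : ℂ) (x : ℤ) : QuasiLocal :=
  lower (x + 1) * lower (x + 2) - lam • (lower x * lower (x + 3))

/-- The Hamiltonian `H_{[a,b]} = ∑_{x=a}^{b-2} n_x n_{x+2} + κ ∑_{x=a}^{b-3} q_x^* q_x`
with open boundary conditions. -/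
def hamiltonian (lam : ℂ) (kappa : ℝ) (a b : ℤ) : QuasiLocal :=
  ∑ x ∈ Finset.Icc a (b - 2), number x * number (x + 2) +
    (kappa : ℂ) • ∑ x ∈ Finset.Icc a (b - 3), star (pairOp lam x) * pairOp lam x

/-- Infinite-volume ground states: states `f` with `f(A^* [H, A]) ≥ 0` for every local observable
`A`. The commutator of `A` with the Hamiltonian of `[-n,n]` does not depend on `n` for large `n`. -/
def IsGroundState (lam : ℂ) (kappa : ℝ) (f : QuasiLocal →ₗ[ℂ] ℂ) : Prop :=
  IsState f ∧ ∀ X : Finset ℤ, ∀ A ∈ localAlgebra X, ∀ᶠ n : ℕ in atTop,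
    0 ≤ f (star A * (hamiltonian lam kappa (-n) n * A - A * hamiltonian lam kappa (-n) n))

/-- Zero-energy (frustration-free) states: all finite-volume Hamiltonians have expectation zero. -/
def HasZeroEnergy (lam : ℂ) (kappa : ℝ) (f : QuasiLocal →ₗ[ℂ] ℂ) : Prop :=
  ∀ a b : ℤ, f (hamiltonian lam kappa a b) = 0

/-- Exponential clustering: exponential decay of correlations between observables on two
intervals in the distance of the intervals; the prefactor may depend on the lengths. -/
def ClustersExponentially (f : QuasiLocal →ₗ[ℂ] ℂ) : Prop :=
  ∃ c : ℝ, 0 < c ∧ ∃ C : ℕ → ℕ → ℝ, ∀ a b a' b' : ℤ, b < a' →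
    ∀ A ∈ localAlgebra (Finset.Icc a b), ∀ B ∈ localAlgebra (Finset.Icc a' b'),
      ‖f (A * B) - f A * f B‖ ≤
        C (Finset.Icc a b).card (Finset.Icc a' b').card * ‖A‖ * ‖B‖ *
          Real.exp (-c * ((a' - b : ℤ) : ℝ))

/-- The truncated density-density correlation `f(n_x n_y) - f(n_x) f(n_y)`. -/
def densityCorr (f : QuasiLocal →ₗ[ℂ] ℂ) (x y : ℤ) : ℂ :=
  f (number x * number y) - f (number x) * f (number y)

/-! ### Void-monomer-dimer tilings and the single-void states -/

/-- The three bulk dominoes. -/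
inductive Domino
  | void
  | monomer
  | dimer
  deriving DecidableEq

/-- The number of sites covered by a domino. -/
def Domino.length : Domino → ℤ
  | .void => 1
  | .monomer => 3
  | .dimer => 6

/-- The reverse replacement rule: a dimer comes from two adjacent monomers. -/
def Domino.root : Domino → List Domino
  | .void => [.void]
  | .monomer => [.monomer]
  | .dimer => [.monomer, .monomer]

/-- All tilings obtained from an ordered root tiling by substituting dimers for pairs of
adjacent monomers. -/
def tilings : List Domino → Finset (List Domino)
  | [] => {[]}
  | .monomer :: .monomer :: R =>
      (tilings (.monomer :: R)).image (List.cons .monomer) ∪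
        (tilings R).image (List.cons .dimer)
  | .dimer :: _ => ∅
  | D :: R => (tilings R).image (List.cons D)

theorem mem_tilings (R D : List Domino) : D ∈ tilings R ↔ D.flatMap Domino.root = R := by
  induction R using tilings.induct generalizing D with
  | case1 =>
    rcases D with _ | ⟨_ | _ | _, D⟩ <;> simp [tilings, Domino.root]
  | case2 R ih1 ih2 =>
    rcases D with _ | ⟨_ | _ | _, D⟩ <;> simp [tilings, Domino.root, ih1, ih2]
  | case3 R =>
    rcases D with _ | ⟨_ | _ | _, D⟩ <;> simp [tilings, Domino.root]
  | case4 E R h1 h2 ih =>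
    rcases E with _ | _ | _
    · rcases D with _ | ⟨_ | _ | _, D⟩ <;> simp [tilings, Domino.root, ih]
    · have hm : tilings (Domino.monomer :: R) = (tilings R).image (List.cons .monomer) := by
        rcases R with _ | ⟨_ | _ | _, R⟩
        · simp [tilings]
        · simp [tilings]
        · exact absurd rfl (h1 R rfl)
        · simp [tilings]
      rw [hm]
      rcases D with _ | ⟨_ | _ | _, D⟩
      · simp
      · simp [Domino.root]
      · simp [Domino.root, ih]
      · simp only [Finset.mem_image, List.cons.injEq, List.flatMap_cons, Domino.root]
        constructor
        · rintro ⟨_, _, h, _⟩; cases h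
        · intro h
          simp only [List.cons_append, List.nil_append, List.cons.injEq, true_and] at h
          exact (h1 _ rfl h.symm).elim
    · exact (h2 rfl).elim

/-- The creation operator of a domino starting at site `x`. -/
def Domino.create (lam : ℂ) (x : ℤ) : Domino → QuasiLocal
  | .void => 1
  | .monomer => raise x
  | .dimer => lam • (raise (x + 1) * raise (x + 2))

/-- The product of the creation operators of consecutive dominoes, the first of which starts at
site `x`. -/
def createTiling (lam : ℂ) : ℤ → List Domino → QuasiLocal
  | _, [] => 1
  | x, D :: T => D.create lam x * createTiling lam (x + D.length) T

/-- The VMD vector of a root tiling (without boundary dominoes) starting at site `x`. All spins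
outside of the tiled interval are down. -/
def vmdVector (lam : ℂ) (x : ℤ) (R : List Domino) : Config :=
  ∑ T ∈ tilings R, (createTiling lam x T).op vacuum

/-- The VMD vector `ψ_k^{(n)} = φ_{n+k} ⊗ |0⟩_{3k} ⊗ φ_{n-k}` on `[-3n,3n]`, for `n ≥ |k|`: its
root tiling has a single void, at `3k`. -/
def singleVoidVector (lam : ℂ) (k : ℤ) (n : ℕ) : Config :=
  vmdVector lam (-3 * n)
    (List.replicate (n + k).toNat .monomer ++ .void :: List.replicate (n - k).toNat .monomer)

/-- The expectation of an observable in the normalised vector `ψ_k^{(n)}`. -/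
def singleVoidExpectation (lam : ℂ) (k : ℤ) (n : ℕ) (A : QuasiLocal) : ℂ :=
  let v : Config := ((‖singleVoidVector lam k n‖⁻¹ : ℝ) : ℂ) • singleVoidVector lam k n
  ⟪v, A.op v⟫_ℂ

/-! ### GNS representation and parameters -/

/-- The functional `A ↦ ⟨Ψ, π(A) Ψ⟩` of a vector `Ψ` in the GNS space of `ρ`. -/
def vectorFunctional (ρ : QuasiLocal →ₚ[ℂ] ℂ) (Ψ : ρ.GNS) : QuasiLocal →ₗ[ℂ] ℂ where
  toFun A := ⟪Ψ, ρ.gnsStarAlgHom A Ψ⟫_ℂ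
  map_add' A B := by
    rw [map_add, add_apply, inner_add_right]
  map_smul' c A := by
    rw [map_smul, smul_apply, inner_smul_right]; rfl

/-- `Δμ = μ₊ - μ₋ = √(1 + 4|λ|²)`. -/
def muDiff (lam : ℂ) : ℝ := Real.sqrt (1 + 4 * ‖lam‖ ^ 2)

/-- `μ₊ = (1 + √(1 + 4|λ|²)) / 2`. -/
def muPlus (lam : ℂ) : ℝ := (1 + Real.sqrt (1 + 4 * ‖lam‖ ^ 2)) / 2

/-- `μ₋ = (1 - √(1 + 4|λ|²)) / 2`. -/
def muMinus (lam : ℂ) : ℝ := (1 - Real.sqrt (1 + 4 * ‖lam‖ ^ 2)) / 2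

/-- `μ = μ₋ / μ₊`, which lies in `(-1, 0]`. -/
def muRatio (lam : ℂ) : ℝ := muMinus lam / muPlus lam

/-- `∑_{k > j} |c_k|²`. -/
def tailMass (c : ℤ → ℂ) (j : ℤ) : ℝ := ∑' k : {k : ℤ // j < k}, ‖c k‖ ^ 2

/-- `S_μ = ∑_{l ≥ 0} |c_l|² μ^l`. -/
def muMass (lam : ℂ) (c : ℤ → ℂ) : ℝ := ∑' l : ℕ, ‖c l‖ ^ 2 * muRatio lam ^ l

end SpinChain

end

open SpinChain

/-! A single-void vector is a product of two chains of monomers and dimers, left and right of the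
void. A leading monomer and a leading dimer give orthogonal vectors, so the squared norms of chains
satisfy w(L+2) = w(L+1) + |λ|² w(L). This is solved by a Binet formula in μ₊ and μ
(`muDiff_mul_chainWeight`), and the ratios w(n-c)/w(n) tend to μ₊^(-c).

Existence of the limits. At the edge of a window a chain is cut either between two dominoes or
inside a dimer (`chain_split`). With two edges there are four window parts. The four outer parts are
pairwise orthogonal, so the expectation of an observable in the window is a sum of four terms whose
weights are ratios of chain norms (`voidExp_eq_sum`). Hence local expectations converge as both
chain lengths tend to infinity, and density of the local observables gives the rest.

Purity. The projections onto the four window parts add up to a projection P_m with ω(P_m) = 1.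
Between interior observables the parts stay orthogonal, and each part is itself a finite single-void
vector. Thus P_m A P_m is a combination of the four projections with coefficients that all tend to
ω(A), so P_m A P_m - ω(A) P_m tends to 0 in norm (`tendsto_norm_suppProj`). If a unit vector of the
GNS space is approximated by the class of b, then b P_m b* compresses observables in the same way to
their expectations in that vector (`exists_compression`). A state dominated by a multiple of a
vector state inherits this compression and must agree with it (`apply_eq_of_dominated`). Hence every
unit vector of the GNS space is a pure state, without a separate irreducibility argument.

One representation. An explicit local observable moves the void by one domino in every long enough
finite volume, with norm ratio tending to one, so each ω_{3k} is a vector state for ω_0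
(`exists_voidState_eq_conj`). The diagonal observable `voidDetector k` looks at the sites 3k+1 and
3k+2. It fixes the vector with void at 3k and annihilates those with a void further to the right,
because the triples of the left chain are aligned differently from those of the right chain.
Therefore the vectors are orthonormal, and on observables commuting with all detectors, such as
polynomials in the number operators, a superposition is the mixture with weights |c_k|².

Zero energy. Each term of the Hamiltonian has the form X*X with X annihilating all VMD vectors, so H
annihilates the superposed vector and ω(A*[H,A]) = ω(A*HA) ≥ 0.

Correlations. A number operator at 3j selects monomers in the left chain and dimers in the right
chain, which cuts that chain in two and yields closed formulas. For a mixture, the law of total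
covariance splits C_j into the mean of the single-void correlations, which is O(|μ|^j), and the
covariance of the single-void densities, which is the double series F_j. As j → ∞ the density at 3j
tends to a constant independent of k, so F_j → 0 by dominated convergence.

Slow decay. Weights 1/((i+1)(i+2)) are put at very sparse sites s_i. The tail 1/(i+2) is then much
larger than the individual weights, while every exponential term, and r_j for j ≥ s_i, is below the
square of a weight. If |λ|²/μ₊ ≠ 1 the tail term dominates for all large j. If |λ|²/μ₊ = 1, that is
|λ|² = 2, the tail terms cancel; but at j = s_i the vanishing density at the void contributes the
single weight, still much larger than r_j. -/

noncomputable section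

/-! ### GNS vectors and a purity criterion by compressing observables -/

namespace PositiveLinearMap

variable {A : Type*} [CStarAlgebra A] [PartialOrder A] [StarOrderedRing A]

/-- The class of `a` in the GNS space. -/
def gnsVec (f : A →ₚ[ℂ] ℂ) (a : A) : f.GNS := ((f.toPreGNS a : f.PreGNS) : f.GNS)

theorem gnsVec_inner (f : A →ₚ[ℂ] ℂ) (a b : A) :
    ⟪f.gnsVec a, f.gnsVec b⟫_ℂ = f (star a * b) := by
  rw [gnsVec, gnsVec, UniformSpace.Completion.inner_coe]
  rfl

theorem gnsStarAlgHom_gnsVec (f : A →ₚ[ℂ] ℂ) (a b : A) :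
    f.gnsStarAlgHom a (f.gnsVec b) = f.gnsVec (a * b) := by
  simp only [gnsVec, gnsStarAlgHom_apply]
  exact f.gnsNonUnitalStarAlgHom_apply_coe

theorem gnsVec_sub (f : A →ₚ[ℂ] ℂ) (a b : A) :
    f.gnsVec (a - b) = f.gnsVec a - f.gnsVec b := by
  simp only [gnsVec, map_sub, UniformSpace.Completion.coe_sub]

theorem gnsVec_smul (f : A →ₚ[ℂ] ℂ) (c : ℂ) (a : A) :
    f.gnsVec (c • a) = c • f.gnsVec a := by
  simp only [gnsVec, map_smul, UniformSpace.Completion.coe_smul]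

theorem norm_sq_gnsVec (f : A →ₚ[ℂ] ℂ) (a : A) : ((‖f.gnsVec a‖ ^ 2 : ℝ) : ℂ) = f (star a * a) := by
  rw [← gnsVec_inner, inner_self_eq_norm_sq_to_K]; norm_cast

theorem denseRange_gnsVec (f : A →ₚ[ℂ] ℂ) : DenseRange f.gnsVec :=
  UniformSpace.Completion.denseRange_coe.comp f.toPreGNS.surjective.denseRange
    (UniformSpace.Completion.continuous_coe _)

theorem norm_gnsStarAlgHom_le (f : A →ₚ[ℂ] ℂ) (a : A) : ‖f.gnsStarAlgHom a‖ ≤ ‖a‖ :=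
  NonUnitalStarAlgHom.norm_apply_le f.gnsStarAlgHom a

theorem norm_gnsStarAlgHom_apply_le (f : A →ₚ[ℂ] ℂ) (a : A) (x : f.GNS) :
    ‖f.gnsStarAlgHom a x‖ ≤ ‖a‖ * ‖x‖ :=
  ((f.gnsStarAlgHom a).le_opNorm x).trans
    (mul_le_mul_of_nonneg_right (f.norm_gnsStarAlgHom_le a) (norm_nonneg x))

theorem inner_gnsStarAlgHom_left (f : A →ₚ[ℂ] ℂ) (a : A) (x y : f.GNS) :
    ⟪f.gnsStarAlgHom a x, y⟫_ℂ = ⟪x, f.gnsStarAlgHom (star a) y⟫_ℂ := by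
  rw [map_star, ContinuousLinearMap.star_eq_adjoint, ContinuousLinearMap.adjoint_inner_right]

theorem apply_eq_inner_gnsVec_one (f : A →ₚ[ℂ] ℂ) (a : A) :
    f a = ⟪f.gnsVec 1, f.gnsStarAlgHom a (f.gnsVec 1)⟫_ℂ := by
  rw [gnsStarAlgHom_gnsVec, gnsVec_inner]; simp

theorem norm_gnsVec_one (f : A →ₚ[ℂ] ℂ) (hf : f 1 = 1) : ‖f.gnsVec 1‖ = 1 := by
  have h := f.norm_sq_gnsVec 1
  simp only [star_one, mul_one, hf] at h
  have h' : ‖f.gnsVec 1‖ ^ 2 = 1 := by exact_mod_cast h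
  exact (pow_eq_one_iff_of_nonneg (norm_nonneg _) two_ne_zero).1 h'

theorem norm_apply_le_of_map_one (f : A →ₚ[ℂ] ℂ) (hf : f 1 = 1) (a : A) : ‖f a‖ ≤ ‖a‖ := by
  rw [apply_eq_inner_gnsVec_one]
  refine (norm_inner_le_norm _ _).trans ?_
  have := f.norm_gnsStarAlgHom_apply_le a (f.gnsVec 1)
  rw [f.norm_gnsVec_one hf] at this ⊢
  linarith

/-- A state dominated by a functional `f` agrees with `f` at `a` if `a` is compressed to `f a` by
approximate projections of full weight. -/
theorem apply_eq_of_dominated (g : A →ₚ[ℂ] ℂ) (hg : g 1 = 1) (f : A →ₗ[ℂ] ℂ) (C : ℝ)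
    (hC0 : 0 ≤ C) (hC : ∀ a, (g (star a * a)).re ≤ C * (f (star a * a)).re) (a : A)
    (h : ∀ ε > 0, ∃ e : A, IsSelfAdjoint e ∧ (f ((1 - e) * (1 - e))).re ≤ ε ^ 2 ∧
      ‖e * a * e - f a • e‖ ≤ ε) : g a = f a := by
  set s := Real.sqrt C
  have hs : 0 ≤ s := Real.sqrt_nonneg C
  have key : ∀ ε : ℝ, 0 < ε → ε ≤ 1 → ‖g a - f a‖ ≤ (‖a‖ * (2 * s + s * s) + 1 + ‖f a‖ * s) * ε := by
    intro ε hε hε1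
    obtain ⟨e, he, he1, he2⟩ := h ε hε
    set x := g.gnsVec 1 with hx
    set y := g.gnsVec (1 - e) with hy
    have hx1 : ‖x‖ = 1 := g.norm_gnsVec_one hg
    have hse : star (1 - e) = 1 - e := by simp [he.star_eq]
    have hy1 : ‖y‖ ≤ s * ε := by
      have h1 : ‖y‖ ^ 2 = (g (star (1 - e) * (1 - e))).re := by
        rw [← g.norm_sq_gnsVec, Complex.ofReal_re]
      have h2 := hC (1 - e)
      rw [← h1, hse] at h2
      have h3 : ‖y‖ ^ 2 ≤ (s * ε) ^ 2 := by
        rw [mul_pow, Real.sq_sqrt hC0]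
        exact h2.trans (mul_le_mul_of_nonneg_left he1 hC0)
      exact (sq_le_sq₀ (norm_nonneg _) (by positivity)).1 h3
    have e1 : g ((1 - e) * a) = ⟪y, g.gnsStarAlgHom a x⟫_ℂ := by
      rw [gnsStarAlgHom_gnsVec, gnsVec_inner, hse, mul_one]
    have e2 : g (a * (1 - e)) = ⟪x, g.gnsStarAlgHom a y⟫_ℂ := by
      rw [gnsStarAlgHom_gnsVec, gnsVec_inner, star_one, one_mul]
    have e3 : g ((1 - e) * a * (1 - e)) = ⟪y, g.gnsStarAlgHom a y⟫_ℂ := by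
      rw [gnsStarAlgHom_gnsVec, gnsVec_inner, hse, mul_assoc]
    have e4 : g (1 - e) = ⟪x, y⟫_ℂ := by
      rw [gnsVec_inner, star_one, one_mul]
    have hb : ∀ u v : g.GNS, ‖⟪u, g.gnsStarAlgHom a v⟫_ℂ‖ ≤ ‖u‖ * (‖a‖ * ‖v‖) := fun u v =>
      (norm_inner_le_norm u _).trans
        (mul_le_mul_of_nonneg_left (g.norm_gnsStarAlgHom_apply_le a v) (norm_nonneg u))
    -- Replacing a by e a e costs only terms containing 1 - e. Their expectations are inner products
    -- with y, the class of 1 - e, and domination by C f gives ‖y‖ ≤ √C ε.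
    have dec : g a - f a = g ((1 - e) * a) + g (a * (1 - e)) - g ((1 - e) * a * (1 - e))
        + g (e * a * e - f a • e) - f a * g (1 - e) := by
      have h1 : (1 - e) * a + a * (1 - e) - (1 - e) * a * (1 - e) = a - e * a * e := by noncomm_ring
      rw [← map_add, ← map_sub, h1]
      simp only [map_sub, map_smul, smul_eq_mul, hg]
      ring
    rw [dec]
    have n1 : ‖g ((1 - e) * a)‖ ≤ ‖a‖ * (s * ε) := by
      rw [e1]; refine (hb _ _).trans ?_
      rw [hx1, mul_one, mul_comm]; gcongr
    have n2 : ‖g (a * (1 - e))‖ ≤ ‖a‖ * (s * ε) := by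
      rw [e2]; refine (hb _ _).trans ?_
      rw [hx1, one_mul]; gcongr
    have n3 : ‖g ((1 - e) * a * (1 - e))‖ ≤ ‖a‖ * (s * s * ε) := by
      rw [e3]; refine (hb _ _).trans ?_
      calc ‖y‖ * (‖a‖ * ‖y‖) ≤ (s * ε) * (‖a‖ * (s * 1)) := by
            gcongr
            exact hy1.trans (by gcongr)
        _ = _ := by ring
    have n4 : ‖g (e * a * e - f a • e)‖ ≤ ε := (g.norm_apply_le_of_map_one hg _).trans he2
    have n5 : ‖f a * g (1 - e)‖ ≤ ‖f a‖ * (s * ε) := by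
      rw [norm_mul, e4]
      gcongr
      refine (norm_inner_le_norm _ _).trans ?_
      rw [hx1, one_mul]; exact hy1
    refine (norm_sub_le _ _).trans ?_
    refine (add_le_add ((norm_add_le _ _).trans (add_le_add ((norm_sub_le _ _).trans
      (add_le_add ((norm_add_le _ _).trans (add_le_add n1 n2)) n3)) n4)) n5).trans ?_
    apply le_of_eq; ring
  set K := ‖a‖ * (2 * s + s * s) + 1 + ‖f a‖ * s
  have hK : 0 < K := by positivity
  rw [← sub_eq_zero, ← norm_le_zero_iff]
  refine le_of_forall_pos_le_add fun δ hδ => ?_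
  have := key (min 1 (δ / K)) (by positivity) (min_le_left _ _)
  rw [zero_add]
  refine this.trans ?_
  calc K * min 1 (δ / K) ≤ K * (δ / K) := by gcongr; exact min_le_right _ _
    _ = δ := by field_simp

/-- If projections `P n` of full weight compress every observable to a multiple of themselves
asymptotically, then every unit vector of the GNS space is asymptotically the range of an
observable that compresses all observables to their expectation. -/
theorem exists_compression (f : A →ₚ[ℂ] ℂ) (P : ℕ → A)
    (hPs : ∀ n, IsSelfAdjoint (P n)) (hPP : ∀ n, P n * P n = P n) (hP1 : ∀ n, f (P n) = 1)
    (hf : f 1 = 1) (hP : ∀ a, Tendsto (fun n => ‖P n * a * P n - f a • P n‖) atTop (𝓝 0))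
    (x : f.GNS) (hx : ‖x‖ = 1) (a : A) (ε : ℝ) (hε : 0 < ε) :
    ∃ e : A, IsSelfAdjoint e ∧ ‖x - f.gnsStarAlgHom e x‖ ≤ ε ∧
      ‖e * a * e - ⟪x, f.gnsStarAlgHom a x⟫_ℂ • e‖ ≤ ε := by
  -- The error budget: the vector estimate below costs ε/2 + 12δ and the compression estimate ε/2 +
  -- 15‖a‖δ, so 24δ ≤ ε and 30‖a‖δ ≤ ε suffice.
  set δ := min 1 (ε / (24 + 30 * ‖a‖)) with hδ
  have hδ0 : 0 < δ := by positivity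
  have hδ1 : δ ≤ 1 := min_le_left _ _
  have hδ2 : (24 + 30 * ‖a‖) * δ ≤ ε := by
    calc (24 + 30 * ‖a‖) * δ ≤ (24 + 30 * ‖a‖) * (ε / (24 + 30 * ‖a‖)) := by
          gcongr; exact min_le_right _ _
      _ = ε := by field_simp
  obtain ⟨b, hb⟩ := f.denseRange_gnsVec.exists_dist_lt x hδ0
  rw [dist_eq_norm] at hb
  set y := f.gnsVec b with hy
  have hy2 : ‖y‖ ≤ 1 + δ := by
    have := norm_sub_norm_le y x
    rw [norm_sub_rev] at this
    linarith
  have hy3 : 1 - δ ≤ ‖y‖ := by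
    have := norm_sub_norm_le x y
    linarith
  set s := ‖y‖ ^ 2 with hs
  have hsf : f (star b * b) = (s : ℂ) := (f.norm_sq_gnsVec b).symm
  have hs1 : |1 - s| ≤ 3 * δ := by
    rw [abs_le]; constructor <;> nlinarith [norm_nonneg y]
  have ht1 := hP (star b * b)
  have ht2 := hP (star b * a * b)
  have ev1 : ∀ᶠ n in atTop, ‖P n * (star b * b) * P n - f (star b * b) • P n‖ <
      min 1 (ε / (2 * (‖b‖ + 1))) := ht1.eventually_lt_const (by positivity)
  have ev2 : ∀ᶠ n in atTop, ‖P n * (star b * a * b) * P n - f (star b * a * b) • P n‖ <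
      ε / (2 * (‖b‖ + 1) ^ 2) := ht2.eventually_lt_const (by positivity)
  obtain ⟨n, h1, h2⟩ := (ev1.and ev2).exists
  have hPn : ‖P n‖ ≤ 1 := by
    have h := CStarRing.norm_star_mul_self (x := P n)
    rw [(hPs n).star_eq, hPP n] at h
    nlinarith [norm_nonneg (P n)]
  -- A projection of expectation one fixes the cyclic vector, since ‖(P - 1)ξ‖² = f(1 - P) = 0.
  have hPx : f.gnsStarAlgHom (P n) (f.gnsVec 1) = f.gnsVec 1 := by
    rw [gnsStarAlgHom_gnsVec, mul_one, ← sub_eq_zero, ← gnsVec_sub, ← norm_eq_zero,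
      ← sq_eq_zero_iff]
    have := f.norm_sq_gnsVec (P n - 1)
    have h0 : star (P n - 1) * (P n - 1) = 1 - P n := by
      simp [(hPs n).star_eq, mul_sub, sub_mul, hPP n]
    rw [h0, map_sub, hf, hP1, sub_self] at this
    exact_mod_cast this
  have hrep : f.gnsVec (b * P n) = y := by
    rw [hy, ← mul_one (b * P n), mul_assoc, ← gnsStarAlgHom_gnsVec, ← gnsStarAlgHom_gnsVec, hPx,
      gnsStarAlgHom_gnsVec, mul_one]
  -- On the class y of b this acts as b P (b*b) P ≈ s b P, hence as multiplication by s ≈ 1.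
  -- Moreover e a e = b P (b* a b) P b* ≈ f(b* a b) e, where f(b* a b) is the expectation of a in y.
  set e := b * P n * star b with he
  have hes : IsSelfAdjoint e := by
    rw [IsSelfAdjoint, he, star_mul, star_mul, star_star, (hPs n).star_eq, mul_assoc]
  -- There is no control of ‖b‖ in terms of y, but the C*-identity turns ‖e‖ into ‖P b*b P‖, which
  -- is within 1 of s‖P‖ ≤ 4.
  have hnorm : ‖e‖ ≤ 5 := by
    have h3 : e = (b * P n) * star (b * P n) := by
      rw [star_mul, (hPs n).star_eq, he, mul_assoc b (P n) (P n * star b), ← mul_assoc (P n) (P n),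
        hPP n, mul_assoc]
    have h4 : star (b * P n) * (b * P n) = P n * (star b * b) * P n := by
      rw [star_mul, (hPs n).star_eq]; noncomm_ring
    rw [h3, CStarRing.norm_self_mul_star, ← CStarRing.norm_star_mul_self, h4]
    have h5 : ‖P n * (star b * b) * P n‖ ≤ 1 + ‖f (star b * b) • P n‖ := by
      have := norm_le_norm_add_norm_sub' (P n * (star b * b) * P n) (f (star b * b) • P n)
      linarith [h1.le.trans (min_le_left _ _)]
    rw [norm_smul, hsf, Complex.norm_real, Real.norm_of_nonneg (by positivity)] at h5
    have : s * ‖P n‖ ≤ s * 1 := by gcongr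
    have : s ≤ 4 := by nlinarith [norm_nonneg y]
    linarith
  refine ⟨e, hes, ?_, ?_⟩
  · have h6 : ‖(s : ℂ) • y - f.gnsStarAlgHom e y‖ ≤ ε / 2 := by
      have : (s : ℂ) • y - f.gnsStarAlgHom e y =
          - f.gnsStarAlgHom (b * (P n * (star b * b) * P n - f (star b * b) • P n))
            (f.gnsVec 1) := by
        have h8 : (s : ℂ) • y = f.gnsVec (b * (s : ℂ) • P n) := by
          rw [mul_smul_comm, gnsVec_smul, hrep]
        have h9 : f.gnsStarAlgHom e y = f.gnsVec (b * (P n * (star b * b) * P n)) := by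
          rw [← hrep, gnsStarAlgHom_gnsVec, he]; congr 1; noncomm_ring
        rw [h8, h9, ← gnsVec_sub, gnsStarAlgHom_gnsVec, mul_one, hsf, ← neg_one_smul ℂ,
          ← gnsVec_smul]
        congr 1
        rw [neg_one_smul, mul_sub, neg_sub]
      rw [this, norm_neg]
      refine (f.norm_gnsStarAlgHom_apply_le _ _).trans ?_
      rw [f.norm_gnsVec_one hf, mul_one]
      refine (norm_mul_le _ _).trans ?_
      calc ‖b‖ * _ ≤ (‖b‖ + 1) * (ε / (2 * (‖b‖ + 1))) := by
            gcongr
            · linarith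
            · exact h1.le.trans (min_le_right _ _)
        _ = ε / 2 := by field_simp
    have h7 : ‖f.gnsStarAlgHom e (y - x)‖ ≤ 5 * δ := by
      refine (f.norm_gnsStarAlgHom_apply_le _ _).trans ?_
      rw [norm_sub_rev]
      gcongr
    have h8 : ‖((1 - s : ℝ) : ℂ) • y‖ ≤ 6 * δ := by
      rw [norm_smul, Complex.norm_real, Real.norm_eq_abs]
      calc |1 - s| * ‖y‖ ≤ 3 * δ * 2 := by gcongr; linarith
        _ = 6 * δ := by ring
    have dec : x - f.gnsStarAlgHom e x = (x - y) + ((1 - s : ℝ) : ℂ) • y +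
        ((s : ℂ) • y - f.gnsStarAlgHom e y) + f.gnsStarAlgHom e (y - x) := by
      rw [map_sub, Complex.ofReal_sub, Complex.ofReal_one, sub_smul, one_smul]; abel
    rw [dec]
    refine (norm_add_le _ _).trans ?_
    refine (add_le_add ((norm_add_le _ _).trans (add_le_add ((norm_add_le _ _).trans
      (add_le_add hb.le h8)) h6)) h7).trans ?_
    nlinarith [norm_nonneg a]
  · have h9 : ‖f (star b * a * b) - ⟪x, f.gnsStarAlgHom a x⟫_ℂ‖ ≤ 3 * ‖a‖ * δ := by
      have e1 : f (star b * a * b) = ⟪y, f.gnsStarAlgHom a y⟫_ℂ := by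
        rw [gnsStarAlgHom_gnsVec, gnsVec_inner, mul_assoc]
      have e2 : ⟪y, f.gnsStarAlgHom a y⟫_ℂ - ⟪x, f.gnsStarAlgHom a x⟫_ℂ =
          ⟪y - x, f.gnsStarAlgHom a y⟫_ℂ + ⟪x, f.gnsStarAlgHom a (y - x)⟫_ℂ := by
        rw [inner_sub_left, map_sub, inner_sub_right]; ring
      rw [e1, e2]
      refine (norm_add_le _ _).trans ((add_le_add (norm_inner_le_norm _ _)
        (norm_inner_le_norm _ _)).trans ?_)
      have n1 := f.norm_gnsStarAlgHom_apply_le a y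
      have n2 := f.norm_gnsStarAlgHom_apply_le a (y - x)
      have n3 : ‖y - x‖ ≤ δ := by rw [norm_sub_rev]; exact hb.le
      rw [hx, one_mul]
      calc ‖y - x‖ * ‖f.gnsStarAlgHom a y‖ + ‖f.gnsStarAlgHom a (y - x)‖
          ≤ δ * (‖a‖ * 2) + ‖a‖ * δ := by
            gcongr
            · exact n1.trans (by gcongr; linarith)
            · exact n2.trans (by gcongr)
        _ = 3 * ‖a‖ * δ := by ring
    have dec : e * a * e - ⟪x, f.gnsStarAlgHom a x⟫_ℂ • e =
        b * (P n * (star b * a * b) * P n - f (star b * a * b) • P n) * star b +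
        (f (star b * a * b) - ⟪x, f.gnsStarAlgHom a x⟫_ℂ) • e := by
      rw [sub_smul, mul_sub, sub_mul, mul_smul_comm, smul_mul_assoc, ← he]
      have : e * a * e = b * (P n * (star b * a * b) * P n) * star b := by
        rw [he]; noncomm_ring
      rw [this]; abel
    rw [dec]
    refine (norm_add_le _ _).trans ?_
    rw [norm_smul]
    have n1 : ‖b * (P n * (star b * a * b) * P n - f (star b * a * b) • P n) * star b‖ ≤ ε / 2 := by
      refine (norm_mul_le _ _).trans ?_
      rw [norm_star]
      calc _ ≤ (‖b‖ * (ε / (2 * (‖b‖ + 1) ^ 2))) * ‖b‖ := by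
            gcongr
            refine (norm_mul_le _ _).trans ?_
            gcongr
        _ ≤ ((‖b‖ + 1) * (ε / (2 * (‖b‖ + 1) ^ 2))) * (‖b‖ + 1) := by gcongr <;> linarith
        _ = ε / 2 := by field_simp
    calc _ ≤ ε / 2 + 3 * ‖a‖ * δ * 5 := by gcongr
      _ ≤ ε := by linarith

end PositiveLinearMap

end


noncomputable section

/-! ### Operator relations on the configuration basis -/

namespace SpinChain

theorem op_add (A B : QuasiLocal) : (A + B).op = A.op + B.op := rfl
theorem op_sub (A B : QuasiLocal) : (A - B).op = A.op - B.op := rfl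
theorem op_one : (1 : QuasiLocal).op = 1 := rfl
theorem op_zero : (0 : QuasiLocal).op = 0 := rfl
theorem op_mul_apply (A B : QuasiLocal) (f : Config) : (A * B).op f = A.op (B.op f) := rfl
theorem op_one_apply (f : Config) : (1 : QuasiLocal).op f = f := rfl
theorem op_smul (c : ℂ) (A : QuasiLocal) : (c • A).op = c • A.op := rfl
theorem op_star (A : QuasiLocal) : (star A).op = ContinuousLinearMap.adjoint A.op := rfl
theorem op_lower (x : ℤ) : (lower x).op = spinLower x := rfl
theorem op_algebraMap (c : ℂ) : (algebraMap ℂ QuasiLocal c).op = c • 1 := by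
  rw [Algebra.algebraMap_eq_smul_one, op_smul, op_one]
theorem norm_op (A : QuasiLocal) : ‖A.op‖ = ‖A‖ := rfl

theorem op_injective : Function.Injective QuasiLocal.op := Subtype.val_injective

theorem op_sum {ι : Type*} (s : Finset ι) (f : ι → QuasiLocal) :
    (∑ i ∈ s, f i).op = ∑ i ∈ s, (f i).op :=
  map_sum (⟨⟨QuasiLocal.op, op_zero⟩, op_add⟩ : QuasiLocal →+ (Config →L[ℂ] Config)) f s

theorem inner_ket (S T : Finset ℤ) : ⟪ket S, ket T⟫_ℂ = if S = T then 1 else 0 := by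
  rw [ket, lp.inner_single_left]
  simp [ket, lp.single_apply, Pi.single_apply]

theorem ext_ket {T T' : Config →L[ℂ] Config} (h : ∀ S, T (ket S) = T' (ket S)) : T = T' := by
  ext1 f
  have hs := lp.hasSum_single (p := 2) (by norm_num) f
  have e : ∀ S : Finset ℤ, (lp.single 2 S (f S) : Config) = f S • ket S := by
    intro S
    rw [ket, ← lp.single_smul, smul_eq_mul, mul_one]
  simp only [e] at hs
  have h1 := hs.mapL T
  have h2 := hs.mapL T'
  simp only [map_smul, h] at h1 h2
  exact h1.unique h2

theorem raise_ket (x : ℤ) (S : Finset ℤ) :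
    (raise x).op (ket S) = if x ∈ S then 0 else ket (insert x S) := by
  have key : ∀ T, ⟪ket T, (raise x).op (ket S)⟫_ℂ =
      ⟪ket T, if x ∈ S then 0 else ket (insert x S)⟫_ℂ := by
    intro T
    rw [raise, op_star, ContinuousLinearMap.adjoint_inner_right, op_lower, spinLower_ket]
    by_cases hT : x ∈ T
    · by_cases hS : x ∈ S
      · have : T.erase x ≠ S := fun h => by simp [← h] at hS
        simp [hT, hS, inner_ket, this]
      · have : T.erase x = S ↔ T = insert x S := by
          constructor
          · rintro rfl; simp [Finset.insert_erase hT]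
          · rintro rfl; simp [Finset.erase_insert hS]
        simp [hT, hS, inner_ket, this]
    · by_cases hS : x ∈ S
      · simp [hT, hS]
      · have : T ≠ insert x S := fun h => hT (h ▸ Finset.mem_insert_self x S)
        simp [hT, hS, inner_ket, this]
  ext T
  have := key T
  rw [ket, lp.inner_single_left, lp.inner_single_left] at this
  simpa using this

theorem lower_ket (x : ℤ) (S : Finset ℤ) :
    (lower x).op (ket S) = if x ∈ S then ket (S.erase x) else 0 := spinLower_ket x S

theorem ext_op_ket {A B : QuasiLocal} (h : ∀ S, A.op (ket S) = B.op (ket S)) : A = B :=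
  op_injective (ext_ket h)

theorem lower_mul_self (x : ℤ) : lower x * lower x = 0 := by
  refine ext_op_ket fun S => ?_
  rw [op_zero, op_mul_apply, lower_ket]
  split_ifs <;> simp [lower_ket]

theorem lower_mul_raise (x : ℤ) : lower x * raise x = 1 - raise x * lower x := by
  refine ext_op_ket fun S => ?_
  simp only [op_sub, sub_apply, op_mul_apply, op_one_apply, raise_ket, lower_ket]
  by_cases h : x ∈ S <;> simp [h, raise_ket, lower_ket, Finset.insert_erase]

theorem commute_lower_lower (x y : ℤ) : Commute (lower x) (lower y) := by
  refine ext_op_ket fun S => ?_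
  simp only [op_mul_apply, lower_ket]
  rcases eq_or_ne x y with rfl | hxy
  · rfl
  by_cases h : x ∈ S <;> by_cases h' : y ∈ S <;>
    simp [h, h', lower_ket, hxy, hxy.symm, Finset.erase_right_comm]

theorem commute_lower_raise {x y : ℤ} (hxy : x ≠ y) : Commute (lower x) (raise y) := by
  refine ext_op_ket fun S => ?_
  simp only [op_mul_apply, lower_ket, raise_ket]
  by_cases h : x ∈ S <;> by_cases h' : y ∈ S <;>
    simp [h, h', lower_ket, raise_ket, hxy, hxy.symm, Finset.erase_insert_of_ne]

theorem star_raise (x : ℤ) : star (raise x) = lower x := star_star _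
theorem star_lower (x : ℤ) : star (lower x) = raise x := rfl

theorem commute_raise_raise (x y : ℤ) : Commute (raise x) (raise y) := by
  have := (commute_lower_lower x y).star_star
  simpa only [star_lower] using this

theorem raise_mul_self (x : ℤ) : raise x * raise x = 0 := by
  rw [raise, ← star_mul, lower_mul_self, star_zero]

theorem star_number (x : ℤ) : star (number x) = number x := by
  rw [number, star_mul, star_raise, star_lower]

theorem number_ket (x : ℤ) (S : Finset ℤ) :
    (number x).op (ket S) = if x ∈ S then ket S else 0 := by
  rw [number, op_mul_apply, lower_ket]
  by_cases h : x ∈ S <;> simp [h, raise_ket, Finset.insert_erase]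

theorem number_mul_self (x : ℤ) : number x * number x = number x := by
  refine ext_op_ket fun S => ?_
  simp only [op_mul_apply, number_ket]
  split_ifs with h <;> simp [number_ket, h]

theorem commute_number_number (x y : ℤ) : Commute (number x) (number y) := by
  refine ext_op_ket fun S => ?_
  simp only [op_mul_apply, number_ket]
  by_cases h : x ∈ S <;> by_cases h' : y ∈ S <;> simp [h, h', number_ket]

theorem norm_number_le (x : ℤ) : ‖number x‖ ≤ 1 := by
  have h := CStarRing.norm_star_mul_self (x := number x)
  rw [star_number, number_mul_self] at h
  nlinarith [norm_nonneg (number x)]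

/-! ### Local algebras -/

theorem localAlgebra_eq (X : Finset ℤ) : (localAlgebra X).toSubalgebra =
    Algebra.adjoin ℂ (lower '' (X : Set ℤ) ∪ raise '' (X : Set ℤ)) := by
  rw [localAlgebra, StarAlgebra.adjoin_toSubalgebra]
  congr 2
  ext A
  simp only [Set.mem_star, Set.mem_image]
  constructor
  · rintro ⟨x, hx, h⟩; exact ⟨x, hx, by rw [← star_lower, h, star_star]⟩
  · rintro ⟨x, hx, rfl⟩; exact ⟨x, hx, (star_raise x).symm⟩

theorem localAlgebra_mono {X Y : Finset ℤ} (h : X ⊆ Y) : localAlgebra X ≤ localAlgebra Y :=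
  StarAlgebra.adjoin_mono (Set.image_mono (by exact_mod_cast h))

theorem lower_mem {X : Finset ℤ} {x : ℤ} (h : x ∈ X) : lower x ∈ localAlgebra X :=
  StarAlgebra.subset_adjoin ℂ _ ⟨x, h, rfl⟩

theorem raise_mem {X : Finset ℤ} {x : ℤ} (h : x ∈ X) : raise x ∈ localAlgebra X :=
  star_mem (lower_mem h)

theorem number_mem {X : Finset ℤ} {x : ℤ} (h : x ∈ X) : number x ∈ localAlgebra X :=
  mul_mem (raise_mem h) (lower_mem h)

-- Raising operators are the adjoints of the generators, so listing them as generators too removes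
-- the star case from inductions.
@[elab_as_elim]
theorem localAlgebra_induction {X : Finset ℤ} {p : (A : QuasiLocal) → A ∈ localAlgebra X → Prop}
    (lower : ∀ x (hx : x ∈ X), p (lower x) (lower_mem hx))
    (raise : ∀ x (hx : x ∈ X), p (raise x) (raise_mem hx))
    (scalar : ∀ c, p (algebraMap ℂ QuasiLocal c) (algebraMap_mem _ c))
    (add : ∀ A B hA hB, p A hA → p B hB → p (A + B) (add_mem hA hB))
    (mul : ∀ A B hA hB, p A hA → p B hB → p (A * B) (mul_mem hA hB))
    {A : QuasiLocal} (hA : A ∈ localAlgebra X) : p A hA := by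
  have e : ∀ A, A ∈ Algebra.adjoin ℂ (SpinChain.lower '' (X : Set ℤ) ∪
      SpinChain.raise '' (X : Set ℤ)) ↔ A ∈ localAlgebra X := by
    intro A; rw [← localAlgebra_eq]; exact Iff.rfl
  refine Algebra.adjoin_induction (p := fun A h => p A ((e A).1 h)) ?_ scalar
    (fun A B _ _ => add A B _ _) (fun A B _ _ => mul A B _ _) ((e A).2 hA)
  rintro B (⟨x, hx, rfl⟩ | ⟨x, hx, rfl⟩)
  · exact lower x hx
  · exact raise x hx

theorem commute_lower_of_mem {X : Finset ℤ} {x : ℤ} (hx : x ∉ X) {A : QuasiLocal}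
    (hA : A ∈ localAlgebra X) : Commute (lower x) A := by
  induction hA using localAlgebra_induction with
  | lower y _ => exact commute_lower_lower x y
  | raise y hy => exact commute_lower_raise (fun h => hx (h ▸ hy))
  | scalar c => exact (Algebra.commutes c _).symm
  | add A B _ _ hA hB => exact hA.add_right hB
  | mul A B _ _ hA hB => exact hA.mul_right hB

theorem commute_raise_of_mem {X : Finset ℤ} {x : ℤ} (hx : x ∉ X) {A : QuasiLocal}
    (hA : A ∈ localAlgebra X) : Commute (raise x) A := by
  have := (commute_lower_of_mem hx (star_mem hA)).star_star
  rwa [star_lower, star_star] at this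

theorem commute_of_disjoint {X Y : Finset ℤ} (h : Disjoint X Y) {A B : QuasiLocal}
    (hA : A ∈ localAlgebra X) (hB : B ∈ localAlgebra Y) : Commute A B := by
  induction hA using localAlgebra_induction with
  | lower y hy => exact commute_lower_of_mem (Finset.disjoint_left.1 h hy) hB
  | raise y hy => exact commute_raise_of_mem (Finset.disjoint_left.1 h hy) hB
  | scalar c => exact Algebra.commutes c _
  | add A B _ _ hA hB => exact hA.add_left hB
  | mul A B _ _ hA hB => exact hA.mul_left hB

/-- The strictly local observables are dense. -/
theorem exists_local_approx (A : QuasiLocal) {ε : ℝ} (hε : 0 < ε) :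
    ∃ X : Finset ℤ, ∃ B ∈ localAlgebra X, ‖A - B‖ < ε := by
  have hmem : A.op ∈ closure ((StarAlgebra.adjoin ℂ (Set.range spinLower) :
      StarSubalgebra ℂ (Config →L[ℂ] Config)) : Set (Config →L[ℂ] Config)) := A.2
  obtain ⟨T, hT, hd⟩ := Metric.mem_closure_iff.1 hmem ε hε
  have key : ∃ X : Finset ℤ, ∃ B ∈ localAlgebra X, B.op = T := by
    replace hT : T ∈ StarAlgebra.adjoin ℂ (Set.range spinLower) := hT
    clear hd
    induction hT using StarAlgebra.adjoin_induction with
    | mem T h =>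
      obtain ⟨x, rfl⟩ := h
      exact ⟨{x}, lower x, lower_mem (Finset.mem_singleton_self x), rfl⟩
    | algebraMap c =>
      exact ⟨∅, algebraMap ℂ _ c, algebraMap_mem _ c, by
        rw [op_algebraMap, Algebra.algebraMap_eq_smul_one]⟩
    | add T T' _ _ h h' =>
      obtain ⟨X, B, hB, rfl⟩ := h
      obtain ⟨X', B', hB', rfl⟩ := h'
      exact ⟨X ∪ X', B + B', add_mem (localAlgebra_mono Finset.subset_union_left hB)
        (localAlgebra_mono Finset.subset_union_right hB'), rfl⟩
    | mul T T' _ _ h h' =>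
      obtain ⟨X, B, hB, rfl⟩ := h
      obtain ⟨X', B', hB', rfl⟩ := h'
      exact ⟨X ∪ X', B * B', mul_mem (localAlgebra_mono Finset.subset_union_left hB)
        (localAlgebra_mono Finset.subset_union_right hB'), rfl⟩
    | star T _ h =>
      obtain ⟨X, B, hB, rfl⟩ := h
      exact ⟨X, star B, star_mem hB, rfl⟩
  obtain ⟨X, B, hB, rfl⟩ := key
  refine ⟨X, B, hB, ?_⟩
  rw [dist_eq_norm, ← op_sub, norm_op] at hd
  exact hd

/-! ### The vacuum expectation -/

/-- The vacuum expectation value. -/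
def vacExp : QuasiLocal →ₗ[ℂ] ℂ where
  toFun A := ⟪vacuum, A.op vacuum⟫_ℂ
  map_add' A B := by rw [op_add, add_apply, inner_add_right]
  map_smul' c A := by rw [op_smul, smul_apply, inner_smul_right]; rfl

theorem vacExp_apply (A : QuasiLocal) : vacExp A = ⟪vacuum, A.op vacuum⟫_ℂ := rfl

theorem lower_vacuum (x : ℤ) : (lower x).op vacuum = 0 := by
  rw [vacuum, lower_ket]; simp

theorem vacExp_one : vacExp 1 = 1 := by
  rw [vacExp_apply, op_one_apply, vacuum, inner_ket]; simp

theorem vacExp_star_mul (A B : QuasiLocal) :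
    vacExp (star A * B) = ⟪A.op vacuum, B.op vacuum⟫_ℂ := by
  rw [vacExp_apply, op_mul_apply, op_star,
    ContinuousLinearMap.adjoint_inner_right]

theorem vacExp_star (A : QuasiLocal) : vacExp (star A) = star (vacExp A) := by
  have h := vacExp_star_mul A 1
  rw [mul_one, op_one_apply] at h
  rw [h, vacExp_apply, ← inner_conj_symm]; rfl

theorem vacExp_mul_lower (A : QuasiLocal) (x : ℤ) : vacExp (A * lower x) = 0 := by
  rw [vacExp_apply, op_mul_apply, lower_vacuum, map_zero,
    inner_zero_right]

theorem vacExp_raise_mul (A : QuasiLocal) (x : ℤ) : vacExp (raise x * A) = 0 := by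
  rw [raise, vacExp_star_mul, op_lower, ← op_lower, lower_vacuum, inner_zero_left]

theorem pairwise_commute_one_sub_number (X : Finset ℤ) :
    (X : Set ℤ).Pairwise (Function.onFun Commute fun x => 1 - number x) := fun x _ y _ _ =>
  (Commute.one_left _).sub_left ((Commute.one_right _).sub_right (commute_number_number x y))

/-- The projection onto the configurations that are empty in `X`. -/
def emptyProj (X : Finset ℤ) : QuasiLocal :=
  X.noncommProd (fun x => 1 - number x) (pairwise_commute_one_sub_number X)

theorem emptyProj_ket (X S : Finset ℤ) :
    (emptyProj X).op (ket S) = if Disjoint X S then ket S else 0 := by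
  induction X using Finset.induction_on with
  | empty => simp [emptyProj, op_one_apply]
  | insert x X hx ih =>
    rw [emptyProj, Finset.noncommProd_insert_of_notMem _ _ _ _ hx]
    change ((1 - number x) * emptyProj X).op (ket S) = _
    rw [op_mul_apply, ih, op_sub]
    by_cases h : Disjoint X S
    · by_cases hS : x ∈ S <;> simp [h, hS, number_ket, op_one_apply]
    · simp [h]

theorem emptyProj_mem (X : Finset ℤ) : emptyProj X ∈ localAlgebra X :=
  Submonoid.noncommProd_mem (localAlgebra X).toSubsemiring.toSubmonoid _ _ _ fun _ hx =>
    (sub_mem (one_mem (localAlgebra X)) (number_mem hx) : _ ∈ localAlgebra X)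

theorem emptyProj_mul_self (X : Finset ℤ) : emptyProj X * emptyProj X = emptyProj X := by
  refine ext_op_ket fun S => ?_
  rw [op_mul_apply, emptyProj_ket]
  split_ifs with h <;> simp [emptyProj_ket, h]

theorem star_emptyProj (X : Finset ℤ) : star (emptyProj X) = emptyProj X := by
  refine op_injective (ContinuousLinearMap.ext fun f => ?_)
  refine congrFun (congrArg DFunLike.coe (ext_ket fun S => ?_)) f
  ext T
  have key : ⟪ket T, (star (emptyProj X)).op (ket S)⟫_ℂ = ⟪ket T, (emptyProj X).op (ket S)⟫_ℂ := by
    rw [op_star, ContinuousLinearMap.adjoint_inner_right, emptyProj_ket, emptyProj_ket]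
    by_cases h : T = S
    · subst h; split_ifs <;> simp
    · split_ifs <;> simp [inner_ket, h]
  rw [ket, lp.inner_single_left, lp.inner_single_left] at key
  simpa [ket] using key

theorem emptyProj_vacuum (X : Finset ℤ) : (emptyProj X).op vacuum = vacuum := by
  rw [vacuum, emptyProj_ket]; simp

/-- Local observables act on the configurations inside of their support only. -/
theorem exists_matrix {X : Finset ℤ} {A : QuasiLocal} (hA : A ∈ localAlgebra X) :
    ∃ a : Finset ℤ → Finset ℤ → ℂ, ∀ S ⊆ X, ∀ R, Disjoint X R →
      A.op (ket (S ∪ R)) = ∑ T ∈ X.powerset, a S T • ket (T ∪ R) := by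
  induction hA using localAlgebra_induction with
  | lower x hx =>
    refine ⟨fun S T => if x ∈ S ∧ T = S.erase x then 1 else 0, fun S hS R hR => ?_⟩
    have hxR : x ∉ R := Finset.disjoint_left.1 hR hx
    rw [lower_ket]
    by_cases h : x ∈ S
    · rw [Finset.sum_eq_single (S.erase x)]
      · simp [h, Finset.erase_union_distrib, Finset.erase_eq_of_notMem hxR]
      · intro T _ hT; simp [hT]
      · intro hT
        exact absurd (Finset.mem_powerset.2 ((Finset.erase_subset _ _).trans hS)) hT
    · simp [h, hxR]
  | raise x hx =>
    refine ⟨fun S T => if x ∉ S ∧ T = insert x S then 1 else 0, fun S hS R hR => ?_⟩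
    have hxR : x ∉ R := Finset.disjoint_left.1 hR hx
    rw [raise_ket]
    by_cases h : x ∈ S
    · simp [h]
    · rw [Finset.sum_eq_single (insert x S)]
      · simp [h, hxR, Finset.insert_union]
      · intro T _ hT; simp [hT]
      · intro hT
        exact absurd (Finset.mem_powerset.2 (Finset.insert_subset hx hS)) hT
  | scalar c =>
    refine ⟨fun S T => if T = S then c else 0, fun S hS R hR => ?_⟩
    rw [op_algebraMap, Finset.sum_eq_single S]
    · simp
    · intro T _ hT; simp [hT]
    · intro hT; exact absurd (Finset.mem_powerset.2 hS) hT
  | add A B _ _ hA hB =>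
    obtain ⟨a, ha⟩ := hA
    obtain ⟨b, hb⟩ := hB
    refine ⟨fun S T => a S T + b S T, fun S hS R hR => ?_⟩
    rw [op_add, add_apply, ha S hS R hR, hb S hS R hR, ← Finset.sum_add_distrib]
    simp only [add_smul]
  | mul A B _ _ hA hB =>
    obtain ⟨a, ha⟩ := hA
    obtain ⟨b, hb⟩ := hB
    refine ⟨fun S T => ∑ U ∈ X.powerset, b S U * a U T, fun S hS R hR => ?_⟩
    rw [op_mul_apply, hb S hS R hR, map_sum]
    simp only [map_smul, Finset.sum_smul]
    rw [Finset.sum_comm]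
    refine Finset.sum_congr rfl fun U hU => ?_
    rw [ha U (Finset.mem_powerset.1 hU) R hR, Finset.smul_sum]
    simp only [mul_smul]

/-- A acts on the configuration inside X only, so between empty windows just one matrix element is
left. It does not depend on what lies outside and is therefore the one seen by the vacuum. Relative
to X the projection has rank one; the product property of the vacuum and the support projections
rest on this. -/
theorem emptyProj_mul_mul_emptyProj {X : Finset ℤ} {A : QuasiLocal} (hA : A ∈ localAlgebra X) :
    emptyProj X * A * emptyProj X = vacExp A • emptyProj X := by
  obtain ⟨a, ha⟩ := exists_matrix hA
  have key : ∀ R, Disjoint X R → (emptyProj X).op (A.op (ket R)) = a ∅ ∅ • ket R := by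
    intro R hR
    have := ha ∅ (Finset.empty_subset _) R hR
    rw [Finset.empty_union] at this
    rw [this, map_sum, Finset.sum_eq_single ∅]
    · rw [Finset.empty_union, map_smul, emptyProj_ket, if_pos hR]
    · intro T hT hT0
      have : ¬ Disjoint X (T ∪ R) := fun h => hT0
        (Finset.disjoint_self_iff_empty T |>.1 ((Finset.disjoint_union_right.1 h).1.mono_left
          (Finset.mem_powerset.1 hT)))
      rw [map_smul, emptyProj_ket, if_neg this, smul_zero]
    · intro h; exact absurd (Finset.empty_mem_powerset X) h
  have hv : vacExp A = a ∅ ∅ := by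
    have h1 := key ∅ (Finset.disjoint_empty_right X)
    have h2 : vacExp A = ⟪(emptyProj X).op vacuum, A.op vacuum⟫_ℂ := by
      rw [emptyProj_vacuum]; rfl
    rw [h2, ← ContinuousLinearMap.adjoint_inner_right, ← op_star, star_emptyProj, vacuum, h1,
      inner_smul_right, inner_ket]
    simp
  refine ext_op_ket fun R => ?_
  rw [op_mul_apply, op_mul_apply, op_smul,
    smul_apply, emptyProj_ket, hv]
  split_ifs with h
  · exact key R h
  · simp

/-- The vacuum is a product state. -/
theorem vacExp_mul {X Y : Finset ℤ} (h : Disjoint X Y) {A B : QuasiLocal}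
    (hA : A ∈ localAlgebra X) (hB : B ∈ localAlgebra Y) : vacExp (A * B) = vacExp A * vacExp B := by
  have h0 : ∀ C, vacExp (emptyProj X * C * emptyProj X) = vacExp C := by
    intro C
    have : emptyProj X * C * emptyProj X = star (emptyProj X) * (C * emptyProj X) := by
      rw [star_emptyProj, mul_assoc]
    rw [this, vacExp_star_mul, emptyProj_vacuum, op_mul_apply,
      emptyProj_vacuum]; rfl
  have hc : Commute (emptyProj X) B := commute_of_disjoint h (emptyProj_mem X) hB
  rw [← h0 (A * B)]
  -- The projection commutes with B, so a second copy can be moved between A and B, where it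
  -- collapses A to a scalar.
  have e : emptyProj X * (A * B) * emptyProj X = vacExp A • (emptyProj X * B * emptyProj X) := by
    calc emptyProj X * (A * B) * emptyProj X
        = emptyProj X * A * (B * emptyProj X) := by noncomm_ring
      _ = emptyProj X * A * emptyProj X * B := by rw [← hc.eq]; noncomm_ring
      _ = vacExp A • (emptyProj X * emptyProj X * B) := by
          rw [emptyProj_mul_mul_emptyProj hA, emptyProj_mul_self, smul_mul_assoc]
      _ = _ := by rw [mul_assoc, hc.eq, ← mul_assoc, hc.eq]
  rw [e, map_smul, h0, smul_eq_mul]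

/-- A raising operator at a site that A does not touch moves to the far left, where the vacuum
annihilates it. The orthogonality relations between tilings below reduce to this. -/
theorem vacExp_mul_raise_mul {X : Finset ℤ} {x : ℤ} (hx : x ∉ X) {A : QuasiLocal}
    (hA : A ∈ localAlgebra X) (B : QuasiLocal) : vacExp (A * (raise x * B)) = 0 := by
  rw [← mul_assoc, ← (commute_raise_of_mem hx hA).eq, mul_assoc, vacExp_raise_mul]

end SpinChain

end


noncomputable section

/-! ### VMD vectors are annihilated by the terms of the Hamiltonian -/

namespace SpinChain

variable (lam : ℂ)

/-- The observable that creates the VMD vector of a root tiling from the vacuum. -/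
def vmdOp (x : ℤ) (R : List Domino) : QuasiLocal := ∑ T ∈ tilings R, createTiling lam x T

theorem vmdVector_eq (x : ℤ) (R : List Domino) :
    vmdVector lam x R = (vmdOp lam x R).op vacuum := by
  rw [vmdVector, vmdOp, op_sum, sum_apply]

theorem vmdOp_nil (x : ℤ) : vmdOp lam x [] = 1 := by
  simp [vmdOp, tilings, createTiling]

theorem sum_createTiling_image (x : ℤ) (D : Domino) (s : Finset (List Domino)) :
    ∑ T ∈ s.image (List.cons D), createTiling lam x T =
      D.create lam x * ∑ T ∈ s, createTiling lam (x + D.length) T := by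
  rw [Finset.sum_image (fun _ _ _ _ h => (List.cons.inj h).2), Finset.mul_sum]
  rfl

theorem vmdOp_void (x : ℤ) (R : List Domino) : vmdOp lam x (.void :: R) = vmdOp lam (x + 1) R := by
  rw [vmdOp, tilings, sum_createTiling_image]
  · simp [Domino.create, Domino.length, vmdOp]
  all_goals simp

theorem vmdOp_monomer_monomer (x : ℤ) (R : List Domino) :
    vmdOp lam x (.monomer :: .monomer :: R) = raise x * vmdOp lam (x + 3) (.monomer :: R) +
      lam • (raise (x + 1) * raise (x + 2) * vmdOp lam (x + 6) R) := by
  rw [vmdOp, tilings, Finset.sum_union, sum_createTiling_image, sum_createTiling_image]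
  · simp only [Domino.create, Domino.length, vmdOp, smul_mul_assoc]
  · rw [Finset.disjoint_left]
    intro T h1 h2
    obtain ⟨U, _, rfl⟩ := Finset.mem_image.1 h1
    obtain ⟨U', _, h⟩ := Finset.mem_image.1 h2
    cases h

theorem vmdOp_monomer (x : ℤ) (R : List Domino) (hR : ∀ R', R ≠ .monomer :: R') :
    vmdOp lam x (.monomer :: R) = raise x * vmdOp lam (x + 3) R := by
  have : tilings (.monomer :: R) = (tilings R).image (List.cons .monomer) := by
    rcases R with _ | ⟨_ | _ | _, R⟩
    · simp [tilings]
    · simp [tilings]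
    · exact absurd rfl (hR R)
    · simp [tilings]
  rw [vmdOp, this, sum_createTiling_image]
  rfl

/-- Root tilings contain no dimers, so this sum is empty. The value zero makes the dimer cases of
inductions over arbitrary lists trivial. -/
theorem vmdOp_dimer (x : ℤ) (R : List Domino) : vmdOp lam x (.dimer :: R) = 0 := by
  simp [vmdOp, tilings]

theorem commute_lower_vmdOp (R : List Domino) {x z : ℤ} (h : z < x) :
    Commute (lower z) (vmdOp lam x R) := by
  induction R using tilings.induct generalizing x with
  | case1 => rw [vmdOp_nil]; exact Commute.one_right _
  | case2 R ih1 ih2 =>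
    rw [vmdOp_monomer_monomer]
    exact ((commute_lower_raise (by omega)).mul_right (ih1 (by omega))).add_right
      ((((commute_lower_raise (by omega)).mul_right
        (commute_lower_raise (by omega))).mul_right (ih2 (by omega))).smul_right lam)
  | case3 R => rw [vmdOp_dimer]; exact Commute.zero_right _
  | case4 E R h1 h2 ih =>
    rcases E with _ | _ | _
    · rw [vmdOp_void]; exact ih (by omega)
    · rw [vmdOp_monomer _ _ _ (fun R' hR' => h1 R' rfl hR')]
      exact (commute_lower_raise (by omega)).mul_right (ih (by omega))
    · exact (h2 rfl).elim

theorem lower_vmdVector_of_lt (R : List Domino) {x z : ℤ} (h : z < x) :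
    (lower z).op (vmdVector lam x R) = 0 := by
  rw [vmdVector_eq, ← op_mul_apply, (commute_lower_vmdOp lam R h).eq, op_mul_apply, lower_vacuum,
    map_zero]

theorem lower_raise_apply_of_ne {x y : ℤ} (h : x ≠ y) (f : Config) :
    (lower x).op ((raise y).op f) = (raise y).op ((lower x).op f) := by
  rw [← op_mul_apply, (commute_lower_raise h).eq, op_mul_apply]

theorem lower_raise_apply_self (x : ℤ) (f : Config) :
    (lower x).op ((raise x).op f) = f - (raise x).op ((lower x).op f) := by
  rw [← op_mul_apply, lower_mul_raise]; rfl

theorem vmdVector_void (x : ℤ) (R : List Domino) :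
    vmdVector lam x (.void :: R) = vmdVector lam (x + 1) R := by
  rw [vmdVector_eq, vmdOp_void, vmdVector_eq]

theorem vmdVector_nil (x : ℤ) : vmdVector lam x [] = vacuum := by
  rw [vmdVector_eq, vmdOp_nil]; rfl

theorem vmdVector_dimer (x : ℤ) (R : List Domino) :
    vmdVector lam x (.dimer :: R) = 0 := by
  rw [vmdVector_eq, vmdOp_dimer]; rfl

theorem vmdVector_monomer_monomer (x : ℤ) (R : List Domino) :
    vmdVector lam x (.monomer :: .monomer :: R) =
      (raise x).op (vmdVector lam (x + 3) (.monomer :: R)) +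
      lam • (raise (x + 1)).op ((raise (x + 2)).op (vmdVector lam (x + 6) R)) := by
  simp only [vmdVector_eq, vmdOp_monomer_monomer]; rfl

theorem vmdVector_monomer (x : ℤ) (R : List Domino) (hR : ∀ R', R ≠ .monomer :: R') :
    vmdVector lam x (.monomer :: R) = (raise x).op (vmdVector lam (x + 3) R) := by
  simp only [vmdVector_eq, vmdOp_monomer _ _ _ hR]; rfl

/-- A leading dimer leaves its first site empty, so only the tilings with a leading monomer survive,
and they lose this monomer. -/
theorem lower_vmdVector_monomer (x : ℤ) (R : List Domino) :
    (lower x).op (vmdVector lam x (.monomer :: R)) = vmdVector lam (x + 3) R := by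
  by_cases hR : ∃ R', R = .monomer :: R'
  · obtain ⟨R, rfl⟩ := hR
    rw [vmdVector_monomer_monomer]
    simp (disch := omega) only [map_add, map_smul, lower_raise_apply_self, lower_raise_apply_of_ne,
      lower_vmdVector_of_lt, map_zero, smul_zero, add_zero, sub_zero]
  · push Not at hR
    rw [vmdVector_monomer _ _ _ hR]
    simp (disch := omega) only [lower_raise_apply_self, lower_vmdVector_of_lt, map_zero, sub_zero]

theorem lower_vmdVector_of_ne (x : ℤ) (R : List Domino) (hR : ∀ R', R ≠ .monomer :: R') :
    (lower x).op (vmdVector lam x R) = 0 := by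
  rcases R with _ | ⟨_ | _ | _, R⟩
  · rw [vmdVector_nil, lower_vacuum]
  · rw [vmdVector_void]; exact lower_vmdVector_of_lt _ _ (by omega)
  · exact absurd rfl (hR R)
  · rw [vmdVector_dimer, map_zero]

theorem lower_lower_apply_comm (x y : ℤ) (f : Config) :
    (lower x).op ((lower y).op f) = (lower y).op ((lower x).op f) := by
  rw [← op_mul_apply, (commute_lower_lower x y).eq, op_mul_apply]

theorem lower_lower_succ_vmdVector (x : ℤ) (R : List Domino) :
    (lower x).op ((lower (x + 1)).op (vmdVector lam x R)) = 0 := by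
  by_cases hR : ∃ R', R = .monomer :: R'
  · obtain ⟨R, rfl⟩ := hR
    rw [lower_lower_apply_comm, lower_vmdVector_monomer]
    exact lower_vmdVector_of_lt _ _ (by omega)
  · push Not at hR
    rw [lower_lower_apply_comm, lower_vmdVector_of_ne _ _ _ hR, map_zero]

theorem pairOp_apply (y : ℤ) (f : Config) : (pairOp lam y).op f =
    (lower (y + 1)).op ((lower (y + 2)).op f) - lam • (lower y).op ((lower (y + 3)).op f) := rfl

/-- VMD vectors have no pairs of particles at distance two. -/
theorem lower_lower_add_two_vmdVector (R : List Domino) (x y : ℤ) :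
    (lower y).op ((lower (y + 2)).op (vmdVector lam x R)) = 0 := by
  induction R using tilings.induct generalizing x with
  | case1 => rw [vmdVector_nil, lower_vacuum, map_zero]
  | case2 R ih1 ih2 =>
    have cases : y < x ∨ y = x ∨ y = x + 1 ∨ y = x + 2 ∨ x + 2 < y := by omega
    rcases cases with h | rfl | rfl | rfl | h
    · rw [lower_lower_apply_comm, lower_vmdVector_of_lt _ _ h, map_zero]
    all_goals rw [vmdVector_monomer_monomer]
    · simp (disch := omega) only [map_add, map_smul, lower_raise_apply_self,
        lower_raise_apply_of_ne,
        lower_vmdVector_of_lt, map_zero, smul_zero, add_zero, sub_zero]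
    · simp only [add_assoc]; norm_num only
      rw [lower_lower_apply_comm]
      simp (disch := omega) only [map_add, map_smul, lower_raise_apply_self,
        lower_raise_apply_of_ne,
        lower_vmdVector_of_lt, map_zero, smul_zero, add_zero, sub_zero]
    · simp only [add_assoc]; norm_num only
      rw [lower_lower_apply_comm]
      simp (disch := omega) only [map_add, map_smul, lower_raise_apply_self,
        lower_raise_apply_of_ne,
        lower_vmdVector_of_lt, map_zero, smul_zero, add_zero, sub_zero]
    · simp (disch := omega) only [map_add, map_smul, lower_raise_apply_of_ne, ih1, ih2, map_zero,
        smul_zero, add_zero]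
  | case3 R => simp [vmdVector_dimer]
  | case4 E R h1 h2 ih =>
    rcases E with _ | _ | _
    · rw [vmdVector_void, ih]
    · have cases : y < x ∨ y = x ∨ x < y := by omega
      rcases cases with h | rfl | h
      · rw [lower_lower_apply_comm, lower_vmdVector_of_lt _ _ h, map_zero]
      · rw [lower_lower_apply_comm, lower_vmdVector_monomer]
        exact lower_vmdVector_of_lt _ _ (by omega)
      · rw [vmdVector_monomer _ _ _ (fun R' hR' => h1 R' rfl hR')]
        simp (disch := omega) only [lower_raise_apply_of_ne, ih, map_zero]
    · exact (h2 rfl).elim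

/-- VMD vectors are annihilated by the pair operators. -/
theorem pairOp_vmdVector (R : List Domino) (x y : ℤ) :
    (pairOp lam y).op (vmdVector lam x R) = 0 := by
  induction R using tilings.induct generalizing x with
  | case1 => simp [vmdVector_nil, pairOp_apply, lower_vacuum]
  | case2 R ih1 ih2 =>
    have cases : y < x - 1 ∨ y = x - 1 ∨ y = x ∨ y = x + 1 ∨ y = x + 2 ∨ x + 2 < y := by omega
    rcases cases with h | rfl | rfl | rfl | rfl | h
    · rw [pairOp_apply, lower_lower_apply_comm, lower_lower_apply_comm y,
        lower_vmdVector_of_lt _ _ (by omega), lower_vmdVector_of_lt _ _ (by omega)]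
      simp
    · rw [pairOp_apply, lower_lower_apply_comm (x - 1),
        lower_vmdVector_of_lt lam _ (show x - 1 < x by omega)]
      have e1 : x - 1 + 1 = x := by ring
      have e2 : x - 1 + 2 = x + 1 := by ring
      rw [e1, e2, lower_lower_succ_vmdVector]
      simp
    -- The two tilings of the first six sites meet here. Removing the pair of the dimer leaves λ
    -- times the rest, removing both monomers leaves the rest, and the coefficient λ in the pair
    -- operator makes the difference vanish.
    · rw [pairOp_apply, lower_lower_apply_comm y, lower_vmdVector_monomer,
        vmdVector_monomer_monomer, lower_vmdVector_monomer, lower_lower_apply_comm]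
      simp only [add_assoc]; norm_num only
      simp (disch := omega) only [map_add, map_smul, lower_raise_apply_self,
        lower_raise_apply_of_ne,
        lower_vmdVector_of_lt, map_zero, sub_zero, zero_add, sub_self]
    · rw [pairOp_apply, vmdVector_monomer_monomer, lower_lower_apply_comm (x + 1)]
      simp only [add_assoc]; norm_num only
      rw [lower_lower_apply_comm (x + 2)]
      simp (disch := omega) only [map_add, map_smul, lower_raise_apply_self,
        lower_raise_apply_of_ne,
        lower_vmdVector_of_lt, map_zero, smul_zero, sub_zero, zero_add, sub_self]
    · have h3 := lower_lower_succ_vmdVector lam (x + 3) (.monomer :: R)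
      simp only [add_assoc] at h3; norm_num only at h3
      rw [pairOp_apply, vmdVector_monomer_monomer, lower_lower_apply_comm (x + 2)]
      simp only [add_assoc]; norm_num only
      simp (disch := omega) only [map_add, map_smul, lower_raise_apply_self,
        lower_raise_apply_of_ne, h3,
        lower_vmdVector_of_lt, map_zero, smul_zero, add_zero, sub_zero, zero_add, sub_self]
    · have h3 := ih1 (x + 3)
      have h4 := ih2 (x + 6)
      rw [pairOp_apply] at h3 h4 ⊢
      rw [vmdVector_monomer_monomer]
      simp (disch := omega) only [map_add, map_smul, lower_raise_apply_of_ne]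
      rw [sub_eq_zero] at h3 h4
      simp only [h3, h4, map_smul, smul_add]
      rw [smul_comm lam lam, sub_self]
  | case3 R => simp [vmdVector_dimer]
  | case4 E R h1 h2 ih =>
    rcases E with _ | _ | _
    · rw [vmdVector_void, ih]
    · have hR : ∀ R', R ≠ .monomer :: R' := fun R' hR' => h1 R' rfl hR'
      have cases : y < x - 1 ∨ y = x - 1 ∨ y = x ∨ x < y := by omega
      rcases cases with h | rfl | rfl | h
      · rw [pairOp_apply, lower_lower_apply_comm, lower_lower_apply_comm y,
          lower_vmdVector_of_lt _ _ (by omega), lower_vmdVector_of_lt _ _ (by omega)]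
        simp
      · rw [pairOp_apply, lower_lower_apply_comm (x - 1),
        lower_vmdVector_of_lt lam _ (show x - 1 < x by omega)]
        have e1 : x - 1 + 1 = x := by ring
        have e2 : x - 1 + 2 = x + 1 := by ring
        rw [e1, e2, lower_lower_succ_vmdVector]
        simp
      · rw [pairOp_apply, lower_lower_apply_comm y, lower_vmdVector_monomer,
          lower_vmdVector_of_ne _ _ _ hR, lower_lower_apply_comm, vmdVector_monomer _ _ _ hR]
        simp (disch := omega) only [lower_raise_apply_of_ne, lower_vmdVector_of_lt, map_zero,
          smul_zero, sub_zero]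
      · have h3 := ih (x + 3)
        rw [pairOp_apply] at h3 ⊢
        rw [vmdVector_monomer _ _ _ hR]
        simp (disch := omega) only [lower_raise_apply_of_ne]
        rw [← map_smul, ← map_sub, h3, map_zero]
    · exact (h2 rfl).elim

end SpinChain

end


noncomputable section

/-! ### Chains of monomers and dimers: supports, cuts and norms -/

namespace SpinChain

/-- `A` is a local observable whose support satisfies the predicate `p`. -/
def SupportedIn (p : ℤ → Prop) (A : QuasiLocal) : Prop :=
  ∃ X : Finset ℤ, (∀ x ∈ X, p x) ∧ A ∈ localAlgebra X

namespace SupportedIn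

variable {p q : ℤ → Prop} {A B : QuasiLocal}

theorem mono (hA : SupportedIn p A) (h : ∀ x, p x → q x) : SupportedIn q A :=
  let ⟨X, hX, hA⟩ := hA
  ⟨X, fun x hx => h x (hX x hx), hA⟩

theorem mul (hA : SupportedIn p A) (hB : SupportedIn p B) : SupportedIn p (A * B) := by
  obtain ⟨X, hX, hA⟩ := hA
  obtain ⟨Y, hY, hB⟩ := hB
  refine ⟨X ∪ Y, fun x hx => ?_, mul_mem (localAlgebra_mono Finset.subset_union_left hA)
    (localAlgebra_mono Finset.subset_union_right hB)⟩
  exact (Finset.mem_union.1 hx).elim (hX x) (hY x)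

theorem add (hA : SupportedIn p A) (hB : SupportedIn p B) : SupportedIn p (A + B) := by
  obtain ⟨X, hX, hA⟩ := hA
  obtain ⟨Y, hY, hB⟩ := hB
  refine ⟨X ∪ Y, fun x hx => ?_, add_mem (localAlgebra_mono Finset.subset_union_left hA)
    (localAlgebra_mono Finset.subset_union_right hB)⟩
  exact (Finset.mem_union.1 hx).elim (hX x) (hY x)

theorem star (hA : SupportedIn p A) : SupportedIn p (star A) :=
  let ⟨X, hX, hA⟩ := hA
  ⟨X, hX, star_mem hA⟩

theorem smul (c : ℂ) (hA : SupportedIn p A) : SupportedIn p (c • A) :=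
  let ⟨X, hX, hA⟩ := hA
  ⟨X, hX, SMulMemClass.smul_mem c hA⟩

theorem one : SupportedIn p 1 := ⟨∅, by simp, one_mem _⟩

theorem raise {x : ℤ} (h : p x) : SupportedIn p (raise x) :=
  ⟨{x}, by simpa using h, raise_mem (Finset.mem_singleton_self x)⟩

theorem lower {x : ℤ} (h : p x) : SupportedIn p (lower x) :=
  ⟨{x}, by simpa using h, lower_mem (Finset.mem_singleton_self x)⟩

theorem number {x : ℤ} (h : p x) : SupportedIn p (number x) := (raise h).mul (lower h)

theorem commute (hA : SupportedIn p A) (hB : SupportedIn q B) (h : ∀ x, p x → q x → False) :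
    Commute A B := by
  obtain ⟨X, hX, hA⟩ := hA
  obtain ⟨Y, hY, hB⟩ := hB
  exact commute_of_disjoint (Finset.disjoint_left.2 fun x hx hx' => h x (hX x hx) (hY x hx')) hA hB

theorem vacExp_mul (hA : SupportedIn p A) (hB : SupportedIn q B) (h : ∀ x, p x → q x → False) :
    vacExp (A * B) = vacExp A * vacExp B := by
  obtain ⟨X, hX, hA⟩ := hA
  obtain ⟨Y, hY, hB⟩ := hB
  exact SpinChain.vacExp_mul
    (Finset.disjoint_left.2 fun x hx hx' => h x (hX x hx) (hY x hx')) hA hB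

theorem vacExp_mul_raise_mul (hA : SupportedIn p A) {x : ℤ} (h : ¬ p x) (B : QuasiLocal) :
    vacExp (A * (SpinChain.raise x * B)) = 0 :=
  let ⟨_, hX, hA⟩ := hA
  SpinChain.vacExp_mul_raise_mul (fun hx => h (hX x hx)) hA B

/-- The vacuum expectation of products of observables with disjoint supports. -/
theorem vacExp_star_mul_mul {A' B' C : QuasiLocal} (hA : SupportedIn p A) (hA' : SupportedIn p A')
    (hB : SupportedIn q B) (hB' : SupportedIn q B') (hC : SupportedIn p C)
    (h : ∀ x, p x → q x → False) :
    vacExp (Star.star (A * B) * C * (A' * B')) =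
      vacExp (Star.star A * C * A') * vacExp (Star.star B * B') := by
  have e : Star.star (A * B) * C * (A' * B') =
      (Star.star A * C * A') * (Star.star B * B') := by
    rw [star_mul]
    calc Star.star B * Star.star A * C * (A' * B')
        = Star.star B * (Star.star A * C * A') * B' := by noncomm_ring
      _ = _ := by
        rw [← (((hA.star.mul hC).mul hA').commute hB.star h).eq]; noncomm_ring
  rw [e, ((hA.star.mul hC).mul hA').vacExp_mul (hB.star.mul hB') h]

theorem vacExp_star_mul {A' B' : QuasiLocal} (hA : SupportedIn p A) (hA' : SupportedIn p A')
    (hB : SupportedIn q B) (hB' : SupportedIn q B') (h : ∀ x, p x → q x → False) :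
    vacExp (Star.star (A * B) * (A' * B')) =
      vacExp (Star.star A * A') * vacExp (Star.star B * B') := by
  have := vacExp_star_mul_mul hA hA' hB hB' SupportedIn.one h
  simpa only [mul_one] using this

end SupportedIn

variable (lam : ℂ)

/-- The observable that creates the VMD vector of `L` monomers starting at `x`. -/
def chain (x : ℤ) (L : ℕ) : QuasiLocal := vmdOp lam x (List.replicate L .monomer)

theorem chain_zero (x : ℤ) : chain lam x 0 = 1 := vmdOp_nil lam x

theorem chain_one (x : ℤ) : chain lam x 1 = raise x := by
  rw [chain, List.replicate_one, vmdOp_monomer _ _ _ (by simp), vmdOp_nil, mul_one]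

theorem chain_add_two (x : ℤ) (L : ℕ) : chain lam x (L + 2) =
    raise x * chain lam (x + 3) (L + 1) +
      lam • (raise (x + 1) * raise (x + 2) * chain lam (x + 6) L) := by
  rw [chain, List.replicate_succ, List.replicate_succ, vmdOp_monomer_monomer]
  rfl

/-- A dimer replaces adjacent monomers and so cannot cover the void. The sum over tilings factorises
there, and the void shifts what follows by one site. -/
theorem vmdOp_replicate_append_void (x : ℤ) (L : ℕ) (R : List Domino) :
    vmdOp lam x (List.replicate L .monomer ++ .void :: R) =
      chain lam x L * vmdOp lam (x + 3 * L + 1) R := by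
  induction L using Nat.twoStepInduction generalizing x with
  | zero => simp [chain_zero, vmdOp_void]
  | one =>
    rw [List.replicate_one, List.singleton_append, vmdOp_monomer _ _ _ (by simp), vmdOp_void,
      chain_one]
    norm_num
  | more L ih1 ih2 =>
    have h1 := ih1 (x + 6)
    have h2 := ih2 (x + 3)
    rw [List.replicate_succ, List.cons_append] at h2 ⊢
    rw [List.replicate_succ, List.cons_append, vmdOp_monomer_monomer, h1, h2, chain_add_two,
      add_mul, smul_mul_assoc]
    have e1 : x + 3 + 3 * ((L + 1 : ℕ) : ℤ) + 1 = x + 3 * ((L + 1 + 1 : ℕ) : ℤ) + 1 := by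
      push_cast; ring
    have e2 : x + 6 + 3 * (L : ℤ) + 1 = x + 3 * ((L + 1 + 1 : ℕ) : ℤ) + 1 := by
      push_cast; ring
    rw [e1, e2]
    simp only [mul_assoc]

/-- The last sites of a monomer and of a dimer are empty, so the support ends before the tiled
interval does. For L = 0 the range is empty. -/
theorem chain_supportedIn (x : ℤ) (L : ℕ) :
    SupportedIn (fun z => x ≤ z ∧ z ≤ x + 3 * L - 2) (chain lam x L) := by
  induction L using Nat.twoStepInduction generalizing x with
  | zero => rw [chain_zero]; exact .one
  | one => rw [chain_one]; exact .raise (by constructor <;> push_cast <;> omega)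
  | more L ih1 ih2 =>
    rw [chain_add_two]
    push_cast
    refine ((SupportedIn.raise ⟨by omega, by omega⟩).mul ((ih2 _).mono ?_)).add
      (((((SupportedIn.raise ⟨by omega, by omega⟩).mul
        (SupportedIn.raise ⟨by omega, by omega⟩))).mul ((ih1 _).mono ?_)).smul lam)
    · rintro z ⟨h1, h2⟩; push_cast at h2; constructor <;> omega
    · rintro z ⟨h1, h2⟩; constructor <;> omega

/-- The two tilings of a pair of sites where a chain is cut: either there is a break, or a dimer
straddles the cut. -/
theorem chain_split (x : ℤ) (L M : ℕ) : chain lam x (L + 1 + (M + 1)) =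
    chain lam x (L + 1) * chain lam (x + 3 * L + 3) (M + 1) +
      lam • (chain lam x L * (raise (x + 3 * L + 1) * raise (x + 3 * L + 2)) *
        chain lam (x + 3 * L + 6) M) := by
  induction L using Nat.twoStepInduction generalizing x with
  | zero =>
    have e : 0 + 1 + (M + 1) = M + 2 := by ring
    rw [e, chain_add_two, chain_one, chain_zero]
    simp
  | one =>
    have e : 1 + 1 + (M + 1) = (M + 1) + 2 := by ring
    rw [e, chain_add_two, chain_add_two, chain_add_two, zero_add, chain_one, chain_one, chain_zero]
    simp only [add_assoc, Nat.cast_one, mul_one]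
    norm_num only
    simp only [mul_add, add_mul, smul_mul_assoc, mul_smul_comm, mul_assoc]
    abel
  | more L ih1 ih2 =>
    have e : L + 2 + 1 + (M + 1) = (L + M + 2) + 2 := by ring
    have e1 : L + M + 2 + 1 = L + 1 + 1 + (M + 1) := by ring
    have e2 : L + M + 2 = L + 1 + (M + 1) := by ring
    have p1 : x + 3 + 3 * ((L + 1 : ℕ) : ℤ) = x + 3 * ((L + 2 : ℕ) : ℤ) := by push_cast; ring
    have p2 : x + 6 + 3 * (L : ℤ) = x + 3 * ((L + 2 : ℕ) : ℤ) := by push_cast; ring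
    have h1 := ih1 (x + 6)
    have h2 := ih2 (x + 3)
    rw [p1] at h2
    rw [p2] at h1
    rw [e, chain_add_two, e1, e2, h1, h2, chain_add_two lam x (L + 1), chain_add_two lam x L]
    simp only [mul_add, add_mul, smul_mul_assoc, mul_smul_comm, mul_assoc, smul_add]
    abel

/-- A nonempty chain begins with a particle at y (monomer) or at y + 1 (dimer). If A touches neither
site, this raising operator reaches the vacuum on the left. -/
theorem vacExp_mul_chain {p : ℤ → Prop} {A : QuasiLocal} (hA : SupportedIn p A) {y : ℤ}
    (h0 : ¬ p y) (h1 : ¬ p (y + 1)) (L : ℕ) (B : QuasiLocal) :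
    vacExp (A * (chain lam y (L + 1) * B)) = 0 := by
  rcases L with _ | L
  · rw [zero_add, chain_one, hA.vacExp_mul_raise_mul h0]
  · rw [chain_add_two, add_mul, mul_add, map_add, mul_assoc, hA.vacExp_mul_raise_mul h0,
      smul_mul_assoc, mul_smul_comm, map_smul, mul_assoc, mul_assoc, hA.vacExp_mul_raise_mul h1]
    simp

/-- The squared norms of the VMD vectors of `L` monomers. -/
def chainWeight : ℕ → ℝ
  | 0 => 1
  | 1 => 1
  | L + 2 => chainWeight (L + 1) + ‖lam‖ ^ 2 * chainWeight L

theorem chainWeight_pos (L : ℕ) : 0 < chainWeight lam L := by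
  induction L using Nat.twoStepInduction with
  | zero => simp [chainWeight]
  | one => simp [chainWeight]
  | more L ih1 ih2 => rw [chainWeight]; positivity

theorem vacExp_star_raise_mul_raise (x : ℤ) : vacExp (star (raise x) * raise x) = 1 := by
  rw [star_raise, lower_mul_raise, map_sub, vacExp_one, vacExp_mul_lower, sub_zero]

theorem vacExp_star_pair {x y : ℤ} (h : x ≠ y) :
    vacExp (star (raise x * raise y) * (raise x * raise y)) = 1 := by
  rw [SupportedIn.vacExp_star_mul (p := fun z => z = x) (q := fun z => z = y) (.raise rfl)
    (.raise rfl) (.raise rfl) (.raise rfl) (fun z h1 h2 => h (h1.symm.trans h2)),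
    vacExp_star_raise_mul_raise, vacExp_star_raise_mul_raise, one_mul]

theorem vacExp_star_mul_comm (A B : QuasiLocal) :
    vacExp (star A * B) = star (vacExp (star B * A)) := by
  rw [← vacExp_star, star_mul, star_star]

/-- The tilings with a leading monomer and those with a leading dimer span orthogonal vectors, so
the squared norms add up, the dimer with a factor |λ|². This is the recursion of `chainWeight`. -/
theorem vacExp_star_chain_mul_chain (x : ℤ) (L : ℕ) :
    vacExp (star (chain lam x L) * chain lam x L) = chainWeight lam L := by
  induction L using Nat.twoStepInduction generalizing x with
  | zero => simp [chain_zero, chainWeight, vacExp_one]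
  | one => rw [chain_one, vacExp_star_raise_mul_raise]; simp [chainWeight]
  | more L ih1 ih2 =>
    set U := chain lam (x + 3) (L + 1)
    set W := chain lam (x + 6) L
    have hU : SupportedIn (fun z => x + 3 ≤ z) U :=
      (chain_supportedIn lam _ _).mono fun z h => h.1
    have hW : SupportedIn (fun z => x + 3 ≤ z) W :=
      (chain_supportedIn lam _ _).mono fun z h => by have := h.1; omega
    -- The dimer has a particle at x + 1, a site that is empty whenever a monomer starts at x.
    have c1 : vacExp (star (raise x * U) * (raise (x + 1) * raise (x + 2) * W)) = 0 := by
      rw [mul_assoc]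
      refine SupportedIn.vacExp_mul_raise_mul (p := fun z => z = x ∨ x + 3 ≤ z)
        (((SupportedIn.raise (Or.inl rfl)).mul (hU.mono fun z h => Or.inr h)).star) (by omega) _
    have c2 := vacExp_star_mul_comm (raise (x + 1) * raise (x + 2) * W) (raise x * U)
    rw [c1, star_zero] at c2
    have d1 : vacExp (star (raise x * U) * (raise x * U)) = chainWeight lam (L + 1) := by
      rw [SupportedIn.vacExp_star_mul (p := fun z => z = x) (.raise rfl) (.raise rfl) hU hU
        (fun z h1 h2 => by omega), vacExp_star_raise_mul_raise, ih2, one_mul]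
    have d2 : vacExp (star (raise (x + 1) * raise (x + 2) * W) *
        (raise (x + 1) * raise (x + 2) * W)) = chainWeight lam L := by
      have hr : SupportedIn (fun z => z = x + 1 ∨ z = x + 2) (raise (x + 1) * raise (x + 2)) :=
        (SupportedIn.raise (Or.inl rfl)).mul (SupportedIn.raise (Or.inr rfl))
      rw [SupportedIn.vacExp_star_mul hr hr hW hW (fun z h1 h2 => by omega),
        vacExp_star_pair (by omega), ih1, one_mul]
    rw [chain_add_two, star_add, add_mul, mul_add, mul_add, star_smul]
    simp only [smul_mul_assoc, mul_smul_comm, map_add, map_smul]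
    rw [c1, c2, d1, d2, chainWeight]
    simp only [smul_eq_mul, mul_zero, add_zero, zero_add]
    push_cast
    have : (star lam) * lam = (‖lam‖ : ℂ) ^ 2 := Complex.conj_mul' lam
    rw [← this]
    ring

/-! ### The weights in terms of `μ` -/

theorem muDiff_pos : 0 < muDiff lam := Real.sqrt_pos.2 (by positivity)

theorem one_le_muDiff : 1 ≤ muDiff lam := by
  rw [muDiff, Real.one_le_sqrt]; nlinarith [sq_nonneg ‖lam‖]

theorem muPlus_eq : muPlus lam = (1 + muDiff lam) / 2 := rfl
theorem muMinus_eq : muMinus lam = (1 - muDiff lam) / 2 := rfl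

theorem muDiff_sq : muDiff lam ^ 2 = 1 + 4 * ‖lam‖ ^ 2 := Real.sq_sqrt (by positivity)

theorem one_le_muPlus : 1 ≤ muPlus lam := by
  rw [muPlus_eq]; linarith [one_le_muDiff lam]

theorem muPlus_pos : 0 < muPlus lam := zero_lt_one.trans_le (one_le_muPlus lam)

theorem muMinus_nonpos : muMinus lam ≤ 0 := by
  rw [muMinus_eq]; linarith [one_le_muDiff lam]

theorem muPlus_mul_muMinus : muPlus lam * muMinus lam = -‖lam‖ ^ 2 := by
  rw [muPlus_eq, muMinus_eq]; linarith [muDiff_sq lam]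

theorem muPlus_sub_muMinus : muPlus lam - muMinus lam = muDiff lam := by
  rw [muPlus_eq, muMinus_eq]; ring

theorem muPlus_sq : muPlus lam ^ 2 = muPlus lam + ‖lam‖ ^ 2 := by
  rw [muPlus_eq]; linarith [muDiff_sq lam]

theorem muMinus_sq : muMinus lam ^ 2 = muMinus lam + ‖lam‖ ^ 2 := by
  rw [muMinus_eq]; linarith [muDiff_sq lam]

theorem muRatio_nonpos : muRatio lam ≤ 0 :=
  div_nonpos_of_nonpos_of_nonneg (muMinus_nonpos lam) (muPlus_pos lam).le

theorem abs_muRatio_lt_one : |muRatio lam| < 1 := by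
  rw [abs_of_nonpos (muRatio_nonpos lam), muRatio, ← neg_div, div_lt_one (muPlus_pos lam),
    muPlus_eq, muMinus_eq]
  linarith

theorem muMinus_eq_mul : muMinus lam = muRatio lam * muPlus lam :=
  (div_mul_cancel₀ _ (muPlus_pos lam).ne').symm

theorem muRatio_mul_muPlus_sq : muRatio lam * muPlus lam ^ 2 = -‖lam‖ ^ 2 := by
  rw [pow_two, ← mul_assoc, ← muMinus_eq_mul, mul_comm, muPlus_mul_muMinus]

/-- The numbers μ± are the roots of t² = t + |λ|², the characteristic equation of the recursion, so
this is Binet's formula with μ₋ written as μ μ₊. -/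
theorem muDiff_mul_chainWeight (L : ℕ) : muDiff lam * chainWeight lam L =
    muPlus lam ^ (L + 1) * (1 - muRatio lam ^ (L + 1)) := by
  have h : muDiff lam * chainWeight lam L = muPlus lam ^ (L + 1) - muMinus lam ^ (L + 1) := by
    induction L using Nat.twoStepInduction with
    | zero => simp [chainWeight, muPlus_sub_muMinus]
    | one =>
      simp only [chainWeight, one_add_one_eq_two, muPlus_sq, muMinus_sq]
      linarith [muPlus_sub_muMinus lam]
    | more L ih1 ih2 =>
      rw [chainWeight, mul_add, ih2, mul_left_comm, ih1]
      rw [pow_succ (muPlus lam) (L + 1), pow_succ (muMinus lam) (L + 1),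
        pow_succ (muPlus lam) (L + 1 + 1), pow_succ (muMinus lam) (L + 1 + 1),
        pow_succ (muPlus lam) (L + 1), pow_succ (muMinus lam) (L + 1)]
      linear_combination (-muPlus lam ^ (L + 1)) * muPlus_sq lam +
        (muMinus lam ^ (L + 1)) * muMinus_sq lam
  rw [h, muMinus_eq_mul, mul_pow]; ring

theorem chainWeight_eq (L : ℕ) : chainWeight lam L =
    muPlus lam ^ (L + 1) * (1 - muRatio lam ^ (L + 1)) / muDiff lam := by
  rw [← muDiff_mul_chainWeight]
  field_simp [(muDiff_pos lam).ne']

theorem tendsto_muRatio_pow : Tendsto (fun n : ℕ => muRatio lam ^ n) atTop (𝓝 0) :=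
  tendsto_pow_atTop_nhds_zero_of_abs_lt_one (abs_muRatio_lt_one lam)

/-- In the Binet formula the factors 1 - μ^n tend to one because |μ| < 1, so only the powers of μ₊
remain. The truncated subtraction is irrelevant in the limit. -/
theorem tendsto_chainWeight_div (c : ℕ) :
    Tendsto (fun n => chainWeight lam (n - c) / chainWeight lam n) atTop
      (𝓝 ((muPlus lam)⁻¹ ^ c)) := by
  rw [← tendsto_add_atTop_iff_nat c]
  have hD := (muDiff_pos lam).ne'
  have hP := (muPlus_pos lam).ne'
  have h : ∀ d, Tendsto (fun n : ℕ => 1 - muRatio lam ^ (n + d)) atTop (𝓝 1) := fun d => by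
    have := ((tendsto_add_atTop_iff_nat d).2 (tendsto_muRatio_pow lam)).const_sub 1
    simpa using this
  have h2 := (((h 1).div (h (c + 1)) one_ne_zero)).const_mul ((muPlus lam)⁻¹ ^ c)
  rw [div_one, mul_one] at h2
  refine h2.congr fun n => ?_
  rw [Nat.add_sub_cancel, chainWeight_eq, chainWeight_eq]
  simp only [Pi.div_apply]
  rw [add_assoc n c 1]
  have e : muPlus lam ^ (n + (c + 1)) = muPlus lam ^ (n + 1) * muPlus lam ^ c := by ring
  rw [e, inv_pow]
  have : (muPlus lam) ^ c ≠ 0 := pow_ne_zero _ hP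
  have : (muPlus lam) ^ (n + 1) ≠ 0 := pow_ne_zero _ hP
  -- This factor never vanishes, but it is simpler to note that with division by zero both sides
  -- would be zero.
  by_cases h0 : 1 - muRatio lam ^ (n + (c + 1)) = 0
  · simp [h0]
  · field_simp

end SpinChain

end


noncomputable section

/-! ### Cutting at a window and the infinite-volume limit -/

namespace SpinChain

variable (lam : ℂ) (k : ℤ)

/-- The observable that creates `a` monomers on the left and `b` monomers on the right of a void
at `3k`. -/
def voidOp (a b : ℕ) : QuasiLocal := chain lam (3 * k - 3 * a) a * chain lam (3 * k + 1) b

theorem singleVoidVector_eq (n : ℕ) (h : |k| ≤ n) :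
    singleVoidVector lam k n = (voidOp lam k (n + k).toNat (n - k).toNat).op vacuum := by
  have h1 : ((n + k).toNat : ℤ) = n + k := Int.toNat_of_nonneg (by linarith [neg_abs_le k])
  rw [singleVoidVector, vmdVector_eq, vmdOp_replicate_append_void, voidOp, h1]
  have e1 : (-3 * (n : ℤ)) = 3 * k - 3 * (n + k) := by ring
  have e2 : (-3 * (n : ℤ)) + 3 * (n + k) + 1 = 3 * k + 1 := by ring
  rw [e2, e1]
  rfl

/-- The window parts of the left chain, cut between two dominoes or inside of a dimer. -/
def winL (m : ℕ) : Bool → QuasiLocal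
  | false => chain lam (3 * k - 3 * m - 3) (m + 1)
  | true => chain lam (3 * k - 3 * m) m

/-- The outer parts of the left chain. -/
def outL (m a : ℕ) : Bool → QuasiLocal
  | false => chain lam (3 * k - 3 * a) (a - (m + 1))
  | true => lam • (chain lam (3 * k - 3 * a) (a - (m + 2)) *
      (raise (3 * k - 3 * m - 5) * raise (3 * k - 3 * m - 4)))

/-- The window parts of the right chain. -/
def winR (m : ℕ) : Bool → QuasiLocal
  | false => chain lam (3 * k + 1) (m + 1)
  | true => chain lam (3 * k + 1) m * (raise (3 * k + 3 * m + 2) * raise (3 * k + 3 * m + 3))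

/-- The outer parts of the right chain. -/
def outR (m b : ℕ) : Bool → QuasiLocal
  | false => chain lam (3 * k + 3 * m + 4) (b - (m + 1))
  | true => lam • chain lam (3 * k + 3 * m + 7) (b - (m + 2))

/-- The squared norms of the outer parts. -/
def outWeight (m a : ℕ) : Bool → ℝ
  | false => chainWeight lam (a - (m + 1))
  | true => ‖lam‖ ^ 2 * chainWeight lam (a - (m + 2))

theorem winL_supportedIn (m : ℕ) (i : Bool) :
    SupportedIn (fun z => 3 * k - 3 * m - 3 ≤ z ∧ z ≤ 3 * k - 2) (winL lam k m i) := by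
  cases i
  · exact (chain_supportedIn lam _ _).mono fun z h => by push_cast at h; omega
  · exact (chain_supportedIn lam _ _).mono fun z h => by omega

theorem winR_supportedIn (m : ℕ) (i : Bool) :
    SupportedIn (fun z => 3 * k + 1 ≤ z ∧ z ≤ 3 * k + 3 * m + 3) (winR lam k m i) := by
  cases i
  · exact (chain_supportedIn lam _ _).mono fun z h => by push_cast at h; omega
  · exact ((chain_supportedIn lam _ _).mono fun z h => by omega).mul
      ((SupportedIn.raise (by omega)).mul (.raise (by omega)))

theorem outL_supportedIn {m a : ℕ} (h : m + 2 ≤ a) (i : Bool) :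
    SupportedIn (fun z => z < 3 * k - 3 * m - 3) (outL lam k m a i) := by
  cases i
  · exact (chain_supportedIn lam _ _).mono fun z h => by omega
  · exact ((((chain_supportedIn lam _ _).mono fun z h => by omega).mul
      ((SupportedIn.raise (by omega)).mul (.raise (by omega))))).smul lam

theorem outR_supportedIn (m b : ℕ) (i : Bool) :
    SupportedIn (fun z => 3 * k + 3 * m + 3 < z) (outR lam k m b i) := by
  cases i
  · exact (chain_supportedIn lam _ _).mono fun z h => by omega
  · exact ((chain_supportedIn lam _ _).mono fun z h => by omega).smul lam

/-- `chain_split` at the left edge of the window. A dimer straddling this edge has both particles in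
its first half, outside, so the pair and the factor λ go to the outer part and the window keeps only
the m triples of the rest. -/
theorem chain_left_eq {m a : ℕ} (h : m + 2 ≤ a) :
    chain lam (3 * k - 3 * a) a = ∑ i, winL lam k m i * outL lam k m a i := by
  obtain ⟨c, rfl⟩ := Nat.exists_eq_add_of_le h
  have e : m + 2 + c = c + 1 + (m + 1) := by ring
  have hc : ∀ i, winL lam k m i * outL lam k m (m + 2 + c) i =
      outL lam k m (m + 2 + c) i * winL lam k m i := fun i =>
    ((winL_supportedIn lam k m i).commute (outL_supportedIn lam k h i)
      (fun z h1 h2 => by omega)).eq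
  rw [Fintype.sum_bool, hc, hc]
  have s := chain_split lam (3 * k - 3 * ((m + 2 + c : ℕ) : ℤ)) c m
  rw [← e] at s
  rw [s, outL, outL, winL, winL]
  have e1 : m + 2 + c - (m + 1) = c + 1 := by omega
  have e2 : m + 2 + c - (m + 2) = c := by omega
  have p1 : 3 * k - 3 * ((m + 2 + c : ℕ) : ℤ) + 3 * c + 3 = 3 * k - 3 * m - 3 := by
    push_cast; ring
  have p2 : 3 * k - 3 * ((m + 2 + c : ℕ) : ℤ) + 3 * c + 6 = 3 * k - 3 * m := by
    push_cast; ring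
  have p3 : 3 * k - 3 * ((m + 2 + c : ℕ) : ℤ) + 3 * c + 1 = 3 * k - 3 * m - 5 := by
    push_cast; ring
  have p4 : 3 * k - 3 * ((m + 2 + c : ℕ) : ℤ) + 3 * c + 2 = 3 * k - 3 * m - 4 := by
    push_cast; ring
  rw [p1, p2, p3, p4, e1, e2, smul_mul_assoc, add_comm (lam • _)]

/-- At the right edge the first half of a straddling dimer lies inside, so now the pair of particles
belongs to the window part; only λ is put outside. -/
theorem chain_right_eq {m b : ℕ} (h : m + 2 ≤ b) :
    chain lam (3 * k + 1) b = ∑ i, winR lam k m i * outR lam k m b i := by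
  obtain ⟨c, rfl⟩ := Nat.exists_eq_add_of_le h
  have e : m + 2 + c = m + 1 + (c + 1) := by ring
  have s := chain_split lam (3 * k + 1) m c
  rw [← e] at s
  rw [Fintype.sum_bool, s, winR, winR, outR, outR]
  have e1 : m + 2 + c - (m + 1) = c + 1 := by omega
  have e2 : m + 2 + c - (m + 2) = c := by omega
  have p1 : 3 * k + 1 + 3 * (m : ℤ) + 3 = 3 * k + 3 * m + 4 := by ring
  have p2 : 3 * k + 1 + 3 * (m : ℤ) + 6 = 3 * k + 3 * m + 7 := by ring
  have p3 : 3 * k + 1 + 3 * (m : ℤ) + 1 = 3 * k + 3 * m + 2 := by ring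
  have p4 : 3 * k + 1 + 3 * (m : ℤ) + 2 = 3 * k + 3 * m + 3 := by ring
  rw [p1, p2, p3, p4, e1, e2, mul_smul_comm, add_comm (lam • _)]

/-- The window parts of the single-void vectors. -/
def win (m : ℕ) (p : Bool × Bool) : QuasiLocal := winL lam k m p.1 * winR lam k m p.2

/-- The outer parts of the single-void vectors. -/
def outer (m a b : ℕ) (p : Bool × Bool) : QuasiLocal := outL lam k m a p.1 * outR lam k m b p.2

/-- The predicate of lying in the window. -/
def InWindow (m : ℕ) (z : ℤ) : Prop := 3 * k - 3 * m - 3 ≤ z ∧ z ≤ 3 * k + 3 * m + 3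

theorem win_supportedIn (m : ℕ) (p : Bool × Bool) :
    SupportedIn (InWindow k m) (win lam k m p) :=
  ((winL_supportedIn lam k m p.1).mono fun z h => by unfold InWindow; omega).mul
    ((winR_supportedIn lam k m p.2).mono fun z h => by unfold InWindow; omega)

theorem outer_supportedIn {m a : ℕ} (h : m + 2 ≤ a) (b : ℕ) (p : Bool × Bool) :
    SupportedIn (fun z => ¬ InWindow k m z) (outer lam k m a b p) :=
  ((outL_supportedIn lam k h p.1).mono fun z h => by unfold InWindow; omega).mul
    ((outR_supportedIn lam k m b p.2).mono fun z h => by unfold InWindow; omega)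

theorem voidOp_eq_sum {m a b : ℕ} (ha : m + 2 ≤ a) (hb : m + 2 ≤ b) :
    voidOp lam k a b = ∑ p, win lam k m p * outer lam k m a b p := by
  rw [voidOp, chain_left_eq lam k ha, chain_right_eq lam k hb, Fintype.sum_prod_type,
    Finset.sum_mul_sum]
  refine Finset.sum_congr rfl fun i _ => Finset.sum_congr rfl fun j _ => ?_
  have hc : Commute (outL lam k m a i) (winR lam k m j) :=
    (outL_supportedIn lam k ha i).commute (winR_supportedIn lam k m j) (fun z h1 h2 => by omega)
  rw [win, outer]
  calc winL lam k m i * outL lam k m a i * (winR lam k m j * outR lam k m b j)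
      = winL lam k m i * (outL lam k m a i * winR lam k m j) * outR lam k m b j := by noncomm_ring
    _ = _ := by rw [hc.eq]; noncomm_ring

theorem vacExp_star_smul_mul_smul (c : ℂ) (A : QuasiLocal) :
    vacExp (star (c • A) * (c • A)) = ((‖c‖ ^ 2 : ℝ) : ℂ) * vacExp (star A * A) := by
  rw [star_smul, smul_mul_smul_comm, map_smul, smul_eq_mul]
  congr 1
  rw [Complex.star_def, Complex.conj_mul']
  norm_cast

theorem vacExp_star_chain_pair (x y : ℤ) (L : ℕ) (h : x + 3 * L - 2 < y) :
    vacExp (star (chain lam x L * (raise y * raise (y + 1))) *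
      (chain lam x L * (raise y * raise (y + 1)))) = chainWeight lam L := by
  have hr : SupportedIn (fun z => y ≤ z) (raise y * raise (y + 1)) :=
    (SupportedIn.raise (by omega)).mul (.raise (by omega))
  rw [SupportedIn.vacExp_star_mul (chain_supportedIn lam x L) (chain_supportedIn lam x L) hr hr
    (fun z h1 h2 => by omega), vacExp_star_chain_mul_chain, vacExp_star_pair (by omega), mul_one]

theorem vacExp_star_outL {m a : ℕ} (h : m + 2 ≤ a) (i : Bool) :
    vacExp (star (outL lam k m a i) * outL lam k m a i) = outWeight lam m a i := by
  cases i
  · exact vacExp_star_chain_mul_chain lam _ _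
  · rw [outL, vacExp_star_smul_mul_smul, outWeight, Complex.ofReal_mul]
    congr 1
    have := vacExp_star_chain_pair lam (3 * k - 3 * a) (3 * k - 3 * m - 5) (a - (m + 2)) (by omega)
    have e : 3 * k - 3 * (m : ℤ) - 5 + 1 = 3 * k - 3 * m - 4 := by ring
    rwa [e] at this

theorem vacExp_star_outR (m b : ℕ) (i : Bool) :
    vacExp (star (outR lam k m b i) * outR lam k m b i) = outWeight lam m b i := by
  cases i
  · exact vacExp_star_chain_mul_chain lam _ _
  · rw [outR, vacExp_star_smul_mul_smul, vacExp_star_chain_mul_chain, outWeight,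
      Complex.ofReal_mul]

theorem vacExp_star_mul_mul (A B C : QuasiLocal) :
    vacExp (star A * B * C) = star (vacExp (star C * star B * A)) := by
  rw [← vacExp_star, star_mul, star_mul, star_star, star_star, mul_assoc]

/-- Different window parts on the left are orthogonal, also after the application of an observable
supported away from the left edge. -/
theorem vacExp_winL_ne {p : ℤ → Prop} {A : QuasiLocal} (hA : SupportedIn p A) (m : ℕ)
    (h0 : ¬ p (3 * k - 3 * m - 3)) (h1 : ¬ p (3 * k - 3 * m - 2)) {i j : Bool} (hij : i ≠ j) :
    vacExp (star (winL lam k m i) * A * winL lam k m j) = 0 := by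
  -- Without a straddling dimer the window starts with a particle at one of its first two sites.
  -- With one, these sites are empty, and B does not touch them.
  have key : ∀ B : QuasiLocal, SupportedIn p B →
      vacExp (star (winL lam k m true) * B * winL lam k m false) = 0 := by
    intro B hB
    have hs : SupportedIn (fun z => z ≠ 3 * k - 3 * m - 3 ∧ z ≠ 3 * k - 3 * m - 2)
        (star (winL lam k m true) * B) := by
      refine (((chain_supportedIn lam _ _).mono fun z h => ?_).star).mul (hB.mono fun z h => ?_)
      · omega
      · exact ⟨fun e => h0 (e ▸ h), fun e => h1 (e ▸ h)⟩
    have := vacExp_mul_chain lam hs (y := 3 * k - 3 * m - 3) (by omega) (by omega) m 1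
    rwa [mul_one] at this
  rcases i <;> rcases j
  · exact absurd rfl hij
  · rw [vacExp_star_mul_mul, key _ hA.star, star_zero]
  · exact key _ hA
  · exact absurd rfl hij

theorem vacExp_mul_pair_mul {p q : ℤ → Prop} {A : QuasiLocal} (hA : SupportedIn p A) {y : ℤ}
    (h : ¬ p (y + 1)) (B : QuasiLocal) (hB : SupportedIn q B) (h' : ¬ q (y + 1)) :
    vacExp (A * (B * (raise y * raise (y + 1)))) = 0 := by
  have e : B * (raise y * raise (y + 1)) = raise (y + 1) * (B * raise y) := by
    rw [(commute_raise_raise y (y + 1)).eq, ← mul_assoc,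
      (hB.commute (.raise (p := fun z => z = y + 1) rfl) (fun z h1 h2 => h' (h2 ▸ h1))).eq,
      mul_assoc]
  rw [e, hA.vacExp_mul_raise_mul h]

/-- Different window parts on the right are orthogonal, also after the application of an
observable supported away from the right edge. -/
theorem vacExp_winR_ne {p : ℤ → Prop} {A : QuasiLocal} (hA : SupportedIn p A) (m : ℕ)
    (h0 : ¬ p (3 * k + 3 * m + 3)) {i j : Bool} (hij : i ≠ j) :
    vacExp (star (winR lam k m i) * A * winR lam k m j) = 0 := by
  have key : ∀ B : QuasiLocal, SupportedIn p B →
      vacExp (star (winR lam k m false) * B * winR lam k m true) = 0 := by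
    intro B hB
    have hs : SupportedIn (fun z => z ≠ 3 * k + 3 * m + 3) (star (winR lam k m false) * B) := by
      refine (((chain_supportedIn lam _ _).mono fun z h => ?_).star).mul (hB.mono fun z h => ?_)
      · push_cast at h; omega
      · exact fun e => h0 (e ▸ h)
    have e : 3 * k + 3 * (m : ℤ) + 2 + 1 = 3 * k + 3 * m + 3 := by ring
    have := vacExp_mul_pair_mul hs (y := 3 * k + 3 * m + 2) (by omega)
      (chain lam (3 * k + 1) m) (chain_supportedIn lam _ _) (by omega)
    rw [e] at this
    exact this
  rcases i <;> rcases j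
  · exact absurd rfl hij
  · exact key _ hA
  · rw [vacExp_star_mul_mul, key _ hA.star, star_zero]
  · exact absurd rfl hij

/-- The pair of the straddling dimer occupies the last site before the window's last empty
neighbour, 3k - 3m - 4, which an unbroken outer chain leaves empty. -/
theorem vacExp_outL_ne {m a : ℕ} (h : m + 2 ≤ a) {i j : Bool} (hij : i ≠ j) :
    vacExp (star (outL lam k m a i) * outL lam k m a j) = 0 := by
  have key : vacExp (star (outL lam k m a false) * outL lam k m a true) = 0 := by
    have e : 3 * k - 3 * (m : ℤ) - 5 + 1 = 3 * k - 3 * m - 4 := by ring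
    have := vacExp_mul_pair_mul (chain_supportedIn lam (3 * k - 3 * a) (a - (m + 1))).star
      (y := 3 * k - 3 * m - 5) (by omega) (chain lam (3 * k - 3 * a) (a - (m + 2)))
      (chain_supportedIn lam _ _) (by omega)
    rw [e] at this
    rw [outL, outL, mul_smul_comm, map_smul, this, smul_zero]
  rcases i <;> rcases j
  · exact absurd rfl hij
  · exact key
  · rw [vacExp_star_mul_comm, key, star_zero]
  · exact absurd rfl hij

/-- An outer chain after a clean cut is nonempty and has a particle at one of its first two sites;
these belong to the empty second half of a straddling dimer. -/
theorem vacExp_outR_ne {m b : ℕ} (h : m + 2 ≤ b) {i j : Bool} (hij : i ≠ j) :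
    vacExp (star (outR lam k m b i) * outR lam k m b j) = 0 := by
  have key : vacExp (star (outR lam k m b true) * outR lam k m b false) = 0 := by
    have hs : SupportedIn (fun z => 3 * k + 3 * m + 7 ≤ z) (outR lam k m b true) :=
      ((chain_supportedIn lam _ _).mono fun z h => h.1).smul lam
    have := vacExp_mul_chain lam hs.star (y := 3 * k + 3 * m + 4) (by omega) (by omega)
      (b - (m + 2)) 1
    have e : b - (m + 2) + 1 = b - (m + 1) := by omega
    rwa [mul_one, e] at this
  rcases i <;> rcases j
  · exact absurd rfl hij
  · rw [vacExp_star_mul_comm, key, star_zero]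
  · exact key
  · exact absurd rfl hij

theorem vacExp_star_outer {m a b : ℕ} (ha : m + 2 ≤ a) (hb : m + 2 ≤ b) (p q : Bool × Bool) :
    vacExp (star (outer lam k m a b p) * outer lam k m a b q) =
      if p = q then ((outWeight lam m a p.1 * outWeight lam m b p.2 : ℝ) : ℂ) else 0 := by
  rw [outer, outer, SupportedIn.vacExp_star_mul (outL_supportedIn lam k ha _)
    (outL_supportedIn lam k ha _) (outR_supportedIn lam k m b _) (outR_supportedIn lam k m b _)
    (fun z h1 h2 => by omega)]
  split_ifs with h
  · subst h
    rw [vacExp_star_outL lam k ha, vacExp_star_outR, Complex.ofReal_mul]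
  · by_cases h1 : p.1 = q.1
    · have h2 : p.2 ≠ q.2 := fun h2 => h (Prod.ext h1 h2)
      rw [vacExp_outR_ne lam k hb h2, mul_zero]
    · rw [vacExp_outL_ne lam k ha h1, zero_mul]

/-- The expectation of `A` in the normalised single-void vector with `a` monomers on the left and
`b` monomers on the right. -/
def voidExp (a b : ℕ) (A : QuasiLocal) : ℂ :=
  vacExp (star (voidOp lam k a b) * A * voidOp lam k a b) /
    ((chainWeight lam a * chainWeight lam b : ℝ) : ℂ)

theorem vacExp_star_voidOp (a b : ℕ) : vacExp (star (voidOp lam k a b) * voidOp lam k a b) =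
    ((chainWeight lam a * chainWeight lam b : ℝ) : ℂ) := by
  rw [voidOp, SupportedIn.vacExp_star_mul (chain_supportedIn lam _ _) (chain_supportedIn lam _ _)
    (chain_supportedIn lam _ _) (chain_supportedIn lam _ _) (fun z h1 h2 => by omega),
    vacExp_star_chain_mul_chain, vacExp_star_chain_mul_chain, Complex.ofReal_mul]

theorem weight_mul_ne_zero (a b : ℕ) :
    ((chainWeight lam a * chainWeight lam b : ℝ) : ℂ) ≠ 0 := by
  have := (mul_pos (chainWeight_pos lam a) (chainWeight_pos lam b)).ne'
  exact_mod_cast this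

theorem voidExp_one (a b : ℕ) : voidExp lam k a b 1 = 1 := by
  rw [voidExp, mul_one, vacExp_star_voidOp, div_self (weight_mul_ne_zero lam a b)]

theorem vacExp_star_mul_self (A : QuasiLocal) :
    vacExp (star A * A) = ((‖A.op vacuum‖ ^ 2 : ℝ) : ℂ) := by
  rw [vacExp_star_mul, inner_self_eq_norm_sq_to_K]; norm_cast

theorem norm_sq_voidOp_vacuum (a b : ℕ) : ‖(voidOp lam k a b).op vacuum‖ ^ 2 =
    chainWeight lam a * chainWeight lam b := by
  have h := vacExp_star_voidOp lam k a b
  rw [vacExp_star_mul_self] at h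
  exact Complex.ofReal_injective h

theorem vacExp_star_mul_mul_eq (A B C : QuasiLocal) :
    vacExp (star A * B * C) = ⟪A.op vacuum, B.op (C.op vacuum)⟫_ℂ := by
  rw [mul_assoc, vacExp_star_mul, op_mul_apply]

theorem norm_voidExp_le (a b : ℕ) (A : QuasiLocal) : ‖voidExp lam k a b A‖ ≤ ‖A‖ := by
  have hpos := mul_pos (chainWeight_pos lam a) (chainWeight_pos lam b)
  rw [voidExp, norm_div, Complex.norm_real, Real.norm_of_nonneg hpos.le, div_le_iff₀ hpos,
    vacExp_star_mul_mul_eq, ← norm_sq_voidOp_vacuum lam k]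
  refine (norm_inner_le_norm _ _).trans ?_
  have := A.op.le_opNorm ((voidOp lam k a b).op vacuum)
  rw [norm_op] at this
  nlinarith [norm_nonneg ((voidOp lam k a b).op vacuum)]

theorem voidExp_add (a b : ℕ) (A B : QuasiLocal) :
    voidExp lam k a b (A + B) = voidExp lam k a b A + voidExp lam k a b B := by
  rw [voidExp, mul_add, add_mul, map_add, add_div]; rfl

theorem voidExp_smul (a b : ℕ) (c : ℂ) (A : QuasiLocal) :
    voidExp lam k a b (c • A) = c * voidExp lam k a b A := by
  rw [voidExp, mul_smul_comm, smul_mul_assoc, map_smul, smul_eq_mul, mul_div_assoc]; rfl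

theorem voidExp_sub (a b : ℕ) (A B : QuasiLocal) :
    voidExp lam k a b (A - B) = voidExp lam k a b A - voidExp lam k a b B := by
  rw [voidExp, mul_sub, sub_mul, map_sub, sub_div]; rfl

theorem voidExp_star_mul_self_nonneg (a b : ℕ) (A : QuasiLocal) :
    0 ≤ voidExp lam k a b (star A * A) := by
  have hpos := mul_pos (chainWeight_pos lam a) (chainWeight_pos lam b)
  have e : star (voidOp lam k a b) * (star A * A) * voidOp lam k a b =
      star (A * voidOp lam k a b) * (A * voidOp lam k a b) := by
    rw [star_mul]; noncomm_ring
  rw [voidExp, e, vacExp_star_mul_self, ← Complex.ofReal_div]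
  exact Complex.zero_le_real.2 (div_nonneg (sq_nonneg _) hpos.le)

theorem singleVoidExpectation_eq (n : ℕ) (h : |k| ≤ n) (A : QuasiLocal) :
    singleVoidExpectation lam k n A = voidExp lam k (n + k).toNat (n - k).toNat A := by
  have e := norm_sq_voidOp_vacuum lam k (n + k).toNat (n - k).toNat
  rw [singleVoidExpectation, singleVoidVector_eq lam k n h]
  rw [map_smul, inner_smul_left, inner_smul_right, voidExp, vacExp_star_mul_mul_eq, ← e]
  rw [Complex.conj_ofReal]
  push_cast
  rw [div_eq_inv_mul, ← mul_assoc, ← pow_two, inv_pow]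

/-- The expectation of a local observable in a window. -/
theorem voidExp_eq_sum {m a b : ℕ} (ha : m + 2 ≤ a) (hb : m + 2 ≤ b) {A : QuasiLocal}
    (hA : SupportedIn (InWindow k m) A) :
    voidExp lam k a b A = ∑ p : Bool × Bool,
      vacExp (star (win lam k m p) * A * win lam k m p) *
        ((outWeight lam m a p.1 / chainWeight lam a * (outWeight lam m b p.2 / chainWeight lam b) :
          ℝ) : ℂ) := by
  rw [voidExp, voidOp_eq_sum lam k ha hb, star_sum, Finset.sum_mul, Finset.sum_mul_sum, map_sum,
    Finset.sum_div]
  refine Finset.sum_congr rfl fun p _ => ?_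
  -- The observable acts in the window only, so each term contains the inner product of two outer
  -- parts and the off-diagonal terms vanish.
  rw [map_sum, Finset.sum_eq_single p]
  · rw [SupportedIn.vacExp_star_mul_mul (win_supportedIn lam k m p) (win_supportedIn lam k m p)
      (outer_supportedIn lam k ha b p) (outer_supportedIn lam k ha b p) hA (fun z h1 h2 => h2 h1),
      vacExp_star_outer lam k ha hb, if_pos rfl, mul_div_assoc, ← Complex.ofReal_div,
      mul_div_mul_comm]
  · intro q _ hq
    rw [SupportedIn.vacExp_star_mul_mul (win_supportedIn lam k m p) (win_supportedIn lam k m q)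
      (outer_supportedIn lam k ha b p) (outer_supportedIn lam k ha b q) hA (fun z h1 h2 => h2 h1),
      vacExp_star_outer lam k ha hb, if_neg hq.symm, mul_zero]
  · intro h; exact absurd (Finset.mem_univ p) h

theorem tendsto_outWeight_div (m : ℕ) (i : Bool) :
    ∃ c, Tendsto (fun a => outWeight lam m a i / chainWeight lam a) atTop (𝓝 c) := by
  cases i
  · exact ⟨_, tendsto_chainWeight_div lam (m + 1)⟩
  · refine ⟨_, ((tendsto_chainWeight_div lam (m + 2)).const_mul (‖lam‖ ^ 2)).congr fun a => ?_⟩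
    rw [outWeight, mul_div_assoc]

theorem supportedIn_inWindow {X : Finset ℤ} {A : QuasiLocal} (hA : A ∈ localAlgebra X) :
    ∃ m₀ : ℕ, ∀ m ≥ m₀, SupportedIn (fun z => 3 * k - 3 * m < z ∧ z < 3 * k + 3 * m) A := by
  obtain ⟨m₀, hm₀⟩ : ∃ m₀ : ℕ, ∀ z ∈ X, |z| + 3 * |k| < m₀ := by
    refine ⟨(X.sup fun z => (|z| + 3 * |k| + 1).toNat), fun z hz => ?_⟩
    have := Finset.le_sup (f := fun z => (|z| + 3 * |k| + 1).toNat) hz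
    have h2 : |z| + 3 * |k| + 1 ≤ ((|z| + 3 * |k| + 1).toNat : ℤ) := Int.self_le_toNat _
    have h3 : ((|z| + 3 * |k| + 1).toNat : ℤ) ≤
      ((X.sup fun z => (|z| + 3 * |k| + 1).toNat : ℕ) : ℤ) := by exact_mod_cast this
    omega
  refine ⟨m₀, fun m hm => ⟨X, fun z hz => ?_, hA⟩⟩
  have h1 := hm₀ z hz
  have h2 := neg_abs_le z
  have h3 := le_abs_self z
  have h4 := neg_abs_le k
  have h5 := le_abs_self k
  constructor <;> omega

theorem exists_tendsto_voidExp_of_local {X : Finset ℤ} {A : QuasiLocal}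
    (hA : A ∈ localAlgebra X) :
    ∃ l, Tendsto (fun p : ℕ × ℕ => voidExp lam k p.1 p.2 A) (atTop ×ˢ atTop) (𝓝 l) := by
  obtain ⟨m, hm⟩ := supportedIn_inWindow k hA
  have hA' : SupportedIn (InWindow k m) A :=
    (hm m le_rfl).mono fun z h => by unfold InWindow; omega
  choose c hc using tendsto_outWeight_div lam m
  refine ⟨∑ p : Bool × Bool, vacExp (star (win lam k m p) * A * win lam k m p) *
    ((c p.1 * c p.2 : ℝ) : ℂ), ?_⟩
  have h1 : Tendsto (fun x : ℕ × ℕ => ∑ p : Bool × Bool,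
      vacExp (star (win lam k m p) * A * win lam k m p) *
        ((outWeight lam m x.1 p.1 / chainWeight lam x.1 *
          (outWeight lam m x.2 p.2 / chainWeight lam x.2) : ℝ) : ℂ)) (atTop ×ˢ atTop)
      (𝓝 (∑ p : Bool × Bool, vacExp (star (win lam k m p) * A * win lam k m p) *
        ((c p.1 * c p.2 : ℝ) : ℂ))) := by
    refine tendsto_finsetSum _ fun p _ => Tendsto.const_mul _ ?_
    exact (Complex.continuous_ofReal.tendsto _).comp
      (((hc p.1).comp tendsto_fst).mul ((hc p.2).comp tendsto_snd))
  refine h1.congr' ?_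
  filter_upwards [(eventually_ge_atTop (m + 2)).prod_mk (eventually_ge_atTop (m + 2))] with x hx
  exact (voidExp_eq_sum lam k hx.1 hx.2 hA').symm

/-- Local approximation with the uniform bound ‖voidExp A‖ ≤ ‖A‖ makes the expectations Cauchy. The
two chain lengths tend to infinity independently, so that they can later be shifted by different
amounts when the void is moved. -/
theorem exists_tendsto_voidExp (A : QuasiLocal) :
    ∃ l, Tendsto (fun p : ℕ × ℕ => voidExp lam k p.1 p.2 A) (atTop ×ˢ atTop) (𝓝 l) := by
  rw [← cauchy_map_iff_exists_tendsto, Metric.cauchy_iff]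
  refine ⟨inferInstance, fun ε hε => ?_⟩
  obtain ⟨X, B, hB, hAB⟩ := exists_local_approx A (show 0 < ε / 4 by positivity)
  obtain ⟨l, hl⟩ := exists_tendsto_voidExp_of_local lam k hB
  have ev := (Metric.tendsto_nhds.1 hl) (ε / 4) (by positivity)
  refine ⟨Metric.ball l (ε / 2), ?_, ?_⟩
  · rw [mem_map]
    filter_upwards [ev] with x hx
    have h1 : ‖voidExp lam k x.1 x.2 (A - B)‖ < ε / 4 := (norm_voidExp_le lam k _ _ _).trans_lt hAB
    rw [voidExp_sub, ← dist_eq_norm] at h1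
    simp only [Set.mem_preimage, Metric.mem_ball]
    have := dist_triangle (voidExp lam k x.1 x.2 A) (voidExp lam k x.1 x.2 B) l
    linarith
  · intro x hx y hy
    rw [Metric.mem_ball] at hx hy
    have := dist_triangle_right x y l
    linarith

/-- The infinite-volume single-void state, as a linear functional. -/
def voidLim : QuasiLocal →ₗ[ℂ] ℂ where
  toFun A := (exists_tendsto_voidExp lam k A).choose
  map_add' A B := by
    refine tendsto_nhds_unique (exists_tendsto_voidExp lam k (A + B)).choose_spec ?_
    refine ((exists_tendsto_voidExp lam k A).choose_spec.add
      (exists_tendsto_voidExp lam k B).choose_spec).congr fun x => ?_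
    rw [voidExp_add]
  map_smul' c A := by
    refine tendsto_nhds_unique (exists_tendsto_voidExp lam k (c • A)).choose_spec ?_
    refine ((exists_tendsto_voidExp lam k A).choose_spec.const_mul c).congr fun x => ?_
    rw [voidExp_smul]

theorem tendsto_voidLim (A : QuasiLocal) :
    Tendsto (fun p : ℕ × ℕ => voidExp lam k p.1 p.2 A) (atTop ×ˢ atTop) (𝓝 (voidLim lam k A)) :=
  (exists_tendsto_voidExp lam k A).choose_spec

theorem voidLim_star_mul_self_nonneg (A : QuasiLocal) : 0 ≤ voidLim lam k (star A * A) :=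
  ge_of_tendsto' (tendsto_voidLim lam k _) fun _ => voidExp_star_mul_self_nonneg lam k _ _ A

/-- The infinite-volume single-void state. -/
def voidState : QuasiLocal →ₚ[ℂ] ℂ :=
  PositiveLinearMap.mk₀ (voidLim lam k) fun A hA => by
    obtain ⟨B, rfl⟩ := CStarAlgebra.nonneg_iff_eq_star_mul_self.1 hA
    exact voidLim_star_mul_self_nonneg lam k B

theorem tendsto_voidState (A : QuasiLocal) :
    Tendsto (fun p : ℕ × ℕ => voidExp lam k p.1 p.2 A) (atTop ×ˢ atTop)
      (𝓝 (voidState lam k A)) := tendsto_voidLim lam k A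

theorem voidState_one : voidState lam k 1 = 1 :=
  tendsto_nhds_unique (tendsto_voidState lam k 1) (by simp [voidExp_one])

theorem isState_voidState : IsState (voidState lam k).toLinearMap :=
  ⟨voidLim_star_mul_self_nonneg lam k, voidState_one lam k⟩

theorem tendsto_toNat_add : Tendsto (fun n : ℕ => ((n + k).toNat, (n - k).toNat)) atTop
    (atTop ×ˢ atTop) := by
  refine Tendsto.prodMk ?_ ?_
  · refine tendsto_atTop.2 fun b => ?_
    filter_upwards [eventually_ge_atTop (b + k.natAbs)] with n hn
    omega
  · refine tendsto_atTop.2 fun b => ?_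
    filter_upwards [eventually_ge_atTop (b + k.natAbs)] with n hn
    omega

theorem tendsto_singleVoidExpectation (A : QuasiLocal) :
    Tendsto (fun n : ℕ => singleVoidExpectation lam k n A) atTop (𝓝 (voidState lam k A)) := by
  refine ((tendsto_voidState lam k A).comp (tendsto_toNat_add k)).congr' ?_
  filter_upwards [eventually_ge_atTop k.natAbs] with n hn
  exact (singleVoidExpectation_eq lam k n (by rw [Int.abs_eq_natAbs]; exact_mod_cast hn) A).symm

end SpinChain

end


noncomputable section

namespace SpinChain

variable (lam : ℂ) (k : ℤ)

/-! ### The support projections of the single-void states -/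

/-- The number of monomers in the window parts. -/
def winLen (m : ℕ) : Bool → ℕ
  | false => m + 1
  | true => m

theorem winL_eq (m : ℕ) (i : Bool) :
    winL lam k m i = chain lam (3 * k - 3 * winLen m i) (winLen m i) := by
  cases i
  · have e : 3 * k - 3 * ((m + 1 : ℕ) : ℤ) = 3 * k - 3 * m - 3 := by push_cast; ring
    rw [winLen, e]; rfl
  · rfl

/-- The predicate of lying in the interior of the window. -/
def InInterior (m : ℕ) (z : ℤ) : Prop := 3 * k - 3 * m < z ∧ z < 3 * k + 3 * m

/-- A window part is itself a finite single-void vector, possibly multiplied by the pair of a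
straddling dimer at the right edge. The pair lies outside the interior and splits off with norm one.
-/
theorem vacExp_win_self {m : ℕ} {A : QuasiLocal} (hA : SupportedIn (InInterior k m) A)
    (p : Bool × Bool) : vacExp (star (win lam k m p) * A * win lam k m p) =
      ((chainWeight lam (winLen m p.1) * chainWeight lam (winLen m p.2) : ℝ) : ℂ) *
        voidExp lam k (winLen m p.1) (winLen m p.2) A := by
  rw [voidExp, mul_div_cancel₀ _ (weight_mul_ne_zero lam _ _)]
  rcases p with ⟨i, _ | _⟩
  · rw [win, winL_eq]; rfl
  · have e : win lam k m (i, true) = voidOp lam k (winLen m i) m *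
        (raise (3 * k + 3 * m + 2) * raise (3 * k + 3 * m + 3)) := by
      rw [win, winL_eq, winR, voidOp, mul_assoc]
    have hr : SupportedIn (fun z => 3 * k + 3 * m + 2 ≤ z)
        (raise (3 * k + 3 * m + 2) * raise (3 * k + 3 * m + 3)) :=
      (SupportedIn.raise (by omega)).mul (.raise (by omega))
    have hv : SupportedIn (fun z => z < 3 * k + 3 * m + 2) (voidOp lam k (winLen m i) m) :=
      ((chain_supportedIn lam _ _).mono fun z h => by omega).mul
        ((chain_supportedIn lam _ _).mono fun z h => by omega)
    rw [e, SupportedIn.vacExp_star_mul_mul hv hv hr hr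
      (hA.mono fun z h => by unfold InInterior at h; omega) (fun z h1 h2 => by omega),
      vacExp_star_pair (by omega), mul_one]
    rfl

/-- Different parts differ at an edge of the window, beyond the reach of A. The factors at the other
edge are absorbed into the observable, which reduces the claim to a single edge. -/
theorem vacExp_win_ne {m : ℕ} {A : QuasiLocal} (hA : SupportedIn (InInterior k m) A)
    {p q : Bool × Bool} (hpq : p ≠ q) :
    vacExp (star (win lam k m p) * A * win lam k m q) = 0 := by
  have hc : ∀ i j, Commute (winL lam k m i) (winR lam k m j) := fun i j =>
    (winL_supportedIn lam k m i).commute (winR_supportedIn lam k m j) (fun z h1 h2 => by omega)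
  by_cases h1 : p.1 = q.1
  · have h2 : p.2 ≠ q.2 := fun h2 => hpq (Prod.ext h1 h2)
    have e : star (win lam k m p) * A * win lam k m q = star (winR lam k m p.2) *
        (star (winL lam k m p.1) * A * winL lam k m q.1) * winR lam k m q.2 := by
      rw [win, win, star_mul]; noncomm_ring
    rw [e]
    refine vacExp_winR_ne lam k (p := fun z => z < 3 * k + 3 * m + 3) ?_ m (by omega) h2
    exact (((winL_supportedIn lam k m _).mono fun z h => by omega).star.mul
      (hA.mono fun z h => by unfold InInterior at h; omega)).mul
      ((winL_supportedIn lam k m _).mono fun z h => by omega)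
  · have e : star (win lam k m p) * A * win lam k m q = star (winL lam k m p.1) *
        (star (winR lam k m p.2) * A * winR lam k m q.2) * winL lam k m q.1 := by
      rw [win, win, (hc _ _).eq, (hc _ _).eq, star_mul]; noncomm_ring
    rw [e]
    refine vacExp_winL_ne lam k (p := fun z => 3 * k - 3 * m < z) ?_ m (by omega) (by omega) h1
    exact (((winR_supportedIn lam k m _).mono fun z h => by omega).star.mul
      (hA.mono fun z h => by unfold InInterior at h; omega)).mul
      ((winR_supportedIn lam k m _).mono fun z h => by omega)

/-- The projection that empties the window. -/
def winEmpty (m : ℕ) : QuasiLocal :=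
  emptyProj (Finset.Icc (3 * k - 3 * (m : ℤ) - 3) (3 * k + 3 * (m : ℤ) + 3))

theorem winEmpty_supportedIn (m : ℕ) : SupportedIn (InWindow k m) (winEmpty k m) :=
  ⟨_, fun _ hx => Finset.mem_Icc.1 hx, emptyProj_mem _⟩

theorem winEmpty_mul_mul {m : ℕ} {A : QuasiLocal} (hA : SupportedIn (InWindow k m) A) :
    winEmpty k m * A * winEmpty k m = vacExp A • winEmpty k m := by
  obtain ⟨X, hX, hA⟩ := hA
  exact emptyProj_mul_mul_emptyProj (localAlgebra_mono (fun x hx => Finset.mem_Icc.2 (hX x hx)) hA)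

/-- The projections onto the window parts. -/
def winProj (m : ℕ) (p : Bool × Bool) : QuasiLocal :=
  ((chainWeight lam (winLen m p.1) * chainWeight lam (winLen m p.2) : ℝ) : ℂ)⁻¹ •
    (win lam k m p * winEmpty k m * star (win lam k m p))

theorem InInterior.inWindow {m : ℕ} {z : ℤ} (h : InInterior k m z) : InWindow k m z := by
  unfold InInterior at h; unfold InWindow; omega

/-- In the window each projection is a normalised ket-bra: w E w* with E emptying the window. The
middle factor E w* A w' E collapses to a vacuum expectation times E. -/
theorem winProj_mul_mul {m : ℕ} {A : QuasiLocal} (hA : SupportedIn (InInterior k m) A)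
    (p q : Bool × Bool) : winProj lam k m p * A * winProj lam k m q =
      if p = q then voidExp lam k (winLen m p.1) (winLen m p.2) A • winProj lam k m p else 0 := by
  have hw := ((win_supportedIn lam k m p).star.mul (hA.mono fun z h => h.inWindow)).mul
    (win_supportedIn lam k m q)
  have e : win lam k m p * winEmpty k m * star (win lam k m p) * A *
      (win lam k m q * winEmpty k m * star (win lam k m q)) =
      vacExp (star (win lam k m p) * A * win lam k m q) •
        (win lam k m p * winEmpty k m * star (win lam k m q)) := by
    calc _ = win lam k m p * (winEmpty k m * (star (win lam k m p) * A * win lam k m q) *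
          winEmpty k m) * star (win lam k m q) := by noncomm_ring
      _ = _ := by rw [winEmpty_mul_mul k hw, mul_smul_comm, smul_mul_assoc]
  rw [winProj, winProj, smul_mul_assoc, smul_mul_smul_comm, e]
  split_ifs with h
  · subst h
    have := weight_mul_ne_zero lam (winLen m p.1) (winLen m p.2)
    rw [vacExp_win_self lam k hA, smul_smul, smul_smul]
    congr 1
    field_simp
  · rw [vacExp_win_ne lam k hA h, zero_smul, smul_zero]

theorem isSelfAdjoint_winProj (m : ℕ) (p : Bool × Bool) : IsSelfAdjoint (winProj lam k m p) := by
  rw [IsSelfAdjoint, winProj, star_smul, star_mul, star_mul, star_star, winEmpty, star_emptyProj,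
    mul_assoc]
  simp

theorem winProj_mul_self (m : ℕ) (p : Bool × Bool) :
    winProj lam k m p * winProj lam k m p = winProj lam k m p := by
  have := winProj_mul_mul lam k (m := m) SupportedIn.one p p
  rwa [mul_one, if_pos rfl, voidExp_one, one_smul] at this

theorem norm_le_one_of_projection {P : QuasiLocal} (h1 : IsSelfAdjoint P) (h2 : P * P = P) :
    ‖P‖ ≤ 1 := by
  have h := CStarRing.norm_star_mul_self (x := P)
  rw [h1.star_eq, h2] at h
  nlinarith [norm_nonneg P]

/-- The support projection of a single-void state in a window. -/
def suppProj (m : ℕ) : QuasiLocal := ∑ p, winProj lam k m p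

theorem isSelfAdjoint_suppProj (m : ℕ) : IsSelfAdjoint (suppProj lam k m) := by
  rw [IsSelfAdjoint, suppProj, star_sum]
  exact Finset.sum_congr rfl fun p _ => isSelfAdjoint_winProj lam k m p

theorem suppProj_mul_mul {m : ℕ} {A : QuasiLocal} (hA : SupportedIn (InInterior k m) A) :
    suppProj lam k m * A * suppProj lam k m =
      ∑ p, voidExp lam k (winLen m p.1) (winLen m p.2) A • winProj lam k m p := by
  rw [suppProj, Finset.sum_mul, Finset.sum_mul_sum]
  refine Finset.sum_congr rfl fun p _ => ?_
  simp only [winProj_mul_mul lam k hA]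
  simp

theorem suppProj_mul_self (m : ℕ) : suppProj lam k m * suppProj lam k m = suppProj lam k m := by
  have := suppProj_mul_mul lam k (m := m) SupportedIn.one
  simp only [mul_one, voidExp_one, one_smul] at this
  exact this

theorem winProj_mul_win_mul_winEmpty (m : ℕ) (p q : Bool × Bool) :
    winProj lam k m p * (win lam k m q * winEmpty k m) =
      if p = q then win lam k m q * winEmpty k m else 0 := by
  have hw := (win_supportedIn lam k m p).star.mul (win_supportedIn lam k m q)
  have e : win lam k m p * winEmpty k m * star (win lam k m p) * (win lam k m q * winEmpty k m) =
      vacExp (star (win lam k m p) * win lam k m q) • (win lam k m p * winEmpty k m) := by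
    calc _ = win lam k m p * (winEmpty k m * (star (win lam k m p) * win lam k m q) *
          winEmpty k m) := by noncomm_ring
      _ = _ := by rw [winEmpty_mul_mul k hw, mul_smul_comm]
  rw [winProj, smul_mul_assoc, e]
  split_ifs with h
  · subst h
    have h1 := vacExp_win_self lam k (m := m) SupportedIn.one p
    rw [mul_one, voidExp_one, mul_one] at h1
    rw [h1, smul_smul, inv_mul_cancel₀ (weight_mul_ne_zero lam _ _), one_smul]
  · have h1 := vacExp_win_ne lam k (m := m) SupportedIn.one h
    rw [mul_one] at h1
    rw [h1, zero_smul, smul_zero]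

/-- A long single-void vector is a sum of window parts times outer parts. Inserting the emptying
projection in front of the vacuum changes nothing and exposes ranges fixed by the respective
projections. -/
theorem suppProj_voidOp {m a b : ℕ} (ha : m + 2 ≤ a) (hb : m + 2 ≤ b) :
    (suppProj lam k m).op ((voidOp lam k a b).op vacuum) = (voidOp lam k a b).op vacuum := by
  have hV : (winEmpty k m).op vacuum = vacuum := emptyProj_vacuum _
  have h1 : (voidOp lam k a b).op vacuum =
      (∑ q, win lam k m q * winEmpty k m * outer lam k m a b q).op vacuum := by
    rw [voidOp_eq_sum lam k ha hb, op_sum, op_sum, sum_apply, sum_apply]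
    refine Finset.sum_congr rfl fun q _ => ?_
    have hc : Commute (winEmpty k m) (outer lam k m a b q) :=
      (winEmpty_supportedIn k m).commute (outer_supportedIn lam k ha b q) (fun z h1 h2 => h2 h1)
    rw [mul_assoc, hc.eq, ← mul_assoc, op_mul_apply _ (winEmpty k m), hV]
  rw [h1, ← op_mul_apply]
  congr 2
  rw [suppProj, Finset.sum_mul_sum, Finset.sum_comm]
  refine Finset.sum_congr rfl fun q _ => ?_
  simp only [← mul_assoc _ _ (outer lam k m a b q), winProj_mul_win_mul_winEmpty]
  simp

theorem voidState_suppProj (m : ℕ) : voidState lam k (suppProj lam k m) = 1 := by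
  refine tendsto_nhds_unique (tendsto_voidState lam k _) (tendsto_const_nhds.congr' ?_)
  filter_upwards [(eventually_ge_atTop (m + 2)).prod_mk (eventually_ge_atTop (m + 2))] with x hx
  rw [← voidExp_one lam k x.1 x.2, voidExp, voidExp, vacExp_star_mul_mul_eq,
    vacExp_star_mul_mul_eq, suppProj_voidOp lam k hx.1 hx.2, op_one_apply]

theorem tendsto_winLen (i : Bool) : Tendsto (fun m => winLen m i) atTop atTop := by
  cases i
  · exact tendsto_add_atTop_nat 1
  · exact tendsto_id

/-- The support projections compress every observable to its expectation asymptotically. -/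
theorem tendsto_norm_suppProj (A : QuasiLocal) :
    Tendsto (fun m => ‖suppProj lam k m * A * suppProj lam k m -
      voidState lam k A • suppProj lam k m‖) atTop (𝓝 0) := by
  have hP : ∀ m, ‖suppProj lam k m‖ ≤ 1 := fun m =>
    norm_le_one_of_projection (isSelfAdjoint_suppProj lam k m) (suppProj_mul_self lam k m)
  have hloc : ∀ X : Finset ℤ, ∀ B ∈ localAlgebra X,
      Tendsto (fun m => ‖suppProj lam k m * B * suppProj lam k m -
        voidState lam k B • suppProj lam k m‖) atTop (𝓝 0) := by
    intro X B hB
    obtain ⟨m₀, hm₀⟩ := supportedIn_inWindow k hB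
    -- All four coefficients have the same limit, the infinite-volume expectation. This is why a
    -- projection onto four window parts compresses as if it had rank one.
    have hlim : Tendsto (fun m => ∑ p : Bool × Bool,
        ‖voidExp lam k (winLen m p.1) (winLen m p.2) B - voidState lam k B‖) atTop (𝓝 0) := by
      rw [show (0 : ℝ) = ∑ p : Bool × Bool, 0 by simp]
      refine tendsto_finsetSum _ fun p _ => ?_
      have h1 := (tendsto_voidState lam k B).comp
        ((tendsto_winLen p.1).prodMk (tendsto_winLen p.2))
      exact (tendsto_iff_norm_sub_tendsto_zero.1 h1)
    refine squeeze_zero' (Eventually.of_forall fun _ => norm_nonneg _) ?_ hlim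
    filter_upwards [eventually_ge_atTop m₀] with m hm
    rw [suppProj_mul_mul lam k (hm₀ m hm), suppProj, Finset.smul_sum, ← Finset.sum_sub_distrib]
    refine (norm_sum_le _ _).trans (Finset.sum_le_sum fun p _ => ?_)
    rw [← sub_smul, norm_smul]
    exact mul_le_of_le_one_right (norm_nonneg _)
      (norm_le_one_of_projection (isSelfAdjoint_winProj lam k m p) (winProj_mul_self lam k m p))
  rw [Metric.tendsto_atTop]
  intro ε hε
  obtain ⟨X, B, hB, hAB⟩ := exists_local_approx A (show 0 < ε / 4 by positivity)
  obtain ⟨N, hN⟩ := Metric.tendsto_atTop.1 (hloc X B hB) (ε / 4) (by positivity)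
  refine ⟨N, fun m hm => ?_⟩
  have h1 := hN m hm
  rw [dist_zero_right, norm_norm] at h1 ⊢
  have dec : suppProj lam k m * A * suppProj lam k m - voidState lam k A • suppProj lam k m =
      (suppProj lam k m * B * suppProj lam k m - voidState lam k B • suppProj lam k m) +
      suppProj lam k m * (A - B) * suppProj lam k m -
      voidState lam k (A - B) • suppProj lam k m := by
    rw [map_sub, sub_smul]; noncomm_ring
  have h2 : ‖suppProj lam k m * (A - B) * suppProj lam k m‖ ≤ ε / 4 := by
    refine (norm_mul_le _ _).trans ((mul_le_of_le_one_right (norm_nonneg _) (hP m)).trans ?_)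
    refine (norm_mul_le _ _).trans ?_
    exact (mul_le_of_le_one_left (norm_nonneg _) (hP m)).trans hAB.le
  have h3 : ‖voidState lam k (A - B) • suppProj lam k m‖ ≤ ε / 4 := by
    rw [norm_smul]
    refine (mul_le_of_le_one_right (norm_nonneg _) (hP m)).trans ?_
    exact ((voidState lam k).norm_apply_le_of_map_one (voidState_one lam k) _).trans hAB.le
  rw [dec]
  refine (norm_sub_le _ _).trans_lt ?_
  have := norm_add_le (suppProj lam k m * B * suppProj lam k m -
    voidState lam k B • suppProj lam k m) (suppProj lam k m * (A - B) * suppProj lam k m)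
  linarith

/-! ### Purity -/

theorem vectorFunctional_apply (ρ : QuasiLocal →ₚ[ℂ] ℂ) (x : ρ.GNS) (A : QuasiLocal) :
    vectorFunctional ρ x A = ⟪x, ρ.gnsStarAlgHom A x⟫_ℂ := rfl

theorem vectorFunctional_star_mul (ρ : QuasiLocal →ₚ[ℂ] ℂ) (x : ρ.GNS) (A B : QuasiLocal) :
    vectorFunctional ρ x (star A * B) = ⟪ρ.gnsStarAlgHom A x, ρ.gnsStarAlgHom B x⟫_ℂ := by
  rw [vectorFunctional_apply, map_mul, ρ.inner_gnsStarAlgHom_left]; rfl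

theorem vectorFunctional_star_mul_self (ρ : QuasiLocal →ₚ[ℂ] ℂ) (x : ρ.GNS) (A : QuasiLocal) :
    vectorFunctional ρ x (star A * A) = ((‖ρ.gnsStarAlgHom A x‖ ^ 2 : ℝ) : ℂ) := by
  rw [vectorFunctional_star_mul, inner_self_eq_norm_sq_to_K]; norm_cast

theorem vectorFunctional_one (ρ : QuasiLocal →ₚ[ℂ] ℂ) {x : ρ.GNS} (hx : ‖x‖ = 1) :
    vectorFunctional ρ x 1 = 1 := by
  rw [vectorFunctional_apply, map_one]
  change ⟪x, x⟫_ℂ = 1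
  rw [inner_self_eq_norm_sq_to_K, hx]
  norm_num

theorem isState_vectorFunctional (ρ : QuasiLocal →ₚ[ℂ] ℂ) {x : ρ.GNS} (hx : ‖x‖ = 1) :
    IsState (vectorFunctional ρ x) :=
  ⟨fun A => by
    rw [vectorFunctional_star_mul_self]; exact Complex.zero_le_real.2 (sq_nonneg _),
    vectorFunctional_one ρ hx⟩

/-- All unit vectors in the GNS space of a single-void state give pure states. -/
theorem isPureState_vectorFunctional {x : (voidState lam k).GNS} (hx : ‖x‖ = 1) :
    IsPureState (vectorFunctional (voidState lam k) x) := by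
  refine mem_extremePoints_iff_left.2 ⟨isState_vectorFunctional _ hx, ?_⟩
  rintro g hg g' hg' ⟨s, t, hs, ht, _, hst⟩
  have hgn : ∀ A : QuasiLocal, 0 ≤ A → 0 ≤ g A := fun A hA => by
    obtain ⟨B, rfl⟩ := CStarAlgebra.nonneg_iff_eq_star_mul_self.1 hA
    exact hg.1 B
  let G : QuasiLocal →ₚ[ℂ] ℂ := PositiveLinearMap.mk₀ g hgn
  -- The vector state is s g + t g' with s, t > 0, so it dominates s g.
  have hdom : ∀ A, (G (star A * A)).re ≤
      s⁻¹ * (vectorFunctional (voidState lam k) x (star A * A)).re := by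
    intro A
    have h1 : (vectorFunctional (voidState lam k) x (star A * A)).re =
        s * (g (star A * A)).re + t * (g' (star A * A)).re := by
      rw [← hst]; simp
    have h2 : 0 ≤ (g' (star A * A)).re := (Complex.le_def.1 (hg'.1 A)).1
    rw [h1, ← div_eq_inv_mul, le_div_iff₀ hs]
    change (g (star A * A)).re * s ≤ _
    nlinarith [mul_nonneg ht.le h2]
  refine LinearMap.ext fun A => ?_
  refine G.apply_eq_of_dominated hg.2 _ s⁻¹ (by positivity) hdom A fun ε hε => ?_
  obtain ⟨e, he, h1, h2⟩ := (voidState lam k).exists_compression (suppProj lam k)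
    (isSelfAdjoint_suppProj lam k) (suppProj_mul_self lam k) (voidState_suppProj lam k)
    (voidState_one lam k) (tendsto_norm_suppProj lam k) x hx A ε hε
  refine ⟨e, he, ?_, h2⟩
  have h3 : (1 - e) * (1 - e) = star (1 - e) * (1 - e) := by simp [he.star_eq]
  rw [h3, vectorFunctional_star_mul_self, Complex.ofReal_re, map_sub, map_one]
  change ‖x - (voidState lam k).gnsStarAlgHom e x‖ ^ 2 ≤ ε ^ 2
  gcongr

end SpinChain

end


noncomputable section

/-! ### Local observables acting on single-void vectors -/

namespace SpinChain

variable (lam : ℂ) (k : ℤ)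

namespace SupportedIn

variable {p q : ℤ → Prop} {A B : QuasiLocal} {x : ℤ}

theorem lower_vacuum (hA : SupportedIn p A) (h : ¬ p x) : (SpinChain.lower x).op (A.op vacuum) = 0 := by
  rw [← op_mul_apply, ((SupportedIn.lower (p := fun z => z = x) rfl).commute hA
    (fun z h1 h2 => h (h1 ▸ h2))).eq, op_mul_apply, SpinChain.lower_vacuum, map_zero]

theorem number_vacuum (hA : SupportedIn p A) (h : ¬ p x) :
    (SpinChain.number x).op (A.op vacuum) = 0 := by
  rw [SpinChain.number, op_mul_apply, hA.lower_vacuum h, map_zero]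

theorem lower_raise_vacuum (hA : SupportedIn p A) (h : ¬ p x) (hB : SupportedIn q B) (h' : ¬ q x) :
    (SpinChain.lower x).op ((A * (SpinChain.raise x * B)).op vacuum) = (A * B).op vacuum := by
  rw [← op_mul_apply, ← mul_assoc, ((SupportedIn.lower (p := fun z => z = x) rfl).commute hA
    (fun z h1 h2 => h (h1 ▸ h2))).eq, mul_assoc, op_mul_apply, ← mul_assoc, lower_mul_raise,
    op_mul_apply, op_mul_apply]
  congr 1
  rw [op_sub, sub_apply, op_mul_apply, hB.lower_vacuum h', map_zero, sub_zero, op_one_apply]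

theorem number_raise (hA : SupportedIn p A) (h : ¬ p x) (B : QuasiLocal) (f : Config) :
    (SpinChain.number x).op ((A * (SpinChain.raise x * B)).op f) =
      (A * (SpinChain.raise x * B)).op f := by
  have e : SpinChain.number x * SpinChain.raise x = SpinChain.raise x := by
    rw [SpinChain.number, mul_assoc, lower_mul_raise, mul_sub, mul_one, ← mul_assoc,
      raise_mul_self, zero_mul, sub_zero]
  rw [← op_mul_apply, ← mul_assoc, ((SupportedIn.number (p := fun z => z = x) rfl).commute hA
    (fun z h1 h2 => h (h1 ▸ h2))).eq, mul_assoc, ← mul_assoc _ _ B, e]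

end SupportedIn

theorem chain_add_two_mul (A B : QuasiLocal) (x : ℤ) (L : ℕ) : A * chain lam x (L + 2) * B =
    A * (raise x * (chain lam (x + 3) (L + 1) * B)) +
      lam • (A * (raise (x + 1) * (raise (x + 2) * (chain lam (x + 6) L * B)))) := by
  rw [chain_add_two, mul_add, add_mul, mul_smul_comm, smul_mul_assoc]
  simp only [mul_assoc]

theorem lower_chain_first {p : ℤ → Prop} {A : QuasiLocal} (hA : SupportedIn p A) {y : ℤ}
    (h : ¬ p y) (b : ℕ) : (lower y).op ((A * chain lam y (b + 1)).op vacuum) =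
      (A * chain lam (y + 3) b).op vacuum := by
  rw [← op_mul_apply, ← mul_assoc, ((SupportedIn.lower (p := fun z => z = y) rfl).commute hA
    (fun z h1 h2 => h (h1 ▸ h2))).eq, mul_assoc, op_mul_apply, op_mul_apply, op_mul_apply,
    chain, ← vmdVector_eq, List.replicate_succ, lower_vmdVector_monomer, vmdVector_eq]
  rfl

theorem chain_succ (x : ℤ) (L : ℕ) : chain lam x (L + 2) = chain lam x (L + 1) *
    raise (x + 3 * L + 3) +
      lam • (chain lam x L * (raise (x + 3 * L + 1) * raise (x + 3 * L + 2))) := by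
  have := chain_split lam x L 0
  rwa [zero_add, chain_one, chain_zero, mul_one] at this

/-- The first site of the last triple is occupied only if this triple is a monomer; if a dimer ends
there, it lies in the empty second half of the dimer. -/
theorem lower_chain_last {q : ℤ → Prop} (x : ℤ) (L : ℕ) {B : QuasiLocal} (hB : SupportedIn q B)
    (h : ¬ q (x + 3 * L)) : (lower (x + 3 * L)).op ((chain lam x (L + 1) * B).op vacuum) =
      (chain lam x L * B).op vacuum := by
  rcases L with _ | L
  · have := SupportedIn.one (p := fun _ => False) |>.lower_raise_vacuum (x := x) (by simp) hB
      (by simpa using h)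
    simpa [chain_one, chain_zero] using this
  · have e : x + 3 * ((L + 1 : ℕ) : ℤ) = x + 3 * L + 3 := by push_cast; ring
    rw [e] at h ⊢
    rw [chain_succ, add_mul, op_add, add_apply, map_add, mul_assoc,
      (chain_supportedIn lam x (L + 1)).lower_raise_vacuum (by push_cast; omega) hB h]
    have h2 : SupportedIn (fun z => z ≠ x + 3 * L + 3) (lam • (chain lam x L *
        (raise (x + 3 * L + 1) * raise (x + 3 * L + 2))) * B) :=
      ((((chain_supportedIn lam x L).mono fun z h => by omega).mul
        ((SupportedIn.raise (by omega)).mul (.raise (by omega)))).smul lam).mul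
        (hB.mono fun z h1 h2 => h (h2 ▸ h1))
    rw [h2.lower_vacuum (by simp), add_zero]

/-! ### Moving the void -/

/-- The observable that moves the void by one domino to the right. -/
def moveRight : QuasiLocal :=
  (1 + lam • (raise (3 * k - 2) * raise (3 * k - 1) * (lower (3 * k - 3) * lower (3 * k)))) *
    (raise (3 * k) * lower (3 * k + 1))

/-- The observable that moves the void by one domino to the left. -/
def moveLeft : QuasiLocal :=
  (1 + lam • (raise (3 * k - 1) * raise (3 * k) * (lower (3 * k - 2) * lower (3 * k + 1)))) *
    (raise (3 * k - 2) * lower (3 * k - 3))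

/-- Lowering at 3k + 1 selects and strips a leading monomer of the right chain; raising at 3k
appends a monomer to the left chain. The tilings in which the new left chain ends with a dimer are
still missing. The λ term supplies them by turning the monomers at 3k - 3 and 3k into one dimer. -/
theorem moveRight_voidOp (a b : ℕ) :
    (moveRight lam k).op ((voidOp lam k (a + 1) (b + 1)).op vacuum) =
      (voidOp lam (k + 1) (a + 2) (b + 0)).op vacuum := by
  set x : ℤ := 3 * k - 3 * ((a + 1 : ℕ) : ℤ) with hx
  have hx' : x + 3 * a = 3 * k - 3 := by rw [hx]; push_cast; ring
  have hA := chain_supportedIn lam x (a + 1)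
  have hC : SupportedIn (fun z => 3 * k + 4 ≤ z) (chain lam (3 * k + 4) b) :=
    (chain_supportedIn lam _ _).mono fun z h => h.1
  have e0 : voidOp lam k (a + 1) (b + 1) = chain lam x (a + 1) * chain lam (3 * k + 1) (b + 1) := rfl
  have e1 : voidOp lam (k + 1) (a + 2) (b + 0) = chain lam x (a + 2) * chain lam (3 * k + 4) b := by
    rw [voidOp]; congr 2
    · rw [hx]; push_cast; ring
    · ring
  have s1 := lower_chain_first lam hA (y := 3 * k + 1) (by push_cast; omega) b
  rw [show 3 * k + 1 + 3 = 3 * k + 4 by ring] at s1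
  have s2 : (raise (3 * k)).op ((chain lam x (a + 1) * chain lam (3 * k + 4) b).op vacuum) =
      (chain lam x (a + 1) * (raise (3 * k) * chain lam (3 * k + 4) b)).op vacuum := by
    rw [← op_mul_apply, ← mul_assoc, ((SupportedIn.raise (p := fun z => z = 3 * k) rfl).commute hA
      (fun z h1 h2 => by push_cast at h2; omega)).eq, mul_assoc]
  have s3 := hA.lower_raise_vacuum (x := 3 * k) (by push_cast; omega) hC (by omega)
  have s4 := lower_chain_last lam x a hC (by omega)
  rw [hx'] at s4
  have hrr : SupportedIn (fun z => 3 * k - 2 ≤ z) (raise (3 * k - 2) * raise (3 * k - 1)) :=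
    (SupportedIn.raise (by omega)).mul (.raise (by omega))
  have s5 : (raise (3 * k - 2) * raise (3 * k - 1)).op
      ((chain lam x a * chain lam (3 * k + 4) b).op vacuum) =
      (chain lam x a * (raise (3 * k - 2) * raise (3 * k - 1)) * chain lam (3 * k + 4) b).op
        vacuum := by
    rw [← op_mul_apply, ← mul_assoc, (hrr.commute (chain_supportedIn lam x a)
      (fun z h1 h2 => by omega)).eq]
  have s6 := chain_succ lam x a
  rw [show x + 3 * a + 1 = 3 * k - 2 by omega, show x + 3 * a + 2 = 3 * k - 1 by omega,
    show x + 3 * a + 3 = 3 * k by omega] at s6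
  have s7 : ∀ v, (moveRight lam k).op v = (raise (3 * k)).op ((lower (3 * k + 1)).op v) +
      lam • (raise (3 * k - 2) * raise (3 * k - 1)).op ((lower (3 * k - 3)).op ((lower (3 * k)).op
        ((raise (3 * k)).op ((lower (3 * k + 1)).op v)))) := fun v => rfl
  rw [s7, e0, e1, s1, s2, s3, s4, s5, s6, add_mul, op_add,
    add_apply, smul_mul_assoc, op_smul, smul_apply, mul_assoc _ (raise (3 * k))]

/-- The mirror procedure: the last monomer of the left chain is stripped, one is prepended to the
right chain at 3k - 2, and the λ term turns the monomers at 3k - 2 and 3k + 1 into the missing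
leading dimers. -/
theorem moveLeft_voidOp (a b : ℕ) :
    (moveLeft lam k).op ((voidOp lam k (a + 1) (b + 1)).op vacuum) =
      (voidOp lam (k - 1) (a + 0) (b + 2)).op vacuum := by
  set x : ℤ := 3 * k - 3 * ((a + 1 : ℕ) : ℤ) with hx
  have hx' : x + 3 * a = 3 * k - 3 := by rw [hx]; push_cast; ring
  have hA := chain_supportedIn lam x a
  have hC : SupportedIn (fun z => 3 * k + 1 ≤ z) (chain lam (3 * k + 1) (b + 1)) :=
    (chain_supportedIn lam _ _).mono fun z h => h.1
  have hC' : SupportedIn (fun z => 3 * k + 4 ≤ z) (chain lam (3 * k + 4) b) :=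
    (chain_supportedIn lam _ _).mono fun z h => h.1
  have e0 : voidOp lam k (a + 1) (b + 1) = chain lam x (a + 1) * chain lam (3 * k + 1) (b + 1) := rfl
  have e1 : voidOp lam (k - 1) (a + 0) (b + 2) = chain lam x a * chain lam (3 * k - 2) (b + 2) := by
    rw [voidOp]; congr 2
    · rw [hx]; push_cast; ring
    · ring
  have s1 := lower_chain_last lam x a hC (by omega)
  rw [hx'] at s1
  have s2 : (raise (3 * k - 2)).op ((chain lam x a * chain lam (3 * k + 1) (b + 1)).op vacuum) =
      (chain lam x a * raise (3 * k - 2) * chain lam (3 * k + 1) (b + 1)).op vacuum := by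
    rw [← op_mul_apply, ← mul_assoc, ((SupportedIn.raise (p := fun z => z = 3 * k - 2) rfl).commute
      hA (fun z h1 h2 => by omega)).eq]
  have hAr : SupportedIn (fun z => z ≤ 3 * k - 2) (chain lam x a * raise (3 * k - 2)) :=
    (hA.mono fun z h => by omega).mul (.raise (by omega))
  have s3 := lower_chain_first lam hAr (y := 3 * k + 1) (by omega) b
  rw [show 3 * k + 1 + 3 = 3 * k + 4 by ring] at s3
  have s4 := hA.lower_raise_vacuum (x := 3 * k - 2) (by omega) hC' (by omega)
  have hrr : SupportedIn (fun z => 3 * k - 2 ≤ z) (raise (3 * k - 1) * raise (3 * k)) :=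
    (SupportedIn.raise (by omega)).mul (.raise (by omega))
  have s5 : (raise (3 * k - 1) * raise (3 * k)).op
      ((chain lam x a * chain lam (3 * k + 4) b).op vacuum) =
      (chain lam x a * (raise (3 * k - 1) * raise (3 * k) * chain lam (3 * k + 4) b)).op
        vacuum := by
    rw [← op_mul_apply, ← mul_assoc, (hrr.commute hA (fun z h1 h2 => by omega)).eq, mul_assoc]
  have s6 := chain_add_two lam (3 * k - 2) b
  rw [show 3 * k - 2 + 3 = 3 * k + 1 by omega, show 3 * k - 2 + 1 = 3 * k - 1 by omega,
    show 3 * k - 2 + 2 = 3 * k by omega, show 3 * k - 2 + 6 = 3 * k + 4 by omega] at s6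
  have s7 : ∀ v, (moveLeft lam k).op v = (raise (3 * k - 2)).op ((lower (3 * k - 3)).op v) +
      lam • (raise (3 * k - 1) * raise (3 * k)).op ((lower (3 * k - 2)).op
        ((lower (3 * k + 1)).op ((raise (3 * k - 2)).op ((lower (3 * k - 3)).op v)))) :=
    fun v => rfl
  rw [s7, e0, e1, s1, s2, s3, mul_assoc (chain lam x a) _ (chain lam (3 * k + 4) b), s4, s5, s6,
    mul_add, op_add, add_apply, mul_smul_comm, op_smul, smul_apply, mul_assoc]

theorem tendsto_chainWeight_add_div (c d : ℕ) :
    Tendsto (fun n => chainWeight lam (n + c) / chainWeight lam (n + d)) atTop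
      (𝓝 (muPlus lam ^ c / muPlus lam ^ d)) := by
  have h1 := (tendsto_chainWeight_div lam d).comp (tendsto_add_atTop_nat (c + d))
  have h2 := (tendsto_chainWeight_div lam c).comp (tendsto_add_atTop_nat (c + d))
  have hP := (muPlus_pos lam).ne'
  have h3 := h1.div h2 (pow_ne_zero _ (inv_ne_zero hP))
  have e : (muPlus lam)⁻¹ ^ d / (muPlus lam)⁻¹ ^ c = muPlus lam ^ c / muPlus lam ^ d := by
    rw [inv_pow, inv_pow]; field_simp
  rw [e] at h3
  refine h3.congr fun n => ?_
  simp only [Pi.div_apply, Function.comp_apply]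
  rw [show n + (c + d) - d = n + c by omega, show n + (c + d) - c = n + d by omega,
    div_div_div_cancel_right₀ (chainWeight_pos lam _).ne']

/-- A local observable that transforms the vectors of one single-void state into those of
another. -/
theorem voidState_eq_conj {k k' : ℤ} {T : QuasiLocal} {c d : ℕ} (hcd : c + d = 2)
    (hT : ∀ a b, T.op ((voidOp lam k (a + 1) (b + 1)).op vacuum) =
      (voidOp lam k' (a + c) (b + d)).op vacuum) (A : QuasiLocal) :
    voidState lam k' A = voidState lam k (star T * A * T) := by
  have hs : ∀ e : ℕ, Tendsto (fun n : ℕ => n + e) atTop atTop := tendsto_add_atTop_nat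
  have h1 := (tendsto_voidState lam k (star T * A * T)).comp
    (((hs 1).comp tendsto_fst).prodMk ((hs 1).comp tendsto_snd) :
      Tendsto (fun p : ℕ × ℕ => (p.1 + 1, p.2 + 1)) (atTop ×ˢ atTop) (atTop ×ˢ atTop))
  have h2 := (tendsto_voidState lam k' A).comp
    (((hs c).comp tendsto_fst).prodMk ((hs d).comp tendsto_snd) :
      Tendsto (fun p : ℕ × ℕ => (p.1 + c, p.2 + d)) (atTop ×ˢ atTop) (atTop ×ˢ atTop))
  have h3 : Tendsto (fun p : ℕ × ℕ => ((chainWeight lam (p.1 + c) / chainWeight lam (p.1 + 1) *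
      (chainWeight lam (p.2 + d) / chainWeight lam (p.2 + 1)) : ℝ) : ℂ)) (atTop ×ˢ atTop)
      (𝓝 1) := by
    have := ((tendsto_chainWeight_add_div lam c 1).comp (tendsto_fst (f := atTop) (g := atTop))).mul
      ((tendsto_chainWeight_add_div lam d 1).comp (tendsto_snd (f := atTop) (g := atTop)))
    -- Moving the void preserves the total number of monomers (c + d = 1 + 1), so the powers of μ₊
    -- cancel and no normalisation constant remains.
    have e : muPlus lam ^ c / muPlus lam ^ 1 * (muPlus lam ^ d / muPlus lam ^ 1) = 1 := by
      rw [div_mul_div_comm, ← pow_add, ← pow_add, hcd,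
        div_self (pow_ne_zero _ (muPlus_pos lam).ne')]
    rw [e] at this
    have h := (Complex.continuous_ofReal.tendsto _).comp this
    rwa [Complex.ofReal_one] at h
  have h4 := h2.mul h3
  rw [mul_one] at h4
  refine tendsto_nhds_unique h4 (h1.congr fun p => ?_)
  simp only [Function.comp_apply]
  rw [voidExp, voidExp, vacExp_star_mul_mul_eq, vacExp_star_mul_mul_eq, op_mul_apply, hT,
    op_mul_apply, op_star, ContinuousLinearMap.adjoint_inner_right, hT, div_mul_div_comm,
    Complex.ofReal_div, mul_comm, mul_div, mul_comm, div_mul_cancel₀ _ (weight_mul_ne_zero lam _ _)]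

/-- All single-void states are vector states in the GNS representation of one of them. -/
theorem exists_voidState_eq_conj (l : ℤ) :
    ∃ B : QuasiLocal, ∀ A, voidState lam l A = voidState lam 0 (star B * A * B) := by
  induction l using Int.induction_on with
  | zero => exact ⟨1, fun A => by simp⟩
  | succ i ih =>
    obtain ⟨B, hB⟩ := ih
    refine ⟨moveRight lam i * B, fun A => ?_⟩
    rw [voidState_eq_conj lam rfl (moveRight_voidOp lam i), hB, star_mul]
    simp only [mul_assoc]
  | pred i ih =>
    obtain ⟨B, hB⟩ := ih
    refine ⟨moveLeft lam (-i) * B, fun A => ?_⟩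
    rw [voidState_eq_conj lam rfl (moveLeft_voidOp lam (-i)), hB, star_mul]
    simp only [mul_assoc]

theorem exists_vectors : ∃ Ω : ℤ → (voidState lam 0).GNS,
    ∀ k A, voidState lam k A = vectorFunctional (voidState lam 0) (Ω k) A := by
  choose B hB using exists_voidState_eq_conj lam
  refine ⟨fun l => (voidState lam 0).gnsVec (B l), fun l A => ?_⟩
  rw [vectorFunctional_apply, (voidState lam 0).gnsStarAlgHom_gnsVec,
    (voidState lam 0).gnsVec_inner, hB, mul_assoc]

/-! ### Observables annihilating a single-void state -/

/-- This transfers annihilation of the finite-volume vectors to the infinite-volume state. The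
hypothesis is only eventual, since some observables require long chains. -/
theorem voidState_star_mul_self_eq_zero {X : QuasiLocal}
    (h : ∀ᶠ p : ℕ × ℕ in atTop ×ˢ atTop, X.op ((voidOp lam k p.1 p.2).op vacuum) = 0) :
    voidState lam k (star X * X) = 0 := by
  refine tendsto_nhds_unique (tendsto_voidState lam k _) (tendsto_const_nhds.congr' ?_)
  filter_upwards [h] with p hp
  rw [voidExp, vacExp_star_mul_mul_eq, op_mul_apply, hp]
  simp

theorem voidOp_vacuum_eq (a b : ℕ) : (voidOp lam k a b).op vacuum = vmdVector lam (3 * k - 3 * a)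
    (List.replicate a .monomer ++ .void :: List.replicate b .monomer) := by
  rw [vmdVector_eq, vmdOp_replicate_append_void, voidOp, sub_add_cancel]; rfl

theorem voidState_star_pairOp (y : ℤ) :
    voidState lam k (star (pairOp lam y) * pairOp lam y) = 0 :=
  voidState_star_mul_self_eq_zero lam k (Eventually.of_forall fun p => by
    rw [voidOp_vacuum_eq, pairOp_vmdVector])

theorem voidState_star_lower_lower (y : ℤ) :
    voidState lam k (star (lower y * lower (y + 2)) * (lower y * lower (y + 2))) = 0 :=
  voidState_star_mul_self_eq_zero lam k (Eventually.of_forall fun p => by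
    rw [voidOp_vacuum_eq, op_mul_apply, lower_lower_add_two_vmdVector])

theorem number_mul_number_eq {x y : ℤ} (h : x ≠ y) :
    number x * number y = star (lower x * lower y) * (lower x * lower y) := by
  rw [star_mul, star_lower, star_lower, number, number]
  calc raise x * lower x * (raise y * lower y)
      = raise x * (lower x * raise y) * lower y := by noncomm_ring
    _ = raise x * raise y * (lower x * lower y) := by
        rw [(commute_lower_raise h).eq]; noncomm_ring
    _ = _ := by rw [(commute_raise_raise x y).eq]

/-- An observable that is one on the configurations `10` and `01` and zero on `00` and `11` at
the sites right of `3k`: it detects a void at `3k` if there is none further to the left. -/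
def voidDetector : QuasiLocal :=
  number (3 * k + 1) + number (3 * k + 2) - (2 : ℂ) • (number (3 * k + 1) * number (3 * k + 2))

theorem star_voidDetector : star (voidDetector k) = voidDetector k := by
  rw [voidDetector, star_sub, star_add, star_smul, star_mul, star_number, star_number,
    (commute_number_number _ _).eq]
  simp

theorem commute_number_voidDetector (x : ℤ) : Commute (number x) (voidDetector k) :=
  ((commute_number_number _ _).add_right (commute_number_number _ _)).sub_right
    (((commute_number_number _ _).mul_right (commute_number_number _ _)).smul_right _)

theorem voidDetector_apply (f : Config) : (voidDetector k).op f = (number (3 * k + 1)).op f +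
    (number (3 * k + 2)).op f -
      (2 : ℂ) • (number (3 * k + 1)).op ((number (3 * k + 2)).op f) := rfl

/-- The right chain starts at 3k + 1, so these two sites read 10 for a monomer and 01 for a dimer.
-/
theorem voidDetector_voidOp_self (a b : ℕ) :
    (voidDetector k).op ((voidOp lam k a (b + 2)).op vacuum) =
      (voidOp lam k a (b + 2)).op vacuum := by
  have hA := chain_supportedIn lam (3 * k - 3 * a) a
  have e := chain_add_two_mul lam (chain lam (3 * k - 3 * a) a) 1 (3 * k + 1) b
  simp only [mul_one] at e
  rw [show 3 * k + 1 + 3 = 3 * k + 4 by ring, show 3 * k + 1 + 1 = 3 * k + 2 by ring,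
    show 3 * k + 1 + 2 = 3 * k + 3 by ring, show 3 * k + 1 + 6 = 3 * k + 7 by ring] at e
  have h1 := hA.number_raise (x := 3 * k + 1) (by omega) (chain lam (3 * k + 4) (b + 1)) vacuum
  have h2 := hA.number_raise (x := 3 * k + 2) (by omega)
    (raise (3 * k + 3) * chain lam (3 * k + 7) b) vacuum
  have s1 : SupportedIn (fun z => z ≠ 3 * k + 2) (chain lam (3 * k - 3 * a) a *
      (raise (3 * k + 1) * chain lam (3 * k + 4) (b + 1))) :=
    (hA.mono fun z h => by omega).mul ((SupportedIn.raise (by omega)).mul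
      ((chain_supportedIn lam _ _).mono fun z h => by omega))
  have s2 : SupportedIn (fun z => z ≠ 3 * k + 1) (chain lam (3 * k - 3 * a) a *
      (raise (3 * k + 2) * (raise (3 * k + 3) * chain lam (3 * k + 7) b))) :=
    (hA.mono fun z h => by omega).mul ((SupportedIn.raise (by omega)).mul
      ((SupportedIn.raise (by omega)).mul
        ((chain_supportedIn lam _ _).mono fun z h => by omega)))
  rw [voidDetector_apply, voidOp, e, op_add, add_apply, op_smul, smul_apply]
  simp only [map_add, map_smul, h1, h2, s1.number_vacuum (x := 3 * k + 2) (by simp),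
    s2.number_vacuum (x := 3 * k + 1) (by simp), smul_zero, add_zero, zero_add, sub_zero]

theorem voidDetector_of_not {p : ℤ → Prop} {A : QuasiLocal} (hA : SupportedIn p A)
    (h1 : ¬ p (3 * k + 1)) (h2 : ¬ p (3 * k + 2)) : (voidDetector k).op (A.op vacuum) = 0 := by
  rw [voidDetector_apply, hA.number_vacuum h1, hA.number_vacuum h2]; simp

/-- The sites 3k, 3k + 1, 3k + 2 now form a triple of the left chain and read 100, 011 or 000, so
the last two agree. -/
theorem voidDetector_voidOp_of_lt {l : ℤ} (h : k < l) {a : ℕ} (ha : l - k + 2 ≤ a) (b : ℕ) :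
    (voidDetector k).op ((voidOp lam l a b).op vacuum) = 0 := by
  -- The left chain is cut at 3k, with L + 1 triples before this site and M + 1 triples between it
  -- and the void at 3l.
  obtain ⟨M, hM⟩ : ∃ M : ℕ, l = k + 1 + M := ⟨(l - k - 1).toNat, by omega⟩
  obtain ⟨L, rfl⟩ : ∃ L : ℕ, a = L + 1 + (M + 1) := ⟨a - M - 2, by omega⟩
  set x : ℤ := 3 * l - 3 * ((L + 1 + (M + 1) : ℕ) : ℤ) with hx
  have hx' : x + 3 * L + 3 = 3 * k := by rw [hx, hM]; push_cast; ring
  set C := chain lam (3 * l + 1) b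
  have hC : SupportedIn (fun z => 3 * k + 4 ≤ z) C :=
    (chain_supportedIn lam _ _).mono fun z h => by omega
  have hA := chain_supportedIn lam x (L + 1)
  rw [voidOp, chain_split, hx', add_mul, op_add, add_apply, map_add]
  have z2 : (voidDetector k).op ((lam • (chain lam x L * (raise (x + 3 * L + 1) *
      raise (x + 3 * L + 2)) * chain lam (x + 3 * L + 6) M) * C).op vacuum) = 0 := by
    refine voidDetector_of_not k (p := fun z => z < 3 * k + 1 ∨ 3 * k + 2 < z) ?_ (by omega)
      (by omega)
    exact (((((chain_supportedIn lam _ _).mono fun z h => by omega).mul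
      ((SupportedIn.raise (by omega)).mul (.raise (by omega)))).mul
      ((chain_supportedIn lam _ _).mono fun z h => by omega)).smul lam).mul
        (hC.mono fun z h => by omega)
  rw [z2, add_zero]
  rcases M with _ | M
  · refine voidDetector_of_not k (p := fun z => z < 3 * k + 1 ∨ 3 * k + 2 < z) ?_ (by omega)
      (by omega)
    rw [zero_add, chain_one]
    exact ((hA.mono fun z h => by push_cast at h; omega).mul (SupportedIn.raise (by omega))).mul
      (hC.mono fun z h => by omega)
  · rw [chain_add_two_mul, op_add, add_apply, op_smul, smul_apply, map_add, map_smul]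
    have z1 : (voidDetector k).op ((chain lam x (L + 1) * (raise (3 * k) *
        (chain lam (3 * k + 3) (M + 1) * C))).op vacuum) = 0 := by
      refine voidDetector_of_not k (p := fun z => z < 3 * k + 1 ∨ 3 * k + 2 < z) ?_ (by omega)
        (by omega)
      exact (hA.mono fun z h => by push_cast at h; omega).mul ((SupportedIn.raise (by omega)).mul
        (((chain_supportedIn lam _ _).mono fun z h => by omega).mul
          (hC.mono fun z h => by omega)))
    have h1 := hA.number_raise (x := 3 * k + 1) (by push_cast; omega)
      (raise (3 * k + 2) * (chain lam (3 * k + 6) M * C)) vacuum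
    have h2 := (hA.mono (q := fun z => z < 3 * k + 2) (fun z h => by push_cast at h; omega)).mul
      (SupportedIn.raise (x := 3 * k + 1) (by omega)) |>.number_raise (x := 3 * k + 2) (by omega)
      (chain lam (3 * k + 6) M * C) vacuum
    rw [mul_assoc] at h2
    rw [z1, zero_add, voidDetector_apply, h2, h1, two_smul, sub_self, smul_zero]

theorem voidState_one_sub_voidDetector :
    voidState lam k (star (1 - voidDetector k) * (1 - voidDetector k)) = 0 := by
  refine voidState_star_mul_self_eq_zero lam k ?_
  filter_upwards [(eventually_ge_atTop 0).prod_mk (eventually_ge_atTop 2)] with p hp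
  obtain ⟨b, hb⟩ := Nat.exists_eq_add_of_le hp.2
  rw [hb, add_comm 2 b, op_sub, sub_apply, op_one_apply, voidDetector_voidOp_self, sub_self]

theorem voidState_voidDetector_of_lt {l : ℤ} (h : k < l) :
    voidState lam l (star (voidDetector k) * voidDetector k) = 0 := by
  refine voidState_star_mul_self_eq_zero lam l ?_
  filter_upwards [(eventually_ge_atTop (l - k + 2).toNat).prod_mk (eventually_ge_atTop 0)] with p hp
  exact voidDetector_voidOp_of_lt lam k h (by have := hp.1; omega) p.2

end SpinChain

end


noncomputable section

namespace SpinChain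

variable (lam : ℂ) (k : ℤ)

/-! ### Densities -/

theorem SupportedIn.off {p : ℤ → Prop} {A : QuasiLocal} (hA : SupportedIn p A) {x : ℤ}
    (h : ¬ p x) : SupportedIn (fun z => z ≠ x) A :=
  hA.mono fun _ hz e => h (e ▸ hz)

theorem number_chain_first {p q : ℤ → Prop} {A B : QuasiLocal} (hA : SupportedIn p A)
    (hB : SupportedIn q B) {x : ℤ} (hp : ¬ p x) (hq : ¬ q x) (M : ℕ) :
    (number x).op ((A * chain lam x (M + 1) * B).op vacuum) =
      (A * (raise x * (chain lam (x + 3) M * B))).op vacuum := by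
  rcases M with _ | M
  · rw [zero_add, chain_one, chain_zero, one_mul, mul_assoc, hA.number_raise hp]
  · have s : SupportedIn (fun z => z ≠ x) (A * (raise (x + 1) * (raise (x + 2) *
        (chain lam (x + 6) M * B)))) :=
      (hA.off hp).mul ((SupportedIn.raise (by omega)).mul
        ((SupportedIn.raise (by omega)).mul (((chain_supportedIn lam _ _).mono fun z h => by
          omega).mul (hB.off hq))))
    rw [chain_add_two_mul, op_add, add_apply, op_smul, smul_apply, map_add, map_smul,
      hA.number_raise hp, s.number_vacuum (by simp), smul_zero, add_zero]

/-- The number operator at the first site of a triple of a chain selects the tilings with a monomer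
on this triple. -/
theorem number_chain_monomer {p q : ℤ → Prop} {A B : QuasiLocal} (hA : SupportedIn p A)
    (hB : SupportedIn q B) {x : ℤ} (L M : ℕ) (hp : ¬ p (x + 3 * L)) (hq : ¬ q (x + 3 * L)) :
    (number (x + 3 * L)).op ((A * chain lam x (L + (M + 1)) * B).op vacuum) =
      (A * chain lam x L * (raise (x + 3 * L) *
        (chain lam (x + 3 * L + 3) M * B))).op vacuum := by
  rcases L with _ | L
  · simp only [Nat.cast_zero, mul_zero, add_zero, zero_add, chain_zero, mul_one] at hp hq ⊢
    exact number_chain_first lam hA hB hp hq M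
  · have e : x + 3 * ((L + 1 : ℕ) : ℤ) = x + 3 * L + 3 := by push_cast; ring
    rw [e] at hp hq ⊢
    have hA' : SupportedIn (fun z => z ≠ x + 3 * L + 3) (A * chain lam x (L + 1)) :=
      (hA.off hp).mul ((chain_supportedIn lam _ _).mono fun z h => by
        push_cast at h; omega)
    have s : SupportedIn (fun z => z ≠ x + 3 * L + 3) (A * (chain lam x L *
        (raise (x + 3 * L + 1) * raise (x + 3 * L + 2)) * chain lam (x + 3 * L + 6) M) * B) :=
      ((hA.off hp).mul ((((chain_supportedIn lam _ _).mono fun z h => by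
        omega).mul ((SupportedIn.raise (by omega)).mul (.raise (by omega)))).mul
        ((chain_supportedIn lam _ _).mono fun z h => by omega))).mul
        (hB.off hq)
    rw [chain_split, mul_add, add_mul, op_add, add_apply, map_add, mul_smul_comm, smul_mul_assoc,
      op_smul, smul_apply, map_smul, s.number_vacuum (by simp), smul_zero, add_zero,
      ← mul_assoc A, number_chain_first lam hA' hB (by simp) hq]

theorem number_chain_first_dimer {p q : ℤ → Prop} {A B : QuasiLocal} (hA : SupportedIn p A)
    (hB : SupportedIn q B) {x : ℤ} (hp : ¬ p (x + 2)) (hq : ¬ q (x + 2)) (M : ℕ) :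
    (number (x + 2)).op ((A * chain lam x (M + 2) * B).op vacuum) =
      lam • (A * (raise (x + 1) * raise (x + 2)) * (chain lam (x + 6) M * B)).op vacuum := by
  have s : SupportedIn (fun z => z ≠ x + 2) (A * (raise x * (chain lam (x + 3) (M + 1) * B))) :=
    (hA.off hp).mul ((SupportedIn.raise (by omega)).mul
      (((chain_supportedIn lam _ _).mono fun z h => by
        omega).mul (hB.off hq)))
  have hA' : SupportedIn (fun z => z ≠ x + 2) (A * raise (x + 1)) :=
    (hA.off hp).mul (.raise (by omega))
  rw [chain_add_two_mul, op_add, add_apply, op_smul, smul_apply, map_add, map_smul,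
    s.number_vacuum (by simp), zero_add, ← mul_assoc A, hA'.number_raise (by simp)]
  simp only [mul_assoc]

/-- The number operator at the last site of a triple of a chain selects the tilings with a dimer
starting on this triple. -/
theorem number_chain_dimer {p q : ℤ → Prop} {A B : QuasiLocal} (hA : SupportedIn p A)
    (hB : SupportedIn q B) {x : ℤ} (L M : ℕ) (hp : ¬ p (x + 3 * L + 2))
    (hq : ¬ q (x + 3 * L + 2)) :
    (number (x + 3 * L + 2)).op ((A * chain lam x (L + (M + 2)) * B).op vacuum) =
      lam • (A * chain lam x L * (raise (x + 3 * L + 1) * raise (x + 3 * L + 2)) *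
        (chain lam (x + 3 * L + 6) M * B)).op vacuum := by
  rcases L with _ | L
  · simp only [Nat.cast_zero, mul_zero, add_zero, zero_add, chain_zero, mul_one] at hp hq ⊢
    exact number_chain_first_dimer lam hA hB hp hq M
  · have e : x + 3 * ((L + 1 : ℕ) : ℤ) = x + 3 * L + 3 := by push_cast; ring
    rw [e] at hp hq ⊢
    have hA' : SupportedIn (fun z => z ≠ x + 3 * L + 3 + 2) (A * chain lam x (L + 1)) :=
      (hA.off hp).mul ((chain_supportedIn lam _ _).mono fun z h => by
        push_cast at h; omega)
    have s : SupportedIn (fun z => z ≠ x + 3 * L + 3 + 2) (A * (chain lam x L *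
        (raise (x + 3 * L + 1) * raise (x + 3 * L + 2)) * chain lam (x + 3 * L + 6) (M + 1)) * B) :=
      ((hA.off hp).mul ((((chain_supportedIn lam _ _).mono fun z h => by
        omega).mul ((SupportedIn.raise (by omega)).mul (.raise (by omega)))).mul
        ((chain_supportedIn lam _ _).mono fun z h => by omega))).mul
        (hB.off hq)
    rw [show L + 1 + (M + 2) = L + 1 + (M + 1 + 1) by ring, chain_split, mul_add, add_mul, op_add,
      add_apply, map_add, mul_smul_comm, smul_mul_assoc,
      op_smul, smul_apply, map_smul, s.number_vacuum (by simp), smul_zero, add_zero,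
      ← mul_assoc A, show M + 1 + 1 = M + 2 by ring,
      number_chain_first_dimer lam hA' hB (by simp) hq]

/-- The expectation of a projection is a squared norm. `C` stands for the creation operator of the
selected tilings and `c` for the modulus of the amplitude contributed by selected dimers. -/
theorem voidExp_number {a b : ℕ} {N : QuasiLocal} (hN : star N * N = N) {C : QuasiLocal} {c w : ℝ}
    (hC : ‖N.op ((voidOp lam k a b).op vacuum)‖ ^ 2 = ‖c • C.op vacuum‖ ^ 2)
    (hw : vacExp (star C * C) = w) : voidExp lam k a b N =
      ((c ^ 2 * w / (chainWeight lam a * chainWeight lam b) : ℝ) : ℂ) := by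
  have h1 : star (voidOp lam k a b) * N * voidOp lam k a b =
      star (N * voidOp lam k a b) * (N * voidOp lam k a b) := by
    rw [star_mul, mul_assoc (star _) (star N), ← mul_assoc (star N), hN, mul_assoc]
  rw [vacExp_star_mul_self] at hw
  rw [voidExp, h1, vacExp_star_mul_self, op_mul_apply, hC, norm_smul, mul_pow,
    Real.norm_eq_abs, sq_abs, Complex.ofReal_injective hw, ← Complex.ofReal_div]

theorem star_number_mul_number (x : ℤ) : star (number x) * number x = number x := by
  rw [star_number, number_mul_self]

theorem star_number_number_mul (x y : ℤ) :
    star (number x * number y) * (number x * number y) = number x * number y := by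
  rw [star_mul, star_number, star_number]
  calc number y * number x * (number x * number y)
      = number y * (number x * number x) * number y := by noncomm_ring
    _ = number x * (number y * number y) := by
        rw [number_mul_self, (commute_number_number y x).eq, mul_assoc]
    _ = _ := by rw [number_mul_self]

theorem vacExp_star_mul_of_eq {p q : ℤ → Prop} {A B : QuasiLocal} {u v : ℝ}
    (hA : SupportedIn p A) (hB : SupportedIn q B) (h : ∀ x, p x → q x → False)
    (hu : vacExp (star A * A) = u) (hv : vacExp (star B * B) = v) :
    vacExp (star (A * B) * (A * B)) = ((u * v : ℝ) : ℂ) := by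
  rw [SupportedIn.vacExp_star_mul hA hA hB hB h, hu, hv, Complex.ofReal_mul]

theorem vacExp_star_raise_real (x : ℤ) :
    vacExp (star (raise x) * raise x) = ((1 : ℝ) : ℂ) := by
  rw [vacExp_star_raise_mul_raise, Complex.ofReal_one]

theorem vacExp_star_pair_real {x y : ℤ} (h : x ≠ y) :
    vacExp (star (raise x * raise y) * (raise x * raise y)) = ((1 : ℝ) : ℂ) := by
  rw [vacExp_star_pair h, Complex.ofReal_one]

theorem chain_supp_le (x : ℤ) (L : ℕ) {y : ℤ} (h : x + 3 * L ≤ y) :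
    SupportedIn (fun z => z < y) (chain lam x L) :=
  (chain_supportedIn lam x L).mono fun z hz => by omega

theorem chain_supp_ge (x : ℤ) (L : ℕ) {y : ℤ} (h : y ≤ x) :
    SupportedIn (fun z => y ≤ z) (chain lam x L) :=
  (chain_supportedIn lam x L).mono fun z hz => by omega

/-- The vector selected by a monomer in the left chain. -/
theorem number_voidOp_left (L d b : ℕ) :
    (number (3 * (k - 1 - d))).op ((voidOp lam k (L + (d + 1)) b).op vacuum) =
      (chain lam (3 * k - 3 * ((L + (d + 1) : ℕ) : ℤ)) L * (raise (3 * (k - 1 - d)) *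
        (chain lam (3 * k - 3 * d) d * chain lam (3 * k + 1) b))).op vacuum := by
  have h := number_chain_monomer lam (A := 1) (p := fun _ => False) .one
    (chain_supp_ge lam (3 * k + 1) b le_rfl) (x := 3 * k - 3 * ((L + (d + 1) : ℕ) : ℤ)) L d
    (by simp) (by push_cast; omega)
  have e : 3 * k - 3 * ((L + (d + 1) : ℕ) : ℤ) + 3 * L = 3 * (k - 1 - d) := by push_cast; ring
  have e' : 3 * (k - 1 - (d : ℤ)) + 3 = 3 * k - 3 * d := by ring
  rw [e, e', one_mul, one_mul] at h
  exact h

/-- The vector selected by a dimer in the right chain. -/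
theorem number_voidOp_right {p : ℤ → Prop} {A : QuasiLocal} (hA : SupportedIn p A) (e M : ℕ)
    (hp : ¬ p (3 * (k + 1 + e))) :
    (number (3 * (k + 1 + e))).op ((A * chain lam (3 * k + 1) (e + (M + 2))).op vacuum) =
      lam • (A * (chain lam (3 * k + 1) e * ((raise (3 * k + 3 * e + 2) *
        raise (3 * (k + 1 + e))) * chain lam (3 * k + 3 * e + 7) M))).op vacuum := by
  have h := number_chain_dimer lam hA (B := 1) (q := fun _ => False) .one (x := 3 * k + 1) e M
    (by rwa [show 3 * k + 1 + 3 * (e : ℤ) + 2 = 3 * (k + 1 + e) by ring]) (by simp)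
  rw [show 3 * k + 1 + 3 * (e : ℤ) + 2 = 3 * (k + 1 + e) by ring,
    show 3 * k + 1 + 3 * (e : ℤ) + 1 = 3 * k + 3 * e + 2 by ring,
    show 3 * k + 1 + 3 * (e : ℤ) + 6 = 3 * k + 3 * e + 7 by ring, mul_one, mul_one] at h
  rw [h]
  simp only [mul_assoc]

theorem norm_smul_eq_norm_smul (f : Config) : ‖lam • f‖ ^ 2 = ‖‖lam‖ • f‖ ^ 2 := by
  rw [norm_smul, norm_smul, norm_norm]

/-- A fixed monomer cuts the left chain into independent chains of L and d triples, so the density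
is w(L) w(d) / w(L + d + 1). -/
theorem voidExp_number_left (L d b : ℕ) :
    voidExp lam k (L + (d + 1)) b (number (3 * (k - 1 - d))) =
      ((chainWeight lam d * (chainWeight lam L / chainWeight lam (L + (d + 1))) : ℝ) : ℂ) := by
  have hw := vacExp_star_mul_of_eq
    (chain_supp_le lam (3 * k - 3 * ((L + (d + 1) : ℕ) : ℤ)) L (y := 3 * (k - 1 - d))
      (by push_cast; omega))
    ((SupportedIn.raise (p := fun z => 3 * (k - 1 - d) ≤ z) le_rfl).mul
      ((chain_supp_ge lam (3 * k - 3 * d) d (by omega)).mul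
        (chain_supp_ge lam (3 * k + 1) b (by omega)))) (fun z h1 h2 => by omega)
    (vacExp_star_chain_mul_chain lam _ L)
    (vacExp_star_mul_of_eq (SupportedIn.raise (p := fun z => z = 3 * (k - 1 - d)) rfl)
      ((chain_supp_ge lam (3 * k - 3 * d) d (y := 3 * k - 3 * d) le_rfl).mul
        (chain_supp_ge lam (3 * k + 1) b (by omega))) (fun z h1 h2 => by omega)
      (vacExp_star_raise_real _)
      (vacExp_star_mul_of_eq (chain_supp_le lam (3 * k - 3 * d) d (y := 3 * k + 1) (by omega))
        (chain_supp_ge lam (3 * k + 1) b le_rfl) (fun z h1 h2 => by omega)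
        (vacExp_star_chain_mul_chain lam _ d) (vacExp_star_chain_mul_chain lam _ b)))
  rw [voidExp_number lam k (c := 1) (star_number_mul_number _)
    (by rw [number_voidOp_left, one_smul]) hw]
  congr 1
  have := (chainWeight_pos lam b).ne'
  have := (chainWeight_pos lam (L + (d + 1))).ne'
  field_simp

theorem vacExp_right (e M : ℕ) : vacExp (star (chain lam (3 * k + 1) e *
    ((raise (3 * k + 3 * e + 2) * raise (3 * (k + 1 + e))) * chain lam (3 * k + 3 * e + 7) M)) *
    (chain lam (3 * k + 1) e *
    ((raise (3 * k + 3 * e + 2) * raise (3 * (k + 1 + e))) * chain lam (3 * k + 3 * e + 7) M))) =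
      ((chainWeight lam e * (1 * chainWeight lam M) : ℝ) : ℂ) := by
  have hr : SupportedIn (fun z => 3 * k + 3 * e + 1 ≤ z ∧ z < 3 * k + 3 * e + 7)
      (raise (3 * k + 3 * e + 2) * raise (3 * (k + 1 + e))) :=
    (SupportedIn.raise (by omega)).mul (.raise (by omega))
  exact vacExp_star_mul_of_eq
    (chain_supp_le lam (3 * k + 1) e (y := 3 * k + 3 * e + 1) (by omega))
    ((hr.mono fun z h => h.1).mul
      (chain_supp_ge lam _ M (by omega))) (fun z h1 h2 => by omega)
    (vacExp_star_chain_mul_chain lam _ e)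
    (vacExp_star_mul_of_eq hr
      (chain_supp_ge lam _ M (y := 3 * k + 3 * e + 7) le_rfl) (fun z h1 h2 => by omega)
      (vacExp_star_pair_real (by omega)) (vacExp_star_chain_mul_chain lam _ M))

theorem right_supp (e M : ℕ) : SupportedIn (fun z => 3 * k + 1 ≤ z) (chain lam (3 * k + 1) e *
    ((raise (3 * k + 3 * e + 2) * raise (3 * (k + 1 + e))) * chain lam (3 * k + 3 * e + 7) M)) :=
  (chain_supp_ge lam _ e le_rfl).mul
    (((SupportedIn.raise (by omega)).mul (.raise (by omega))).mul
      (chain_supp_ge lam _ M (by omega)))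

/-- Right of the void, sites divisible by 3 end a triple and are occupied only by a dimer starting
on that triple. It uses two triples and contributes |λ|². -/
theorem voidExp_number_right (a e M : ℕ) :
    voidExp lam k a (e + (M + 2)) (number (3 * (k + 1 + e))) =
      ((‖lam‖ ^ 2 * (chainWeight lam e * (chainWeight lam M / chainWeight lam (e + (M + 2)))) :
        ℝ) : ℂ) := by
  have hA := chain_supp_le lam (3 * k - 3 * a) a (y := 3 * k + 1) (by omega)
  have hw := vacExp_star_mul_of_eq hA (right_supp lam k e M) (fun z h1 h2 => by omega)
    (vacExp_star_chain_mul_chain lam _ a) (vacExp_right lam k e M)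
  rw [voidExp_number lam k (c := ‖lam‖) (star_number_mul_number _)
    (by rw [voidOp, number_voidOp_right lam k hA e M (by omega), norm_smul_eq_norm_smul]) hw]
  congr 1
  have := (chainWeight_pos lam a).ne'
  have := (chainWeight_pos lam (e + (M + 2))).ne'
  field_simp

theorem voidOp_number_self (a b : ℕ) :
    (number (3 * k)).op ((voidOp lam k a b).op vacuum) = 0 := by
  refine SupportedIn.number_vacuum (p := fun z => z ≠ 3 * k) ?_ (by simp)
  exact ((chain_supportedIn lam _ _).mono fun z h => by omega).mul
    ((chain_supportedIn lam _ _).mono fun z h => by omega)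

/-- Both densities in the left chain. -/
theorem voidExp_number_left_left (L d₁ d b : ℕ) :
    voidExp lam k (L + (d₁ + 1) + (d + 1)) b
      (number (3 * (k - 1 - d - 1 - d₁)) * number (3 * (k - 1 - d))) =
      ((chainWeight lam d₁ * chainWeight lam d *
        (chainWeight lam L / chainWeight lam (L + (d₁ + 1) + (d + 1))) : ℝ) : ℂ) := by
  set x : ℤ := 3 * k - 3 * ((L + (d₁ + 1) + (d + 1) : ℕ) : ℤ) with hx
  have hxL : x + 3 * L = 3 * (k - 1 - d - 1 - d₁) := by rw [hx]; push_cast; ring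
  have hB : SupportedIn (fun z => 3 * (k - 1 - d) ≤ z) (raise (3 * (k - 1 - d)) *
        (chain lam (3 * k - 3 * d) d * chain lam (3 * k + 1) b)) :=
    (SupportedIn.raise le_rfl).mul ((chain_supp_ge lam (3 * k - 3 * d) d (by omega)).mul
        (chain_supp_ge lam (3 * k + 1) b (by omega)))
  have h := number_chain_monomer lam (A := 1) (p := fun _ => False) .one hB (x := x) L d₁
    (by simp) (by omega)
  rw [hxL, one_mul, one_mul] at h
  have hB' := vacExp_star_mul_of_eq (SupportedIn.raise (p := fun z => z = 3 * (k - 1 - d)) rfl)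
      ((chain_supp_ge lam (3 * k - 3 * d) d (y := 3 * k - 3 * d) le_rfl).mul
        (chain_supp_ge lam (3 * k + 1) b (by omega))) (fun z h1 h2 => by omega)
      (vacExp_star_raise_real _)
      (vacExp_star_mul_of_eq (chain_supp_le lam (3 * k - 3 * d) d (y := 3 * k + 1) (by omega))
        (chain_supp_ge lam (3 * k + 1) b le_rfl) (fun z h1 h2 => by omega)
        (vacExp_star_chain_mul_chain lam _ d) (vacExp_star_chain_mul_chain lam _ b))
  have hw := vacExp_star_mul_of_eq
    (chain_supp_le lam x L (y := 3 * (k - 1 - d - 1 - d₁)) (by omega))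
    ((SupportedIn.raise (x := 3 * (k - 1 - d - 1 - d₁))
        (p := fun z => 3 * (k - 1 - d - 1 - d₁) ≤ z) le_rfl).mul
      ((chain_supp_ge lam (3 * (k - 1 - d - 1 - d₁) + 3) d₁ (by omega)).mul
        (hB.mono fun z h => by omega))) (fun z h1 h2 => by omega)
    (vacExp_star_chain_mul_chain lam _ L)
    (vacExp_star_mul_of_eq (SupportedIn.raise (p := fun z => z = 3 * (k - 1 - d - 1 - d₁)) rfl)
      ((chain_supp_ge lam (3 * (k - 1 - d - 1 - d₁) + 3) d₁ le_rfl).mul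
        (hB.mono fun z h => by omega)) (fun z h1 h2 => by omega)
      (vacExp_star_raise_real _)
      (vacExp_star_mul_of_eq (chain_supp_le lam (3 * (k - 1 - d - 1 - d₁) + 3) d₁
        (y := 3 * (k - 1 - d)) (by omega)) hB (fun z h1 h2 => by omega)
        (vacExp_star_chain_mul_chain lam _ d₁) hB'))
  rw [voidExp_number lam k (c := 1) (star_number_number_mul _ _) (by rw [op_mul_apply, number_voidOp_left, h, one_smul]) hw]
  congr 1
  have := (chainWeight_pos lam b).ne'
  have := (chainWeight_pos lam (L + (d₁ + 1) + (d + 1))).ne'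
  field_simp

/-- Densities in different chains. -/
theorem voidExp_number_left_right (L d e M : ℕ) :
    voidExp lam k (L + (d + 1)) (e + (M + 2))
      (number (3 * (k - 1 - d)) * number (3 * (k + 1 + e))) =
    voidExp lam k (L + (d + 1)) (e + (M + 2)) (number (3 * (k - 1 - d))) *
    voidExp lam k (L + (d + 1)) (e + (M + 2)) (number (3 * (k + 1 + e))) := by
  set x : ℤ := 3 * k - 3 * ((L + (d + 1) : ℕ) : ℤ) with hx
  have hA : SupportedIn (fun z => z < 3 * k + 1) (chain lam x L * (raise (3 * (k - 1 - d)) *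
      chain lam (3 * k - 3 * d) d)) :=
    (chain_supp_le lam x L (by push_cast at hx; omega)).mul ((SupportedIn.raise (by omega)).mul
      (chain_supp_le lam _ d (by omega)))
  have hw := vacExp_star_mul_of_eq hA (right_supp lam k e M) (fun z h1 h2 => by omega)
    (vacExp_star_mul_of_eq (chain_supp_le lam x L (y := 3 * (k - 1 - d))
        (by push_cast at hx; omega))
      ((SupportedIn.raise (p := fun z => 3 * (k - 1 - d) ≤ z) le_rfl).mul
        (chain_supp_ge lam (3 * k - 3 * d) d (by omega))) (fun z h1 h2 => by omega)
      (vacExp_star_chain_mul_chain lam _ L)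
      (vacExp_star_mul_of_eq (SupportedIn.raise (p := fun z => z = 3 * (k - 1 - d)) rfl)
        (chain_supp_ge lam (3 * k - 3 * d) d (y := 3 * k - 3 * d) le_rfl)
        (fun z h1 h2 => by omega) (vacExp_star_raise_real _)
        (vacExp_star_chain_mul_chain lam _ d))) (vacExp_right lam k e M)
  rw [voidExp_number lam k (c := ‖lam‖) (star_number_number_mul _ _)
    (by
      rw [(commute_number_number _ _).eq, op_mul_apply, number_voidOp_left, ← mul_assoc (raise _),
        ← mul_assoc, number_voidOp_right lam k hA e M (by omega), norm_smul_eq_norm_smul]) hw,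
    voidExp_number_left, voidExp_number_right,
    ← Complex.ofReal_mul]
  congr 1
  have := (chainWeight_pos lam (L + (d + 1))).ne'
  have := (chainWeight_pos lam (e + (M + 2))).ne'
  field_simp

/-- Both densities in the right chain. -/
theorem voidExp_number_right_right (a e e₁ M : ℕ) :
    voidExp lam k a (e + (e₁ + (M + 2) + 2))
      (number (3 * (k + 1 + e)) * number (3 * (k + 3 + e + e₁))) =
      ((‖lam‖ ^ 4 * (chainWeight lam e * chainWeight lam e₁ *
        (chainWeight lam M / chainWeight lam (e + (e₁ + (M + 2) + 2)))) : ℝ) : ℂ) := by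
  have hA := chain_supp_le lam (3 * k - 3 * a) a (y := 3 * k + 1) (by omega)
  have h1 := number_voidOp_right lam k hA e (e₁ + (M + 2)) (by omega)
  have hr : SupportedIn (fun z => 3 * k + 3 * e + 1 ≤ z ∧ z < 3 * k + 3 * e + 7)
      (raise (3 * k + 3 * e + 2) * raise (3 * (k + 1 + e))) :=
    (SupportedIn.raise (by omega)).mul (.raise (by omega))
  set A' := chain lam (3 * k - 3 * a) a * (chain lam (3 * k + 1) e *
    (raise (3 * k + 3 * e + 2) * raise (3 * (k + 1 + e)))) with hA'
  have hsA' : SupportedIn (fun z => z < 3 * (k + e + 2) + 1) A' :=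
    (hA.mono fun z h => by omega).mul ((chain_supp_le lam _ e (by omega)).mul
      (hr.mono fun z h => by omega))
  -- After the first dimer the chain continues at 3(k + e + 2) + 1, as if a void were at 3(k + e +
  -- 2). The single-dimer selection applies again, with everything to the left as prefix.
  have h2 := number_voidOp_right lam (k + e + 2) hsA' e₁ M (by omega)
  have hw := vacExp_star_mul_of_eq hsA' (right_supp lam (k + e + 2) e₁ M)
    (fun z h1 h2 => by omega)
    (vacExp_star_mul_of_eq hA ((chain_supp_ge lam (3 * k + 1) e le_rfl).mul
      (hr.mono fun z h => by omega)) (fun z h1 h2 => by omega)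
      (vacExp_star_chain_mul_chain lam _ a)
      (vacExp_star_mul_of_eq (chain_supp_le lam (3 * k + 1) e (y := 3 * k + 3 * e + 1) (by omega))
        hr (fun z h1 h2 => by omega) (vacExp_star_chain_mul_chain lam _ e)
        (vacExp_star_pair_real (by omega)))) (vacExp_right lam (k + e + 2) e₁ M)
  rw [voidExp_number lam k (c := ‖lam * lam‖) (star_number_number_mul _ _)
    (by
      rw [(commute_number_number _ _).eq, op_mul_apply, voidOp, h1, map_smul,
        ← mul_assoc (chain lam (3 * k + 1) e), ← mul_assoc (chain lam (3 * k - 3 * a) a), ← hA',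
        show 3 * k + 3 * (e : ℤ) + 7 = 3 * (k + e + 2) + 1 by ring,
        show 3 * (k + 3 + e + (e₁ : ℤ)) = 3 * (k + e + 2 + 1 + e₁) by ring, h2, smul_smul,
        norm_smul_eq_norm_smul]) hw]
  congr 1
  have := (chainWeight_pos lam a).ne'
  have := (chainWeight_pos lam (e + (e₁ + (M + 2) + 2))).ne'
  rw [norm_mul]
  field_simp

end SpinChain

end


noncomputable section

/-! ### Infinite-volume one- and two-point densities -/

namespace SpinChain

variable (lam : ℂ) (k : ℤ)

theorem voidState_eq_of_tendsto {A : QuasiLocal} {u : ℕ × ℕ → ℝ} {l : ℝ}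
    (h : ∀ᶠ p : ℕ × ℕ in atTop ×ˢ atTop, voidExp lam k p.1 p.2 A = (u p : ℂ))
    (hu : Tendsto u (atTop ×ˢ atTop) (𝓝 l)) : voidState lam k A = (l : ℂ) :=
  tendsto_nhds_unique (tendsto_voidState lam k A)
    (((Complex.continuous_ofReal.tendsto _).comp hu).congr' (h.mono fun _ hp => hp.symm))

theorem eventually_fst_snd (m n : ℕ) :
    ∀ᶠ p : ℕ × ℕ in atTop ×ˢ atTop, m ≤ p.1 ∧ n ≤ p.2 :=
  (eventually_ge_atTop m).prod_mk (eventually_ge_atTop n)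

/-- The weight of the finite piece between a selected domino and the void, or between two selected
dominoes, combines with the limit ratio of the long chains to a factor of the densities. -/
theorem chainWeight_mul_inv_pow (d : ℕ) : chainWeight lam d * (muPlus lam)⁻¹ ^ (d + 1) =
    (1 - muRatio lam ^ (d + 1)) / muDiff lam := by
  rw [chainWeight_eq, inv_pow]
  have := pow_ne_zero (d + 1) (muPlus_pos lam).ne'
  field_simp

theorem voidState_number_left (d : ℕ) : voidState lam k (number (3 * (k - 1 - d))) =
    (((1 - muRatio lam ^ (d + 1)) / muDiff lam : ℝ) : ℂ) := by
  refine voidState_eq_of_tendsto lam k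
    (u := fun p => chainWeight lam d * (chainWeight lam (p.1 - (d + 1)) / chainWeight lam p.1)) ?_ ?_
  · filter_upwards [eventually_fst_snd (d + 1) 0] with p hp
    obtain ⟨L, hL⟩ := Nat.exists_eq_add_of_le' hp.1
    rw [hL, voidExp_number_left, Nat.add_sub_cancel]
  · rw [← chainWeight_mul_inv_pow]
    exact ((tendsto_chainWeight_div lam (d + 1)).comp tendsto_fst).const_mul _

theorem voidState_number_self : voidState lam k (number (3 * k)) = 0 := by
  rw [← star_number_mul_number]
  exact voidState_star_mul_self_eq_zero lam k
    (Eventually.of_forall fun p => voidOp_number_self lam k p.1 p.2)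

theorem voidState_number_right (e : ℕ) : voidState lam k (number (3 * (k + 1 + e))) =
    ((‖lam‖ ^ 2 / muPlus lam * ((1 - muRatio lam ^ (e + 1)) / muDiff lam) : ℝ) : ℂ) := by
  refine voidState_eq_of_tendsto lam k
    (u := fun p => ‖lam‖ ^ 2 * (chainWeight lam e *
      (chainWeight lam (p.2 - (e + 2)) / chainWeight lam p.2))) ?_ ?_
  · filter_upwards [eventually_fst_snd 0 (e + 2)] with p hp
    obtain ⟨L, hL⟩ := Nat.exists_eq_add_of_le' hp.2
    rw [hL, show L + (e + 2) = e + (L + 2) by ring, voidExp_number_right,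
      show e + (L + 2) - (e + 2) = L by omega]
  · have e : ‖lam‖ ^ 2 / muPlus lam * ((1 - muRatio lam ^ (e + 1)) / muDiff lam) =
        ‖lam‖ ^ 2 * (chainWeight lam e * (muPlus lam)⁻¹ ^ (e + 2)) := by
      rw [← chainWeight_mul_inv_pow, pow_succ _ (e + 1)]; ring
    rw [e]
    exact (((tendsto_chainWeight_div lam _).comp tendsto_snd).const_mul _).const_mul _

theorem voidState_number_left_left (d₁ d : ℕ) :
    voidState lam k (number (3 * (k - 1 - d - 1 - d₁)) * number (3 * (k - 1 - d))) =
      (((1 - muRatio lam ^ (d₁ + 1)) / muDiff lam * ((1 - muRatio lam ^ (d + 1)) / muDiff lam) :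
        ℝ) : ℂ) := by
  refine voidState_eq_of_tendsto lam k
    (u := fun p => chainWeight lam d₁ * chainWeight lam d *
      (chainWeight lam (p.1 - (d₁ + 1 + (d + 1))) / chainWeight lam p.1)) ?_ ?_
  · filter_upwards [eventually_fst_snd (d₁ + 1 + (d + 1)) 0] with p hp
    obtain ⟨L, hL⟩ := Nat.exists_eq_add_of_le' hp.1
    rw [hL, Nat.add_sub_cancel, ← add_assoc, voidExp_number_left_left]
  · have e : (1 - muRatio lam ^ (d₁ + 1)) / muDiff lam * ((1 - muRatio lam ^ (d + 1)) / muDiff lam)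
        = chainWeight lam d₁ * chainWeight lam d * (muPlus lam)⁻¹ ^ (d₁ + 1 + (d + 1)) := by
      rw [← chainWeight_mul_inv_pow, ← chainWeight_mul_inv_pow, pow_add _ (d₁ + 1)]; ring
    rw [e]
    exact ((tendsto_chainWeight_div lam _).comp tendsto_fst).const_mul _

theorem voidState_number_left_right (d e : ℕ) :
    voidState lam k (number (3 * (k - 1 - d)) * number (3 * (k + 1 + e))) =
      voidState lam k (number (3 * (k - 1 - d))) * voidState lam k (number (3 * (k + 1 + e))) := by
  refine tendsto_nhds_unique (tendsto_voidState lam k _)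
    (((tendsto_voidState lam k _).mul (tendsto_voidState lam k _)).congr' ?_)
  filter_upwards [eventually_fst_snd (d + 1) (e + 2)] with p hp
  obtain ⟨L, hL⟩ := Nat.exists_eq_add_of_le' hp.1
  obtain ⟨M, hM⟩ := Nat.exists_eq_add_of_le' hp.2
  rw [hL, hM, show M + (e + 2) = e + (M + 2) by ring, voidExp_number_left_right]

theorem voidState_number_right_right (e e₁ : ℕ) :
    voidState lam k (number (3 * (k + 1 + e)) * number (3 * (k + 3 + e + e₁))) =
      ((‖lam‖ ^ 4 / muPlus lam ^ 2 * ((1 - muRatio lam ^ (e₁ + 1)) / muDiff lam *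
        ((1 - muRatio lam ^ (e + 1)) / muDiff lam)) : ℝ) : ℂ) := by
  refine voidState_eq_of_tendsto lam k
    (u := fun p => ‖lam‖ ^ 4 * (chainWeight lam e * chainWeight lam e₁ *
      (chainWeight lam (p.2 - (e₁ + e + 4)) / chainWeight lam p.2))) ?_ ?_
  · filter_upwards [eventually_fst_snd 0 (e₁ + e + 4)] with p hp
    obtain ⟨M, hM⟩ := Nat.exists_eq_add_of_le' hp.2
    rw [hM, Nat.add_sub_cancel, show M + (e₁ + e + 4) = e + (e₁ + (M + 2) + 2) by ring,
      voidExp_number_right_right]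
  · have e : ‖lam‖ ^ 4 / muPlus lam ^ 2 * ((1 - muRatio lam ^ (e₁ + 1)) / muDiff lam *
        ((1 - muRatio lam ^ (e + 1)) / muDiff lam)) = ‖lam‖ ^ 4 * (chainWeight lam e *
          chainWeight lam e₁ * (muPlus lam)⁻¹ ^ (e₁ + e + 4)) := by
      rw [← chainWeight_mul_inv_pow, ← chainWeight_mul_inv_pow,
        show e₁ + e + 4 = (e₁ + 1) + (e + 1) + 2 by ring, pow_add, pow_add,
        div_eq_mul_inv, ← inv_pow _ 2]
      ring
    rw [e]
    exact (((tendsto_chainWeight_div lam _).comp tendsto_snd).const_mul _).const_mul _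

theorem voidState_mul_number_self (A : QuasiLocal) :
    voidState lam k (A * number (3 * k)) = 0 := by
  refine tendsto_nhds_unique (tendsto_voidState lam k _) (tendsto_const_nhds.congr fun p => ?_)
  rw [voidExp, vacExp_star_mul_mul_eq, op_mul_apply, voidOp_number_self]
  simp

theorem zpow_abs_of_eq {x y : ℤ} (r : ℝ) {n : ℕ} (h : |x - y| = n) : r ^ |x - y| = r ^ n := by
  rw [h, zpow_natCast]

/-- The density. -/
def density (k j : ℤ) : ℝ := (1 - muRatio lam ^ |j - k|) / muDiff lam *
  (if j < k then 1 else if j = k then 0 else ‖lam‖ ^ 2 / muPlus lam)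

theorem voidState_number (j : ℤ) : voidState lam k (number (3 * j)) = (density lam k j : ℂ) := by
  rw [density]
  rcases lt_trichotomy j k with h | rfl | h
  · obtain ⟨d, hd⟩ : ∃ d : ℕ, j = k - 1 - d := ⟨(k - 1 - j).toNat, by omega⟩
    have e : |j - k| = ((d + 1 : ℕ) : ℤ) := by rw [abs_of_neg (by omega)]; push_cast; omega
    rw [zpow_abs_of_eq _ e, if_pos h, mul_one, hd, voidState_number_left]
  · simp [voidState_number_self]
  · obtain ⟨d, hd⟩ : ∃ d : ℕ, j = k + 1 + d := ⟨(j - k - 1).toNat, by omega⟩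
    have e : |j - k| = ((d + 1 : ℕ) : ℤ) := by rw [abs_of_pos (by omega)]; push_cast; omega
    rw [zpow_abs_of_eq _ e, if_neg (by omega), if_neg (by omega), hd, voidState_number_right,
      mul_comm]

theorem voidState_number_mul_number_of_lt {j : ℤ} (hj : 1 < j) (h : j < k) :
    voidState lam k (number 0 * number (3 * j)) =
      ((1 / muDiff lam ^ 2 * (1 - muRatio lam ^ j) * (1 - muRatio lam ^ (k - j)) : ℝ) : ℂ) := by
  obtain ⟨d, hd⟩ : ∃ d : ℕ, j = k - 1 - d := ⟨(k - 1 - j).toNat, by omega⟩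
  obtain ⟨d₁, hd₁⟩ : ∃ d₁ : ℕ, j = 1 + d₁ := ⟨(j - 1).toNat, by omega⟩
  have := voidState_number_left_left lam k d₁ d
  rw [← hd, show 3 * (j - 1 - (d₁ : ℤ)) = 0 by omega] at this
  rw [this, show k - j = ((d + 1 : ℕ) : ℤ) by push_cast; omega, zpow_natCast,
    show j = ((d₁ + 1 : ℕ) : ℤ) by push_cast; omega, zpow_natCast]
  congr 1
  have := (muDiff_pos lam).ne'
  field_simp

/-- With the void strictly between the sites they probe independent chains. If the void is at one of
the sites, this site is empty and both sides vanish. -/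
theorem voidState_number_mul_number_of_mem {j : ℤ} (hk : 0 ≤ k) (h : k ≤ j) :
    voidState lam k (number 0 * number (3 * j)) =
      voidState lam k (number 0) * voidState lam k (number (3 * j)) := by
  rcases hk.eq_or_lt with rfl | hk
  · have h1 := voidState_mul_number_self lam 0 (number (3 * j))
    have h2 := voidState_number_self lam 0
    rw [mul_zero] at h1 h2
    rw [(commute_number_number _ _).eq, h1, h2, zero_mul]
  rcases h.eq_or_lt with rfl | h
  · rw [voidState_mul_number_self, voidState_number_self, mul_zero]
  · obtain ⟨d, hd⟩ : ∃ d : ℕ, k = 1 + d := ⟨(k - 1).toNat, by omega⟩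
    obtain ⟨e, he⟩ : ∃ e : ℕ, j = k + 1 + e := ⟨(j - k - 1).toNat, by omega⟩
    have := voidState_number_left_right lam k d e
    rwa [show 3 * (k - 1 - (d : ℤ)) = 0 by omega, ← he] at this

theorem voidState_number_mul_number_of_neg {j : ℤ} (hj : 1 < j) (h : k < 0) :
    voidState lam k (number 0 * number (3 * j)) =
      ((‖lam‖ ^ 4 / (muPlus lam ^ 2 * muDiff lam ^ 2) *
        (1 - muRatio lam ^ (j - 1)) * (1 - muRatio lam ^ (-k)) : ℝ) : ℂ) := by
  obtain ⟨e, he⟩ : ∃ e : ℕ, k = -1 - e := ⟨(-1 - k).toNat, by omega⟩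
  obtain ⟨e₁, he₁⟩ : ∃ e₁ : ℕ, j = 2 + e₁ := ⟨(j - 2).toNat, by omega⟩
  have := voidState_number_right_right lam k e e₁
  rw [show 3 * (k + 1 + (e : ℤ)) = 0 by omega, show k + 3 + (e : ℤ) + e₁ = j by omega] at this
  rw [this, show -k = ((e + 1 : ℕ) : ℤ) by push_cast; omega, zpow_natCast,
    show j - 1 = ((e₁ + 1 : ℕ) : ℤ) by push_cast; omega, zpow_natCast]
  congr 1
  have := (muDiff_pos lam).ne'
  have := (muPlus_pos lam).ne'
  field_simp

theorem abs_muRatio_pow_le_one (n : ℕ) : |muRatio lam ^ n| ≤ 1 := by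
  rw [abs_pow]; exact pow_le_one₀ (abs_nonneg _) (abs_muRatio_lt_one lam).le

theorem abs_muRatio_zpow_le {m n : ℤ} (hm : 0 ≤ m) (h : m ≤ n) :
    |muRatio lam ^ n| ≤ |muRatio lam| ^ m := by
  lift m to ℕ using hm
  lift n to ℕ using (by omega)
  rw [abs_zpow, zpow_natCast, zpow_natCast]
  exact pow_le_pow_of_le_one (abs_nonneg _) (abs_muRatio_lt_one lam).le (by omega)

theorem abs_one_sub_muRatio_zpow_le {n : ℤ} (h : 0 ≤ n) : |1 - muRatio lam ^ n| ≤ 2 := by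
  have h1 := abs_muRatio_zpow_le lam le_rfl h
  rw [zpow_zero] at h1
  have := abs_sub (1 : ℝ) (muRatio lam ^ n)
  rw [abs_one] at this
  linarith

theorem abs_muRatio_mul : |muRatio lam| * muPlus lam ^ 2 = ‖lam‖ ^ 2 := by
  rw [abs_of_nonpos (muRatio_nonpos lam)]; linarith [muRatio_mul_muPlus_sq lam]

theorem abs_muRatio_le : |muRatio lam| ≤ ‖lam‖ ^ 2 := by
  rw [← abs_muRatio_mul]
  exact le_mul_of_one_le_right (abs_nonneg _) (one_le_pow₀ (one_le_muPlus lam))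

theorem sq_div_muPlus_le : ‖lam‖ ^ 2 / muPlus lam ≤ ‖lam‖ ^ 2 :=
  div_le_self (sq_nonneg _) (one_le_muPlus lam)

/-- The density correlations in the single-void states decay exponentially. -/
theorem norm_voidState_corr_le {j : ℤ} (hj : 1 < j) :
    ‖voidState lam k (number 0 * number (3 * j)) -
      voidState lam k (number 0) * voidState lam k (number (3 * j))‖ ≤
        4 * max 1 (‖lam‖ ^ 2) / muDiff lam ^ 2 * |muRatio lam| ^ j := by
  have hD := muDiff_pos lam
  have hP := muPlus_pos lam
  have h0 := voidState_number lam k 0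
  rw [mul_zero] at h0
  have hRj : 0 ≤ |muRatio lam| ^ j := zpow_nonneg (abs_nonneg _) _
  rcases lt_or_ge k 0 with hk | hk
  · rw [voidState_number_mul_number_of_neg lam k hj hk, h0, voidState_number, ← Complex.ofReal_mul,
      ← Complex.ofReal_sub, Complex.norm_real, Real.norm_eq_abs, density, density, zero_sub,
      abs_of_pos (show 0 < -k by omega), abs_of_pos (show 0 < j - k by omega), if_neg (by omega),
      if_neg (by omega), if_neg (by omega), if_neg (by omega)]
    have e : ‖lam‖ ^ 4 / (muPlus lam ^ 2 * muDiff lam ^ 2) * (1 - muRatio lam ^ (j - 1)) *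
        (1 - muRatio lam ^ (-k)) - (1 - muRatio lam ^ (-k)) / muDiff lam *
        (‖lam‖ ^ 2 / muPlus lam) * ((1 - muRatio lam ^ (j - k)) / muDiff lam *
        (‖lam‖ ^ 2 / muPlus lam)) = ‖lam‖ ^ 2 / muDiff lam ^ 2 * (1 - muRatio lam ^ (-k)) *
        (‖lam‖ ^ 2 / muPlus lam ^ 2 * (muRatio lam ^ (j - k) - muRatio lam ^ (j - 1))) := by
      field_simp; ring
    -- On the right, the difference of the powers of μ only gives |μ|^(j-1). The missing factor |μ|
    -- is hidden in the prefactor |λ|²/μ₊².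
    have hR : ‖lam‖ ^ 2 / muPlus lam ^ 2 = |muRatio lam| := by
      rw [← abs_muRatio_mul]; field_simp
    have h1 : |muRatio lam ^ (j - k) - muRatio lam ^ (j - 1)| ≤ 2 * |muRatio lam| ^ (j - 1) := by
      have h1 := abs_muRatio_zpow_le lam (show 0 ≤ j - 1 by omega) (show j - 1 ≤ j - k by omega)
      have h2 := abs_muRatio_zpow_le lam (show 0 ≤ j - 1 by omega) le_rfl
      have := abs_sub (muRatio lam ^ (j - k)) (muRatio lam ^ (j - 1))
      linarith
    have h2 : |muRatio lam| * |muRatio lam| ^ (j - 1) = |muRatio lam| ^ j := by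
      obtain ⟨n, hn⟩ : ∃ n : ℕ, j = n + 1 := ⟨(j - 1).toNat, by omega⟩
      have e1 : j - 1 = n := by omega
      have e2 : j = ((n + 1 : ℕ) : ℤ) := by omega
      rw [e1, e2, zpow_natCast, zpow_natCast, pow_succ']
    rw [e, hR, abs_mul, abs_mul, abs_mul, abs_abs, abs_of_nonneg (by positivity)]
    calc ‖lam‖ ^ 2 / muDiff lam ^ 2 * |1 - muRatio lam ^ (-k)| *
          (|muRatio lam| * |muRatio lam ^ (j - k) - muRatio lam ^ (j - 1)|)
        ≤ max 1 (‖lam‖ ^ 2) / muDiff lam ^ 2 * 2 *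
          (|muRatio lam| * (2 * |muRatio lam| ^ (j - 1))) := by
          gcongr
          · exact le_max_right _ _
          · exact abs_one_sub_muRatio_zpow_le lam (by omega)
      _ = 4 * max 1 (‖lam‖ ^ 2) / muDiff lam ^ 2 *
          (|muRatio lam| * |muRatio lam| ^ (j - 1)) := by ring
      _ = _ := by rw [h2]
  rcases le_or_gt k j with hkj | hkj
  · rw [voidState_number_mul_number_of_mem lam k hk hkj, sub_self, norm_zero]
    positivity
  · rw [voidState_number_mul_number_of_lt lam k hj hkj, h0, voidState_number, ← Complex.ofReal_mul,
      ← Complex.ofReal_sub, Complex.norm_real, Real.norm_eq_abs, density, density, zero_sub,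
      abs_neg, abs_of_pos (show 0 < k by omega), abs_of_neg (show j - k < 0 by omega),
      if_pos (by omega), if_pos (by omega), neg_sub]
    have e : 1 / muDiff lam ^ 2 * (1 - muRatio lam ^ j) * (1 - muRatio lam ^ (k - j)) -
        (1 - muRatio lam ^ k) / muDiff lam * 1 * ((1 - muRatio lam ^ (k - j)) / muDiff lam * 1) =
        1 / muDiff lam ^ 2 * (1 - muRatio lam ^ (k - j)) * (muRatio lam ^ k - muRatio lam ^ j) := by
      field_simp; ring
    have h1 : |muRatio lam ^ k - muRatio lam ^ j| ≤ 2 * |muRatio lam| ^ j := by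
      have h1 := abs_muRatio_zpow_le lam (show 0 ≤ j by omega) hkj.le
      have h2 := abs_muRatio_zpow_le lam (show 0 ≤ j by omega) le_rfl
      have := abs_sub (muRatio lam ^ k) (muRatio lam ^ j)
      linarith
    rw [e, abs_mul, abs_mul, abs_of_nonneg (by positivity)]
    calc 1 / muDiff lam ^ 2 * |1 - muRatio lam ^ (k - j)| * |muRatio lam ^ k - muRatio lam ^ j|
        ≤ max 1 (‖lam‖ ^ 2) / muDiff lam ^ 2 * 2 * (2 * |muRatio lam| ^ j) := by
          gcongr
          · exact le_max_left _ _
          · exact abs_one_sub_muRatio_zpow_le lam (by omega)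
      _ = _ := by ring

/-- In the case `λ = 0` the VMD vectors are product vectors. -/
theorem vmdVector_zero (R : List Domino) (x : ℤ) :
    vmdVector 0 x R = 0 ∨ ∃ S, vmdVector 0 x R = ket S := by
  have hr : ∀ (y : ℤ) (f : Config), (f = 0 ∨ ∃ S, f = ket S) →
      ((raise y).op f = 0 ∨ ∃ S, (raise y).op f = ket S) := by
    rintro y f (rfl | ⟨S, rfl⟩)
    · exact Or.inl (map_zero _)
    · rw [raise_ket]
      split_ifs
      · exact Or.inl rfl
      · exact Or.inr ⟨_, rfl⟩
  induction R using tilings.induct generalizing x with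
  | case1 => exact Or.inr ⟨∅, by rw [vmdVector_nil]; rfl⟩
  | case2 R ih1 _ => rw [vmdVector_monomer_monomer, zero_smul, add_zero]; exact hr _ _ (ih1 _)
  | case3 R => exact Or.inl (vmdVector_dimer _ _ _)
  | case4 E R h1 h2 ih =>
    rcases E with _ | _ | _
    · rw [vmdVector_void]; exact ih _
    · rw [vmdVector_monomer _ _ _ (fun R' hR' => h1 R' rfl hR')]; exact hr _ _ (ih _)
    · exact (h2 rfl).elim

/-- Without dimers the finite-volume vector is one basis vector, on which number operators take the
definite values 0 and 1. Their expectations multiply, and this survives the limit. -/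
theorem voidState_zero_number_mul_number (x y : ℤ) :
    voidState 0 k (number x * number y) =
      voidState 0 k (number x) * voidState 0 k (number y) := by
  refine tendsto_nhds_unique (tendsto_voidState 0 k _)
    (((tendsto_voidState 0 k _).mul (tendsto_voidState 0 k _)).congr fun p => ?_)
  obtain ⟨S, hS⟩ : ∃ S, (voidOp 0 k p.1 p.2).op vacuum = ket S := by
    rcases vmdVector_zero (List.replicate p.1 .monomer ++ .void :: List.replicate p.2 .monomer)
      (3 * k - 3 * p.1) with h | h
    · have h1 := norm_sq_voidOp_vacuum 0 k p.1 p.2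
      rw [voidOp_vacuum_eq, h, norm_zero] at h1
      have := mul_pos (chainWeight_pos 0 p.1) (chainWeight_pos 0 p.2)
      norm_num at h1
      rcases h1 with h1 | h1
      · exact absurd h1 (chainWeight_pos 0 p.1).ne'
      · exact absurd h1 (chainWeight_pos 0 p.2).ne'
    · rwa [← voidOp_vacuum_eq] at h
  have hi : ⟪ket S, ket S⟫_ℂ = 1 := by rw [inner_ket, if_pos rfl]
  have hw : ((chainWeight 0 p.1 * chainWeight 0 p.2 : ℝ) : ℂ) = 1 := by
    rw [← norm_sq_voidOp_vacuum 0 k, hS]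
    have := inner_self_eq_norm_sq_to_K (𝕜 := ℂ) (ket S)
    rw [hi] at this
    rw [this]; norm_cast
  simp only [voidExp, vacExp_star_mul_mul_eq, hS, hw, div_one, op_mul_apply, number_ket]
  by_cases hx : x ∈ S <;> by_cases hy : y ∈ S <;>
    simp only [hx, hy, number_ket, if_true, if_false, map_zero, inner_zero_right, hi, mul_one,
      mul_zero]

end SpinChain

end


noncomputable section

namespace SpinChain

/-! ### Superpositions of the single-void vectors -/

section Superposition

variable {lam : ℂ} {Ω : ℤ → (voidState lam 0).GNS}

theorem gnsStarAlgHom_apply_eq_zero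
    (hΩ : ∀ k A, voidState lam k A = vectorFunctional (voidState lam 0) (Ω k) A)
    {k : ℤ} {X : QuasiLocal} (h : voidState lam k (star X * X) = 0) :
    (voidState lam 0).gnsStarAlgHom X (Ω k) = 0 := by
  rw [hΩ, vectorFunctional_star_mul_self] at h
  have h1 := Complex.ofReal_eq_zero.1 h
  exact norm_eq_zero.1 (pow_eq_zero_iff (two_ne_zero)|>.1 h1)

theorem gnsStarAlgHom_voidDetector_self
    (hΩ : ∀ k A, voidState lam k A = vectorFunctional (voidState lam 0) (Ω k) A) (k : ℤ) :
    (voidState lam 0).gnsStarAlgHom (voidDetector k) (Ω k) = Ω k := by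
  have h := gnsStarAlgHom_apply_eq_zero hΩ (voidState_one_sub_voidDetector lam k)
  rw [map_sub, map_one, sub_apply] at h
  exact (sub_eq_zero.1 h).symm

/-- Observables that are diagonal in the particle configurations do not connect the single-void
vectors. -/
theorem inner_gnsStarAlgHom_eq_zero
    (hΩ : ∀ k A, voidState lam k A = vectorFunctional (voidState lam 0) (Ω k) A)
    {A : QuasiLocal} (hA : ∀ k, Commute A (voidDetector k)) {k l : ℤ} (hkl : k ≠ l) :
    ⟪Ω k, (voidState lam 0).gnsStarAlgHom A (Ω l)⟫_ℂ = 0 := by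
  set π := (voidState lam 0).gnsStarAlgHom
  have hc : ∀ m v, π A (π (voidDetector m) v) = π (voidDetector m) (π A v) := fun m v => by
    have := congrArg (fun B => π B v) (hA m).eq
    rw [map_mul, map_mul] at this
    exact this
  have hs : ∀ m v w, ⟪π (voidDetector m) v, w⟫_ℂ = ⟪v, π (voidDetector m) w⟫_ℂ := fun m v w => by
    rw [PositiveLinearMap.inner_gnsStarAlgHom_left, star_voidDetector]
  -- The detector of the void further to the left fixes its own vector, annihilates the other one,
  -- and can be moved across A.
  rcases lt_or_gt_of_ne hkl with h | h
  · rw [← gnsStarAlgHom_voidDetector_self hΩ k, hs, ← hc,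
      gnsStarAlgHom_apply_eq_zero hΩ (voidState_voidDetector_of_lt lam k h), map_zero,
      inner_zero_right]
  · rw [← gnsStarAlgHom_voidDetector_self hΩ l, hc, ← hs,
      gnsStarAlgHom_apply_eq_zero hΩ (voidState_voidDetector_of_lt lam l h), inner_zero_left]

/-- Orthogonality is the case A = 1 of `inner_gnsStarAlgHom_eq_zero`. It uses only the states given
by the vectors, so any choice of the vectors, in particular of their phases, is allowed. -/
theorem orthonormal_of_vectorFunctional
    (hΩ : ∀ k A, voidState lam k A = vectorFunctional (voidState lam 0) (Ω k) A) :
    Orthonormal ℂ Ω := by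
  refine ⟨fun k => ?_, fun k l hkl => ?_⟩
  · have h := hΩ k (star 1 * 1)
    rw [vectorFunctional_star_mul_self, star_one, one_mul, voidState_one, map_one] at h
    have h1 : ‖Ω k‖ ^ 2 = 1 := by exact_mod_cast h.symm
    nlinarith [norm_nonneg (Ω k)]
  · have h := inner_gnsStarAlgHom_eq_zero hΩ (fun k => Commute.one_left _) hkl
    rwa [map_one] at h

theorem summable_smul_of_vectorFunctional
    (hΩ : ∀ k A, voidState lam k A = vectorFunctional (voidState lam 0) (Ω k) A)
    {c : ℤ → ℂ} (hc : HasSum (fun k => ‖c k‖ ^ 2) 1) : Summable (fun k => c k • Ω k) := by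
  have h := (orthonormal_of_vectorFunctional hΩ).orthogonalFamily
  exact (h.summable_iff_norm_sq_summable c).2 hc.summable

/-- For an observable commuting with all detectors the matrix elements between different Ω_k vanish,
so no interference terms remain in the expansion. -/
theorem hasSum_vectorFunctional
    (hΩ : ∀ k A, voidState lam k A = vectorFunctional (voidState lam 0) (Ω k) A)
    {c : ℤ → ℂ} (hc : HasSum (fun k => ‖c k‖ ^ 2) 1)
    {A : QuasiLocal} (hA : ∀ k, Commute A (voidDetector k)) :
    HasSum (fun k => (‖c k‖ ^ 2 : ℂ) * voidState lam k A)
      (vectorFunctional (voidState lam 0) (∑' k, c k • Ω k) A) := by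
  have hs := (summable_smul_of_vectorFunctional hΩ hc).hasSum
  set Ψ := ∑' k, c k • Ω k
  set π := (voidState lam 0).gnsStarAlgHom
  have h1 : ∀ l, ⟪Ψ, π A (Ω l)⟫_ℂ = (starRingEnd ℂ) (c l) * voidState lam l A := by
    intro l
    have h2 := hs.mapL (innerSL ℂ (π A (Ω l)))
    have h3 : HasSum (fun k => innerSL ℂ (π A (Ω l)) (c k • Ω k))
        (innerSL ℂ (π A (Ω l)) (c l • Ω l)) := by
      refine hasSum_single l fun k hk => ?_
      rw [innerSL_apply_apply, inner_smul_right, ← inner_conj_symm,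
        inner_gnsStarAlgHom_eq_zero hΩ hA hk, map_zero, mul_zero]
    have h4 := h2.unique h3
    rw [innerSL_apply_apply, innerSL_apply_apply, inner_smul_right] at h4
    rw [← inner_conj_symm, h4, map_mul, inner_conj_symm, hΩ l A]
    rfl
  have h5 := hs.mapL ((innerSL ℂ Ψ).comp (π A))
  refine h5.congr_fun fun k => ?_
  rw [ContinuousLinearMap.comp_apply, map_smul, innerSL_apply_apply, inner_smul_right, h1,
    ← mul_assoc, Complex.mul_conj']

theorem norm_tsum_smul_eq_one
    (hΩ : ∀ k A, voidState lam k A = vectorFunctional (voidState lam 0) (Ω k) A)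
    {c : ℤ → ℂ} (hc : HasSum (fun k => ‖c k‖ ^ 2) 1) : ‖∑' k, c k • Ω k‖ = 1 := by
  have h := hasSum_vectorFunctional hΩ hc (A := star 1 * 1) (fun k => by simp)
  rw [vectorFunctional_star_mul_self, star_one, one_mul, map_one] at h
  simp only [voidState_one, mul_one] at h
  have h2 := (Complex.hasSum_ofReal.2 hc).unique (by simpa using h)
  have h3 : ‖∑' k, c k • Ω k‖ ^ 2 = 1 := by
    have h4 : ((1 : ℝ) : ℂ) = ((‖∑' k, c k • Ω k‖ ^ 2 : ℝ) : ℂ) := by rw [h2]; push_cast; rfl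
    exact (Complex.ofReal_injective h4).symm
  nlinarith [norm_nonneg (∑' k, c k • Ω k)]

theorem gnsStarAlgHom_tsum_eq_zero
    (hΩ : ∀ k A, voidState lam k A = vectorFunctional (voidState lam 0) (Ω k) A)
    {c : ℤ → ℂ} (hc : HasSum (fun k => ‖c k‖ ^ 2) 1) {X : QuasiLocal}
    (h : ∀ k, voidState lam k (star X * X) = 0) :
    (voidState lam 0).gnsStarAlgHom X (∑' k, c k • Ω k) = 0 := by
  have h1 := (summable_smul_of_vectorFunctional hΩ hc).hasSum.mapL
    ((voidState lam 0).gnsStarAlgHom X)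
  refine h1.unique (hasSum_zero.congr_fun fun k => ?_)
  rw [map_smul, gnsStarAlgHom_apply_eq_zero hΩ (h k), smul_zero]

theorem hamiltonian_eq (lam : ℂ) (kappa : ℝ) (a b : ℤ) : hamiltonian lam kappa a b =
    ∑ x ∈ Finset.Icc a (b - 2), star (lower x * lower (x + 2)) * (lower x * lower (x + 2)) +
    (kappa : ℂ) • ∑ x ∈ Finset.Icc a (b - 3), star (pairOp lam x) * pairOp lam x := by
  rw [hamiltonian]
  congr 1
  exact Finset.sum_congr rfl fun x _ => number_mul_number_eq (by omega)

theorem gnsStarAlgHom_hamiltonian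
    (hΩ : ∀ k A, voidState lam k A = vectorFunctional (voidState lam 0) (Ω k) A)
    {c : ℤ → ℂ} (hc : HasSum (fun k => ‖c k‖ ^ 2) 1) (kappa : ℝ) (a b : ℤ) :
    (voidState lam 0).gnsStarAlgHom (hamiltonian lam kappa a b) (∑' k, c k • Ω k) = 0 := by
  have h : ∀ {X : QuasiLocal}, (∀ k, voidState lam k (star X * X) = 0) →
      (voidState lam 0).gnsStarAlgHom (star X * X) (∑' k, c k • Ω k) = 0 := fun hX => by
    rw [map_mul]
    change (voidState lam 0).gnsStarAlgHom _ ((voidState lam 0).gnsStarAlgHom _ _) = 0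
    rw [gnsStarAlgHom_tsum_eq_zero hΩ hc hX, map_zero]
  rw [hamiltonian_eq, map_add, map_smul, map_sum, map_sum, add_apply, smul_apply, sum_apply,
    sum_apply, Finset.sum_eq_zero fun x _ => h fun k => voidState_star_lower_lower lam k x,
    Finset.sum_eq_zero fun x _ => h fun k => voidState_star_pairOp lam k x, smul_zero, add_zero]

theorem hasZeroEnergy_superposition
    (hΩ : ∀ k A, voidState lam k A = vectorFunctional (voidState lam 0) (Ω k) A)
    {c : ℤ → ℂ} (hc : HasSum (fun k => ‖c k‖ ^ 2) 1) (kappa : ℝ) :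
    HasZeroEnergy lam kappa (vectorFunctional (voidState lam 0) (∑' k, c k • Ω k)) := fun a b => by
  rw [vectorFunctional_apply, gnsStarAlgHom_hamiltonian hΩ hc, inner_zero_right]

/-- Every term of the Hamiltonian is X*X with a nonnegative coefficient, and A* X*X A = (XA)*(XA).
-/
theorem IsState.conj_hamiltonian_nonneg {f : QuasiLocal →ₗ[ℂ] ℂ} (hf : IsState f) {kappa : ℝ}
    (hk : 0 < kappa) (a b : ℤ) (A : QuasiLocal) :
    0 ≤ f (star A * hamiltonian lam kappa a b * A) := by
  have h : ∀ X : QuasiLocal, 0 ≤ f (star A * (star X * X) * A) := fun X => by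
    have := hf.1 (X * A)
    rwa [star_mul, show star A * star X * (X * A) = star A * (star X * X) * A by noncomm_ring]
      at this
  rw [hamiltonian_eq, mul_add, add_mul, map_add, Finset.mul_sum, Finset.sum_mul, map_sum,
    mul_smul_comm, smul_mul_assoc, map_smul, Finset.mul_sum, Finset.sum_mul, map_sum]
  refine add_nonneg (Finset.sum_nonneg fun x _ => h _) (mul_nonneg ?_
    (Finset.sum_nonneg fun x _ => h _))
  exact Complex.zero_le_real.2 hk.le

/-- The Hamiltonian annihilates the vector, which removes the term A*A H of the commutator and
leaves A*HA. This works for every n, regardless of the support of A. -/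
theorem isGroundState_superposition
    (hΩ : ∀ k A, voidState lam k A = vectorFunctional (voidState lam 0) (Ω k) A)
    {c : ℤ → ℂ} (hc : HasSum (fun k => ‖c k‖ ^ 2) 1) {kappa : ℝ} (hk : 0 < kappa) :
    IsGroundState lam kappa (vectorFunctional (voidState lam 0) (∑' k, c k • Ω k)) := by
  have hst := isState_vectorFunctional (voidState lam 0) (norm_tsum_smul_eq_one hΩ hc)
  refine ⟨hst, fun X A _ => Eventually.of_forall fun n => ?_⟩
  have h : vectorFunctional (voidState lam 0) (∑' k, c k • Ω k)
      (star A * A * hamiltonian lam kappa (-n) n) = 0 := by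
    rw [vectorFunctional_apply, map_mul _ (star A * A)]
    change ⟪_, (voidState lam 0).gnsStarAlgHom _ ((voidState lam 0).gnsStarAlgHom _ _)⟫_ℂ = 0
    rw [gnsStarAlgHom_hamiltonian hΩ hc, map_zero, inner_zero_right]
  rw [mul_sub, map_sub, ← mul_assoc, ← mul_assoc, h, sub_zero]
  exact hst.conj_hamiltonian_nonneg hk _ _ _

end Superposition

end SpinChain

end


noncomputable section

namespace SpinChain

/-! ### Means with respect to the weights of a superposition -/

section Mean

/-- The mean of `g` with respect to the weights `|c_k|²`. -/
def mean (c : ℤ → ℂ) (g : ℤ → ℝ) : ℝ := ∑' k, ‖c k‖ ^ 2 * g k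

/-- Boundedness on the integers. -/
def IsBdd (g : ℤ → ℝ) : Prop := ∃ B, ∀ k, |g k| ≤ B

variable {g h : ℤ → ℝ} {c : ℤ → ℂ}

theorem IsBdd.const (a : ℝ) : IsBdd fun _ => a := ⟨|a|, fun _ => le_rfl⟩

theorem IsBdd.add (hg : IsBdd g) (hh : IsBdd h) : IsBdd fun k => g k + h k :=
  let ⟨B, hB⟩ := hg
  let ⟨B', hB'⟩ := hh
  ⟨B + B', fun k => (abs_add_le _ _).trans (add_le_add (hB k) (hB' k))⟩

theorem IsBdd.mul (hg : IsBdd g) (hh : IsBdd h) : IsBdd fun k => g k * h k :=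
  let ⟨B, hB⟩ := hg
  let ⟨B', hB'⟩ := hh
  ⟨B * B', fun k => by
    rw [abs_mul]
    exact mul_le_mul (hB k) (hB' k) (abs_nonneg _) ((abs_nonneg _).trans (hB k))⟩

theorem IsBdd.sub (hg : IsBdd g) (hh : IsBdd h) : IsBdd fun k => g k - h k := by
  simpa only [neg_one_mul, ← sub_eq_add_neg] using hg.add ((IsBdd.const (-1)).mul hh)

theorem IsBdd.ite {P : ℤ → Prop} [DecidablePred P] (hg : ∃ B, ∀ k, P k → |g k| ≤ B) :
    IsBdd fun k => if P k then g k else 0 := by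
  obtain ⟨B, hB⟩ := hg
  refine ⟨max B 0, fun k => ?_⟩
  beta_reduce
  split_ifs with h
  · exact (hB k h).trans (le_max_left _ _)
  · rw [abs_zero]; exact le_max_right _ _

theorem hasSum_mean (hc : HasSum (fun k => ‖c k‖ ^ 2) 1) (hg : IsBdd g) :
    HasSum (fun k => ‖c k‖ ^ 2 * g k) (mean c g) := by
  obtain ⟨B, hB⟩ := hg
  refine (Summable.of_norm_bounded (hc.summable.mul_right B) fun k => ?_).hasSum
  rw [Real.norm_eq_abs, abs_mul, abs_of_nonneg (sq_nonneg ‖c k‖)]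
  exact mul_le_mul_of_nonneg_left (hB k) (sq_nonneg _)

theorem mean_const (hc : HasSum (fun k => ‖c k‖ ^ 2) 1) (a : ℝ) : mean c (fun _ => a) = a := by
  have := (hc.mul_right a).tsum_eq
  rwa [one_mul] at this

theorem mean_add (hc : HasSum (fun k => ‖c k‖ ^ 2) 1) (hg : IsBdd g) (hh : IsBdd h) :
    mean c (fun k => g k + h k) = mean c g + mean c h := by
  rw [← ((hasSum_mean hc hg).add (hasSum_mean hc hh)).tsum_eq, mean]
  simp only [mul_add]

theorem mean_sub (hc : HasSum (fun k => ‖c k‖ ^ 2) 1) (hg : IsBdd g) (hh : IsBdd h) :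
    mean c (fun k => g k - h k) = mean c g - mean c h := by
  rw [← ((hasSum_mean hc hg).sub (hasSum_mean hc hh)).tsum_eq, mean]
  simp only [mul_sub]

theorem mean_const_mul (a : ℝ) : mean c (fun k => a * g k) = a * mean c g := by
  rw [mean, mean, ← tsum_mul_left]
  exact tsum_congr fun k => by ring

/-- Comparison is only required where c does not vanish, so that formulas valid for k ≥ 0, or at the
sparse sites, can be used. -/
theorem mean_congr (h' : ∀ k, c k ≠ 0 → g k = h k) : mean c g = mean c h := by
  refine tsum_congr fun k => ?_
  by_cases hk : c k = 0
  · simp [hk]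
  · rw [h' k hk]

theorem mean_mono (hc : HasSum (fun k => ‖c k‖ ^ 2) 1) (hg : IsBdd g) (hh : IsBdd h)
    (h' : ∀ k, c k ≠ 0 → g k ≤ h k) : mean c g ≤ mean c h := by
  refine hasSum_le (fun k => ?_) (hasSum_mean hc hg) (hasSum_mean hc hh)
  by_cases hk : c k = 0
  · simp [hk]
  · exact mul_le_mul_of_nonneg_left (h' k hk) (sq_nonneg _)

theorem abs_mean_le (hc : HasSum (fun k => ‖c k‖ ^ 2) 1) (hg : IsBdd g) (hh : IsBdd h)
    (h' : ∀ k, c k ≠ 0 → |g k| ≤ h k) : |mean c g| ≤ mean c h := by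
  refine abs_le.2 ⟨?_, mean_mono hc hg hh fun k hk => (le_abs_self _).trans (h' k hk)⟩
  have := mean_mono hc ((IsBdd.const (-1)).mul hh) hg
    fun k hk => by have := (abs_le.1 (h' k hk)).1; linarith
  rw [mean_const_mul] at this
  linarith

theorem tsum_subtype_eq_mean (P : ℤ → Prop) [DecidablePred P] (g : ℤ → ℝ) :
    ∑' k : {k : ℤ // P k}, ‖c k‖ ^ 2 * g k = mean c (fun k => if P k then g k else 0) := by
  refine (tsum_subtype {k | P k} fun k => ‖c k‖ ^ 2 * g k).trans (tsum_congr fun k => ?_)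
  by_cases h : P k <;> simp [Set.indicator, h]

theorem tsum_subtype_eq_mean_one (P : ℤ → Prop) [DecidablePred P] :
    ∑' k : {k : ℤ // P k}, ‖c k‖ ^ 2 = mean c (fun k => if P k then 1 else 0) := by
  rw [← tsum_subtype_eq_mean P fun _ => 1]
  simp

theorem tailMass_eq (j : ℤ) : tailMass c j = mean c (fun k => if j < k then 1 else 0) :=
  tsum_subtype_eq_mean_one _

theorem isBdd_indicator (P : ℤ → Prop) [DecidablePred P] : IsBdd fun k => if P k then 1 else 0 :=
  IsBdd.ite ⟨1, fun _ _ => by simp⟩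

theorem tsum_le_eq_one_sub_tailMass (hc : HasSum (fun k => ‖c k‖ ^ 2) 1) (j : ℤ) :
    ∑' k : {k : ℤ // k ≤ j}, ‖c k‖ ^ 2 = 1 - tailMass c j := by
  rw [tsum_subtype_eq_mean_one, tailMass_eq, eq_sub_iff_add_eq,
    ← mean_add hc (isBdd_indicator _) (isBdd_indicator _)]
  refine (mean_congr fun k _ => ?_).trans (mean_const hc 1)
  rcases le_or_gt k j with h | h
  · simp [h]
  · simp [h]

/-- Series over the nonnegative integers. -/
theorem tsum_nat_eq_mean (hneg : ∀ k < 0, c k = 0) (g : ℤ → ℝ) :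
    ∑' k : ℕ, ‖c k‖ ^ 2 * g k = mean c g :=
  Function.Injective.tsum_eq (f := fun k : ℤ => ‖c k‖ ^ 2 * g k) Nat.cast_injective fun k hk => by
    by_contra h
    have hk0 : k < 0 := by
      by_contra h'
      exact h ⟨k.toNat, by simp; omega⟩
    simp [hneg k hk0] at hk

theorem muMass_eq (lam : ℂ) (hneg : ∀ k < 0, c k = 0) :
    muMass lam c = mean c (fun k => muRatio lam ^ k.toNat) := by
  rw [← tsum_nat_eq_mean hneg]
  simp [muMass]

end Mean

/-! ### Densities in superpositions -/

section Density

variable (lam : ℂ)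

theorem sq_div_muPlus_nonneg : 0 ≤ ‖lam‖ ^ 2 / muPlus lam :=
  div_nonneg (sq_nonneg _) (muPlus_pos lam).le

theorem abs_density_le (k j : ℤ) : |density lam k j| ≤ 2 * (1 + ‖lam‖ ^ 2 / muPlus lam) := by
  have hr := sq_div_muPlus_nonneg lam
  rw [density, abs_mul, abs_div, abs_of_pos (muDiff_pos lam)]
  refine mul_le_mul ((div_le_self (abs_nonneg _) (one_le_muDiff lam)).trans
    (abs_one_sub_muRatio_zpow_le lam (abs_nonneg _))) ?_ (abs_nonneg _) (by norm_num)
  split_ifs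
  · rw [abs_one]; linarith
  · rw [abs_zero]; linarith
  · rw [abs_of_nonneg hr]; linarith

theorem isBdd_density (j : ℤ) : IsBdd fun k => density lam k j :=
  ⟨_, fun k => abs_density_le lam k j⟩

theorem isBdd_right (j : ℤ) : IsBdd fun k => if j < k then muRatio lam ^ (k - j) else 0 :=
  IsBdd.ite ⟨1, fun k hk => by
    simpa using abs_muRatio_zpow_le lam le_rfl (show 0 ≤ k - j by omega)⟩

theorem isBdd_left (j : ℤ) : IsBdd fun k => if k ≤ j then muRatio lam ^ (j - k) else 0 :=
  IsBdd.ite ⟨1, fun k hk => by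
    simpa using abs_muRatio_zpow_le lam le_rfl (show 0 ≤ j - k by omega)⟩

theorem isBdd_toNat : IsBdd fun k => muRatio lam ^ k.toNat :=
  ⟨1, fun _ => abs_muRatio_pow_le_one lam _⟩

/-- The bracket isolates the combination in the leading term, and the constant is the limit far to
the right of the void. At k = j the term μ^0 cancels the constant, as the void site is empty. -/
theorem density_eq (k j : ℤ) : density lam k j = 1 / muDiff lam *
    (((if j < k then 1 else 0) - ‖lam‖ ^ 2 / muPlus lam * (if j < k then 1 else 0)
      - (if j < k then muRatio lam ^ (k - j) else 0)
      - ‖lam‖ ^ 2 / muPlus lam * (if k ≤ j then muRatio lam ^ (j - k) else 0))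
      + ‖lam‖ ^ 2 / muPlus lam) := by
  rw [density]
  rcases lt_trichotomy j k with h | rfl | h
  · rw [abs_of_neg (by omega), if_pos h, if_pos h, if_pos h, if_neg (by omega), neg_sub]; ring
  · simp
  · rw [abs_of_pos (by omega), if_neg (by omega), if_neg (by omega), if_neg (by omega),
      if_neg (by omega), if_pos h.le]; ring

theorem density_zero_eq {k : ℤ} (hk : 0 ≤ k) :
    density lam k 0 = 1 / muDiff lam * (1 - muRatio lam ^ k.toNat) := by
  lift k to ℕ using hk
  rw [density_eq]
  rcases Nat.eq_zero_or_pos k with rfl | h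
  · simp
  · rw [if_pos (by omega), if_pos (by omega), if_neg (by omega), sub_zero, zpow_natCast,
      Int.toNat_natCast]
    ring

variable {lam} {c : ℤ → ℂ}

/-- The leading term of the density correlations. -/
def leadingCorr (lam : ℂ) (c : ℤ → ℂ) (j : ℤ) : ℝ :=
  muMass lam c / muDiff lam ^ 2 *
    (tailMass c j - ‖lam‖ ^ 2 / muPlus lam * tailMass c j
      - (∑' k : {k : ℤ // j < k}, ‖c k‖ ^ 2 * muRatio lam ^ ((k : ℤ) - j))
      - ‖lam‖ ^ 2 / muPlus lam *
        ∑' k : {k : ℤ // k ≤ j}, ‖c k‖ ^ 2 * muRatio lam ^ (j - (k : ℤ)))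

/-- The sum of the double series. -/
def seriesCorr (lam : ℂ) (c : ℤ → ℂ) (j : ℤ) : ℝ :=
  mean c (fun k => density lam k j * density lam k 0) -
    mean c (fun k => density lam k j) * mean c (fun k => density lam k 0)

/-- By `density_eq`, the bracket of the leading term is Δμ times the mean density at 3j, minus the
limit value of the scaled density as j → ∞. -/
theorem leadingCorr_eq (hc : HasSum (fun k => ‖c k‖ ^ 2) 1) (j : ℤ) :
    leadingCorr lam c j = muMass lam c / muDiff lam ^ 2 *
      (muDiff lam * mean c (fun k => density lam k j) - ‖lam‖ ^ 2 / muPlus lam) := by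
  have hD := (muDiff_pos lam).ne'
  have h1 := isBdd_indicator fun k => j < k
  have h2 := isBdd_right lam j
  have h3 := isBdd_left lam j
  have hr := IsBdd.const (‖lam‖ ^ 2 / muPlus lam)
  simp only [density_eq lam _ j]
  rw [mean_const_mul, mean_add hc (((h1.sub (hr.mul h1)).sub h2).sub (hr.mul h3)) hr,
    mean_sub hc ((h1.sub (hr.mul h1)).sub h2) (hr.mul h3), mean_sub hc (h1.sub (hr.mul h1)) h2,
    mean_sub hc h1 (hr.mul h1), mean_const_mul, mean_const_mul, mean_const hc,
    leadingCorr, tailMass_eq, tsum_subtype_eq_mean (fun k => j < k) fun k => muRatio lam ^ (k - j),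
    tsum_subtype_eq_mean (fun k => k ≤ j) fun k => muRatio lam ^ (j - k)]
  field_simp
  ring

theorem mean_density_zero (hc : HasSum (fun k => ‖c k‖ ^ 2) 1) (hneg : ∀ k < 0, c k = 0) :
    mean c (fun k => density lam k 0) = 1 / muDiff lam * (1 - muMass lam c) := by
  rw [muMass_eq lam hneg, ← mean_const hc 1, ← mean_sub hc (.const 1) (isBdd_toNat lam),
    ← mean_const_mul, mean_const hc]
  refine mean_congr fun k hk => density_zero_eq lam ?_
  by_contra h
  exact hk (hneg k (by omega))

/-- For k ≥ 0 the density at 0 is (1 - μ^k)/Δμ, so the difference is the mean of μ^k times a bounded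
function of k. If k > j, the factor μ^k is small. If k ≤ j, the bounded terms cancel and μ^(j-k) μ^k
= μ^j remains. -/
theorem abs_seriesCorr_sub_leadingCorr_le (hc : HasSum (fun k => ‖c k‖ ^ 2) 1)
    (hneg : ∀ k < 0, c k = 0) {j : ℤ} (hj : 0 ≤ j) :
    |seriesCorr lam c j - leadingCorr lam c j| ≤
      3 * max 1 (‖lam‖ ^ 2) / muDiff lam ^ 2 * |muRatio lam| ^ j := by
  have hD := muDiff_pos lam
  have hr := sq_div_muPlus_nonneg lam
  have hr' := sq_div_muPlus_le lam
  set r := ‖lam‖ ^ 2 / muPlus lam with hrdef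
  have b1 := isBdd_density lam j
  have b2 := isBdd_density lam 0
  have b3 := isBdd_toNat lam
  have e : seriesCorr lam c j - leadingCorr lam c j = mean c (fun k =>
      density lam k j * density lam k 0 - 1 / muDiff lam * density lam k j +
        r / muDiff lam ^ 2 * muRatio lam ^ k.toNat) := by
    rw [mean_add hc ((b1.mul b2).sub ((IsBdd.const _).mul b1)) ((IsBdd.const _).mul b3),
      mean_sub hc (b1.mul b2) ((IsBdd.const _).mul b1), mean_const_mul, mean_const_mul,
      seriesCorr, leadingCorr_eq hc, mean_density_zero hc hneg, muMass_eq lam hneg]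
    field_simp
    ring
  have hm : 0 ≤ |muRatio lam| ^ j := zpow_nonneg (abs_nonneg _) _
  rw [e, ← mean_const hc (3 * max 1 (‖lam‖ ^ 2) / muDiff lam ^ 2 * |muRatio lam| ^ j)]
  refine abs_mean_le hc (((b1.mul b2).sub ((IsBdd.const _).mul b1)).add ((IsBdd.const _).mul b3))
    (.const _) fun k hk => ?_
  have hk0 : 0 ≤ k := by
    by_contra h
    exact hk (hneg k (by omega))
  have hmax1 := le_max_left 1 (‖lam‖ ^ 2)
  have hmax2 := le_max_right 1 (‖lam‖ ^ 2)
  rw [density_zero_eq lam hk0, density_eq lam k j, ← hrdef]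
  rcases lt_or_ge j k with h | h
  · rw [if_pos h, if_pos h, if_neg (by omega)]
    have e2 : 1 / muDiff lam * (1 - r * 1 - muRatio lam ^ (k - j) - r * 0 + r) *
        (1 / muDiff lam * (1 - muRatio lam ^ k.toNat)) -
        1 / muDiff lam * (1 / muDiff lam * (1 - r * 1 - muRatio lam ^ (k - j) - r * 0 + r)) +
        r / muDiff lam ^ 2 * muRatio lam ^ k.toNat =
        1 / muDiff lam ^ 2 * ((r - (1 - muRatio lam ^ (k - j))) * muRatio lam ^ k) := by
      rw [show muRatio lam ^ k = muRatio lam ^ k.toNat by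
        rw [← zpow_natCast, Int.toNat_of_nonneg hk0]]
      field_simp
      ring
    have h1 := abs_one_sub_muRatio_zpow_le lam (show 0 ≤ k - j by omega)
    have h2 : |r - (1 - muRatio lam ^ (k - j))| ≤ 3 * max 1 (‖lam‖ ^ 2) := by
      have := abs_sub r (1 - muRatio lam ^ (k - j))
      rw [abs_of_nonneg hr] at this
      linarith
    rw [e2, abs_mul, abs_mul, abs_of_nonneg (by positivity)]
    calc _ ≤ 1 / muDiff lam ^ 2 * (3 * max 1 (‖lam‖ ^ 2) * |muRatio lam| ^ j) := by
          gcongr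
          exact abs_muRatio_zpow_le lam hj h.le
      _ = _ := by ring
  · rw [if_neg (by omega), if_neg (by omega), if_pos h]
    have e2 : 1 / muDiff lam * (0 - r * 0 - 0 - r * muRatio lam ^ (j - k) + r) *
        (1 / muDiff lam * (1 - muRatio lam ^ k.toNat)) -
        1 / muDiff lam * (1 / muDiff lam * (0 - r * 0 - 0 - r * muRatio lam ^ (j - k) + r)) +
        r / muDiff lam ^ 2 * muRatio lam ^ k.toNat =
        1 / muDiff lam ^ 2 * (r * muRatio lam ^ j) := by
      have : muRatio lam ^ j = muRatio lam ^ (j - k) * muRatio lam ^ k.toNat := by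
        obtain ⟨a, rfl⟩ : ∃ a : ℕ, j = k + a := ⟨(j - k).toNat, by omega⟩
        lift k to ℕ using hk0
        rw [add_sub_cancel_left, zpow_natCast, Int.toNat_natCast, ← Nat.cast_add, zpow_natCast,
          pow_add, mul_comm]
      rw [this]
      field_simp
      ring
    rw [e2, abs_mul, abs_mul, abs_of_nonneg (by positivity), abs_of_nonneg hr]
    calc _ ≤ 1 / muDiff lam ^ 2 * (3 * max 1 (‖lam‖ ^ 2) * |muRatio lam| ^ j) := by
          gcongr
          · linarith
          · exact abs_muRatio_zpow_le lam hj le_rfl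
      _ = _ := by ring

theorem abs_muMass_le_one (hc : HasSum (fun k => ‖c k‖ ^ 2) 1) (hneg : ∀ k < 0, c k = 0) :
    |muMass lam c| ≤ 1 := by
  rw [muMass_eq lam hneg, ← mean_const hc 1]
  exact abs_mean_le hc (isBdd_toNat lam) (.const 1) fun k _ => abs_muRatio_pow_le_one lam _

theorem isBdd_max (j : ℤ) : IsBdd fun k => |muRatio lam| ^ max (j - k) 0 :=
  ⟨1, fun k => by
    have := abs_muRatio_zpow_le lam le_rfl (le_max_right (j - k) 0)
    rwa [zpow_zero, ← abs_abs (_ ^ _), abs_zpow] at this⟩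

/-- Each discarded term carries a factor |λ|², either from |λ|²/μ₊ or from a power of μ, since |μ| ≤
|λ|². -/
theorem abs_leadingCorr_sub_le (hc : HasSum (fun k => ‖c k‖ ^ 2) 1)
    (hneg : ∀ k < 0, c k = 0) (j : ℤ) :
    |leadingCorr lam c j - muMass lam c / muDiff lam ^ 2 * tailMass c j| ≤
      2 * ‖lam‖ ^ 2 / muDiff lam ^ 2 * ∑' k : ℤ, ‖c k‖ ^ 2 * |muRatio lam| ^ max (j - k) 0 := by
  have hD := muDiff_pos lam
  have hr := sq_div_muPlus_nonneg lam
  have hr' := sq_div_muPlus_le lam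
  have h1 := isBdd_indicator fun k => j < k
  have h2 := isBdd_right lam j
  have h3 := isBdd_left lam j
  set r := ‖lam‖ ^ 2 / muPlus lam with hrdef
  have hrb := IsBdd.const r
  have e : leadingCorr lam c j - muMass lam c / muDiff lam ^ 2 * tailMass c j =
      muMass lam c / muDiff lam ^ 2 * mean c (fun k => (-r) * (if j < k then 1 else 0) -
        (if j < k then muRatio lam ^ (k - j) else 0) -
        r * (if k ≤ j then muRatio lam ^ (j - k) else 0)) := by
    rw [mean_sub hc (((IsBdd.const _).mul h1).sub h2) (hrb.mul h3),
      mean_sub hc ((IsBdd.const _).mul h1) h2, mean_const_mul, mean_const_mul,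
      leadingCorr, tailMass_eq,
      tsum_subtype_eq_mean (fun k => j < k) fun k => muRatio lam ^ (k - j),
      tsum_subtype_eq_mean (fun k => k ≤ j) fun k => muRatio lam ^ (j - k)]
    ring
  have h4 : |mean c (fun k => (-r) * (if j < k then 1 else 0) -
        (if j < k then muRatio lam ^ (k - j) else 0) -
        r * (if k ≤ j then muRatio lam ^ (j - k) else 0))| ≤
      2 * ‖lam‖ ^ 2 * mean c (fun k => |muRatio lam| ^ max (j - k) 0) := by
    rw [← mean_const_mul]
    refine abs_mean_le hc ((((IsBdd.const _).mul h1).sub h2).sub (hrb.mul h3))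
      ((IsBdd.const _).mul (isBdd_max j)) fun k _ => ?_
    rcases lt_or_ge j k with h | h
    · rw [if_pos h, if_pos h, if_neg (by omega), max_eq_right (by omega), zpow_zero]
      -- Strict inequality j < k matters: it provides one power of μ and thereby the factor |λ|².
      have h5 := abs_muRatio_zpow_le lam zero_le_one (show 1 ≤ k - j by omega)
      rw [zpow_one] at h5
      have h6 := abs_sub (-r * 1) (muRatio lam ^ (k - j))
      rw [mul_one, abs_neg, abs_of_nonneg hr] at h6
      have := abs_muRatio_le lam
      rw [mul_zero, sub_zero, mul_one, mul_one]
      linarith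
    · rw [if_neg (by omega), if_neg (by omega), if_pos h, max_eq_left (by omega), mul_zero,
        sub_zero, zero_sub, abs_neg, abs_mul, abs_zpow, abs_of_nonneg hr]
      exact mul_le_mul_of_nonneg_right (by nlinarith [sq_nonneg ‖lam‖])
        (zpow_nonneg (abs_nonneg _) _)
  rw [e, abs_mul, abs_div, abs_of_pos (pow_pos hD 2)]
  calc _ ≤ 1 / muDiff lam ^ 2 *
        (2 * ‖lam‖ ^ 2 * mean c (fun k => |muRatio lam| ^ max (j - k) 0)) := by
        gcongr
        exact abs_muMass_le_one hc hneg
    _ = _ := by rw [mean]; ring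

theorem seriesCorr_eq_of_nonneg (hc : HasSum (fun k => ‖c k‖ ^ 2) 1) (hneg : ∀ k < 0, c k = 0)
    (j : ℤ) : seriesCorr lam c j = 1 / muDiff lam ^ 2 *
      ∑' k : ℕ, ‖c k‖ ^ 2 * (1 - muRatio lam ^ |j - k|) * (muMass lam c - muRatio lam ^ k) *
        (if j < k then 1 else if (k : ℤ) < j then ‖lam‖ ^ 2 / muPlus lam else 0) := by
  have hD := (muDiff_pos lam).ne'
  have b1 := isBdd_density lam j
  have b2 := isBdd_density lam 0
  have e : ∑' k : ℕ, ‖c k‖ ^ 2 * (1 - muRatio lam ^ |j - k|) * (muMass lam c - muRatio lam ^ k) *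
        (if j < k then 1 else if (k : ℤ) < j then ‖lam‖ ^ 2 / muPlus lam else 0) =
      mean c (fun k : ℤ => (1 - muRatio lam ^ |j - k|) * (muMass lam c - muRatio lam ^ k.toNat) *
        (if j < k then 1 else if k < j then ‖lam‖ ^ 2 / muPlus lam else 0)) := by
    rw [← tsum_nat_eq_mean hneg]
    refine tsum_congr fun k => ?_
    rw [Int.toNat_natCast]
    ring
  rw [e, ← mean_const_mul, seriesCorr, mul_comm (mean c _), ← mean_const_mul,
    ← mean_sub hc (b1.mul b2) ((IsBdd.const _).mul b1), mean_density_zero hc hneg]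
  refine mean_congr fun k hk => ?_
  have hk0 : 0 ≤ k := by
    by_contra h
    exact hk (hneg k (by omega))
  rw [density_zero_eq lam hk0, density]
  rcases lt_trichotomy j k with h | rfl | h
  · rw [if_pos h, if_pos h]; field_simp; ring
  · simp
  · rw [if_neg (by omega), if_neg (by omega), if_neg (by omega), if_pos h]; field_simp; ring

theorem tendsto_density (k : ℤ) : Tendsto (fun j : ℕ => density lam k j) atTop
    (𝓝 (1 / muDiff lam * (‖lam‖ ^ 2 / muPlus lam))) := by
  have h : Tendsto (fun j : ℕ => 1 / muDiff lam * (‖lam‖ ^ 2 / muPlus lam *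
      (1 - muRatio lam ^ ((j : ℤ) - k).toNat))) atTop
      (𝓝 (1 / muDiff lam * (‖lam‖ ^ 2 / muPlus lam * (1 - 0)))) := by
    refine ((Tendsto.const_sub 1 ?_).const_mul _).const_mul _
    refine (tendsto_pow_atTop_nhds_zero_of_abs_lt_one (abs_muRatio_lt_one lam)).comp ?_
    refine tendsto_atTop.2 fun n => ?_
    filter_upwards [eventually_ge_atTop (n + k.toNat)] with j hj
    omega
  rw [sub_zero, mul_one] at h
  refine h.congr' ?_
  filter_upwards [eventually_ge_atTop (k.toNat + 1)] with j hj
  have e : muRatio lam ^ ((j : ℤ) - k) = muRatio lam ^ ((j : ℤ) - k).toNat := by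
    rw [← zpow_natCast, Int.toNat_of_nonneg (by omega)]
  rw [density_eq, if_neg (by omega), if_neg (by omega), if_pos (by omega), e]
  ring

theorem tendsto_mean (hc : HasSum (fun k => ‖c k‖ ^ 2) 1) {g : ℕ → ℤ → ℝ} {g' : ℤ → ℝ} {B : ℝ}
    (hB : ∀ j k, |g j k| ≤ B) (hg : ∀ k, Tendsto (fun j => g j k) atTop (𝓝 (g' k))) :
    Tendsto (fun j => mean c (g j)) atTop (𝓝 (mean c g')) := by
  refine tendsto_tsum_of_dominated_convergence (hc.summable.mul_right B)
    (fun k => (hg k).const_mul _) (Eventually.of_forall fun j k => ?_)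
  rw [Real.norm_eq_abs, abs_mul, abs_of_nonneg (sq_nonneg ‖c k‖)]
  exact mul_le_mul_of_nonneg_left (hB j k) (sq_nonneg _)

/-- `seriesCorr` is the covariance of the densities at 3j and 0 over the random void position. The
former converges to a constant for each position, and the covariance with a constant is zero. -/
theorem tendsto_seriesCorr (hc : HasSum (fun k => ‖c k‖ ^ 2) 1) :
    Tendsto (fun j : ℕ => seriesCorr lam c j) atTop (𝓝 0) := by
  have h1 : Tendsto (fun j : ℕ => mean c (fun k => density lam k j)) atTop
      (𝓝 (mean c fun _ => 1 / muDiff lam * (‖lam‖ ^ 2 / muPlus lam))) :=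
    tendsto_mean hc (fun j k => abs_density_le lam k j) fun k => tendsto_density k
  have h2 : Tendsto (fun j : ℕ => mean c (fun k => density lam k j * density lam k 0)) atTop
      (𝓝 (mean c fun k => 1 / muDiff lam * (‖lam‖ ^ 2 / muPlus lam) * density lam k 0)) := by
    refine tendsto_mean hc (B := 2 * (1 + ‖lam‖ ^ 2 / muPlus lam) *
      (2 * (1 + ‖lam‖ ^ 2 / muPlus lam))) (fun j k => ?_)
      fun k => (tendsto_density k).mul_const _
    rw [abs_mul]
    exact mul_le_mul (abs_density_le lam k j) (abs_density_le lam k 0) (abs_nonneg _)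
      ((abs_nonneg _).trans (abs_density_le lam k j))
  have h3 := h2.sub (h1.mul_const (mean c fun k => density lam k 0))
  rwa [mean_const hc, mean_const_mul, sub_self] at h3

theorem _root_.HasSum.prod_mul {ι κ : Type*} {f : ι → ℝ} {g : κ → ℝ} {a b : ℝ} (hf : HasSum f a)
    (hg : HasSum g b) : HasSum (fun p : ι × κ => f p.1 * g p.2) (a * b) :=
  hf.mul hg (summable_mul_of_summable_norm hf.summable.norm hg.summable.norm)

/-- The double series of the density correlations. -/
theorem hasSum_seriesCorr (hc : HasSum (fun k => ‖c k‖ ^ 2) 1) (j : ℤ) :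
    HasSum (fun p : ℤ × ℤ => (‖c p.1‖ ^ 2 * ‖c p.2‖ ^ 2 : ℂ) *
      voidState lam p.1 (number (3 * j)) *
        (voidState lam p.1 (number 0) - voidState lam p.2 (number 0)))
      ((seriesCorr lam c j : ℝ) : ℂ) := by
  have b1 := isBdd_density lam j
  have b2 := isBdd_density lam 0
  have t1 := (hasSum_mean hc (b1.mul b2)).prod_mul hc
  have t2 := (hasSum_mean hc b1).prod_mul (hasSum_mean hc b2)
  have t3 := Complex.hasSum_ofReal.2 (t1.sub t2)
  have h0 : ∀ k, voidState lam k (number 0) = (density lam k 0 : ℂ) := fun k => by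
    rw [← voidState_number, mul_zero]
  rw [mul_one] at t3
  refine t3.congr_fun fun p => ?_
  rw [voidState_number, h0, h0]
  push_cast
  ring

end Density

end SpinChain

end


noncomputable section

namespace SpinChain

/-! ### Density correlations of superpositions -/

section Correlation

variable {lam : ℂ} {c : ℤ → ℂ} {f : QuasiLocal →ₗ[ℂ] ℂ}

/-- On densities and products of two densities, `f` is the mixture of the single-void states with
the weights `|c_k|²`. -/
structure IsMixture (lam : ℂ) (c : ℤ → ℂ) (f : QuasiLocal →ₗ[ℂ] ℂ) : Prop where
  hasSum_weight : HasSum (fun k => ‖c k‖ ^ 2) 1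
  hasSum_number : ∀ x : ℤ,
    HasSum (fun k => (‖c k‖ ^ 2 : ℂ) * voidState lam k (number x)) (f (number x))
  hasSum_number_mul : ∀ x y : ℤ,
    HasSum (fun k => (‖c k‖ ^ 2 : ℂ) * voidState lam k (number x * number y))
      (f (number x * number y))

theorem isMixture_superposition {Ω : ℤ → (voidState lam 0).GNS}
    (hΩ : ∀ k A, voidState lam k A = vectorFunctional (voidState lam 0) (Ω k) A)
    (hc : HasSum (fun k => ‖c k‖ ^ 2) 1) :
    IsMixture lam c (vectorFunctional (voidState lam 0) (∑' k, c k • Ω k)) :=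
  ⟨hc, fun _ => hasSum_vectorFunctional hΩ hc fun k => commute_number_voidDetector k _,
    fun _ _ => hasSum_vectorFunctional hΩ hc fun k =>
      (commute_number_voidDetector k _).mul_left (commute_number_voidDetector k _)⟩

theorem voidState_number_zero (lam : ℂ) (k : ℤ) :
    voidState lam k (number 0) = (density lam k 0 : ℂ) := by
  rw [← voidState_number, mul_zero]

namespace IsMixture

theorem apply_number (hf : IsMixture lam c f) (j : ℤ) :
    f (number (3 * j)) = (mean c (fun k => density lam k j) : ℂ) := by
  refine (hf.hasSum_number (3 * j)).unique ((Complex.hasSum_ofReal.2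
    (hasSum_mean hf.hasSum_weight (isBdd_density lam j))).congr_fun fun k => ?_)
  rw [voidState_number]
  push_cast
  rfl

/-- This is the law of total covariance: the correlation of a mixture minus the covariance of the
component densities is the mean of the component correlations. -/
theorem hasSum_densityCorr_sub (hf : IsMixture lam c f) (j : ℤ) :
    HasSum (fun k => (‖c k‖ ^ 2 : ℂ) * (voidState lam k (number 0 * number (3 * j)) -
      voidState lam k (number 0) * voidState lam k (number (3 * j))))
      (densityCorr f 0 (3 * j) - (seriesCorr lam c j : ℂ)) := by
  have h := Complex.hasSum_ofReal.2
    (hasSum_mean hf.hasSum_weight ((isBdd_density lam j).mul (isBdd_density lam 0)))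
  have e : densityCorr f 0 (3 * j) - (seriesCorr lam c j : ℂ) = f (number 0 * number (3 * j)) -
      (mean c (fun k => density lam k j * density lam k 0) : ℂ) := by
    have h0 := hf.apply_number 0
    rw [mul_zero] at h0
    rw [densityCorr, h0, hf.apply_number, seriesCorr]
    push_cast
    ring
  rw [e]
  refine ((hf.hasSum_number_mul 0 (3 * j)).sub h).congr_fun fun k => ?_
  rw [voidState_number_zero, voidState_number]
  push_cast
  ring

theorem norm_densityCorr_sub_seriesCorr_le (hf : IsMixture lam c f) {j : ℤ} (hj : 1 < j) :
    ‖densityCorr f 0 (3 * j) - (seriesCorr lam c j : ℂ)‖ ≤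
      4 * max 1 (‖lam‖ ^ 2) / muDiff lam ^ 2 * |muRatio lam| ^ j := by
  rw [← (hf.hasSum_densityCorr_sub j).tsum_eq]
  have h := hf.hasSum_weight.mul_right
    (4 * max 1 (‖lam‖ ^ 2) / muDiff lam ^ 2 * |muRatio lam| ^ j)
  rw [one_mul] at h
  refine tsum_of_norm_bounded h fun k => ?_
  rw [norm_mul, norm_pow, Complex.norm_real, norm_norm]
  exact mul_le_mul_of_nonneg_left (norm_voidState_corr_le lam k hj) (sq_nonneg _)

theorem norm_densityCorr_sub_leadingCorr_le (hf : IsMixture lam c f) (hneg : ∀ k < 0, c k = 0)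
    {j : ℤ} (hj : 1 < j) :
    ‖densityCorr f 0 (3 * j) - (leadingCorr lam c j : ℂ)‖ ≤
      8 * max 1 (‖lam‖ ^ 2) / muDiff lam ^ 2 * |muRatio lam| ^ j := by
  have h1 := hf.norm_densityCorr_sub_seriesCorr_le hj
  have h2 := abs_seriesCorr_sub_leadingCorr_le (lam := lam) hf.hasSum_weight hneg
    (show 0 ≤ j by omega)
  rw [← Real.norm_eq_abs, ← Complex.norm_real, Complex.ofReal_sub] at h2
  have h3 := norm_sub_le_norm_sub_add_norm_sub (densityCorr f 0 (3 * j))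
    (seriesCorr lam c j : ℂ) (leadingCorr lam c j : ℂ)
  have h4 : 0 ≤ max 1 (‖lam‖ ^ 2) / muDiff lam ^ 2 * |muRatio lam| ^ j :=
    mul_nonneg (div_nonneg (zero_le_one.trans (le_max_left _ _)) (sq_nonneg _))
      (zpow_nonneg (abs_nonneg _) _)
  rw [mul_div_assoc, mul_assoc] at h1 h2 ⊢
  linarith

theorem norm_densityCorr_sub_tailMass_le (hf : IsMixture lam c f) (hneg : ∀ k < 0, c k = 0)
    {j : ℤ} (hj : 1 < j) :
    ‖densityCorr f 0 (3 * j) -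
        ((muMass lam c / muDiff lam ^ 2 * tailMass c j : ℝ) : ℂ)‖ ≤
      8 * max 1 (‖lam‖ ^ 2) / muDiff lam ^ 2 * |muRatio lam| ^ j +
        2 * ‖lam‖ ^ 2 / muDiff lam ^ 2 *
          ∑' k : ℤ, ‖c k‖ ^ 2 * |muRatio lam| ^ max (j - k) 0 := by
  have h2 := abs_leadingCorr_sub_le (lam := lam) hf.hasSum_weight hneg j
  rw [← Real.norm_eq_abs, ← Complex.norm_real, Complex.ofReal_sub] at h2
  exact (norm_sub_le_norm_sub_add_norm_sub _ _ _).trans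
    (add_le_add (hf.norm_densityCorr_sub_leadingCorr_le hneg hj) h2)

theorem tendsto_densityCorr (hf : IsMixture lam c f) :
    Tendsto (fun j : ℕ => densityCorr f 0 (3 * j)) atTop (𝓝 0) := by
  have h1 : Tendsto (fun j : ℕ => 4 * max 1 (‖lam‖ ^ 2) / muDiff lam ^ 2 * |muRatio lam| ^ j)
      atTop (𝓝 (4 * max 1 (‖lam‖ ^ 2) / muDiff lam ^ 2 * 0)) :=
    (tendsto_pow_atTop_nhds_zero_of_lt_one (abs_nonneg _) (abs_muRatio_lt_one lam)).const_mul _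
  rw [mul_zero] at h1
  have h2 : Tendsto (fun j : ℕ => densityCorr f 0 (3 * j) - (seriesCorr lam c j : ℂ)) atTop
      (𝓝 0) := by
    refine squeeze_zero_norm' ?_ h1
    filter_upwards [eventually_gt_atTop 1] with j hj
    have := hf.norm_densityCorr_sub_seriesCorr_le (j := j) (by exact_mod_cast hj)
    rwa [zpow_natCast] at this
  have h3 := (Complex.continuous_ofReal.tendsto 0).comp
    (tendsto_seriesCorr (lam := lam) hf.hasSum_weight)
  have h4 := h2.add h3
  rw [Complex.ofReal_zero, add_zero] at h4
  exact h4.congr fun j => sub_add_cancel _ _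

theorem densityCorr_eq_of_zero {f : QuasiLocal →ₗ[ℂ] ℂ} (hf : IsMixture 0 c f) {j : ℤ}
    (hj : 0 < j) : densityCorr f 0 (3 * j) =
      (((1 - tailMass c 0) * tailMass c j : ℝ) : ℂ) := by
  have h := (hf.hasSum_densityCorr_sub j).tsum_eq
  simp only [voidState_zero_number_mul_number, sub_self, mul_zero, tsum_zero] at h
  rw [sub_eq_zero.1 h.symm]
  -- Without dimers all triples left of the void are monomers, and no multiple of 3 to the right of
  -- it is occupied. The covariance becomes that of the nested events k > j and k > 0.
  have hd : ∀ k i : ℤ, density 0 k i = if i < k then 1 else 0 := fun k i => by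
    have h1 : muDiff 0 = 1 := by simp [muDiff]
    have h2 : muRatio 0 = 0 := by simp [muRatio, muMinus]
    rw [density, h1, h2]
    rcases lt_trichotomy i k with h | rfl | h
    · rw [if_pos h, zero_zpow _ (by simp; omega)]; simp [h]
    · simp
    · simp [h.ne', not_lt.2 h.le]
  have e : mean c (fun k => density 0 k j * density 0 k 0) = tailMass c j := by
    rw [tailMass_eq]
    refine mean_congr fun k _ => ?_
    rw [hd, hd]
    by_cases h : j < k
    · rw [if_pos h, if_pos (by omega), one_mul]
    · rw [if_neg h, zero_mul]
  rw [seriesCorr, e]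
  simp only [hd, ← tailMass_eq]
  congr 1
  ring

end IsMixture

end Correlation

end SpinChain

end


noncomputable section

namespace SpinChain

/-! ### Superpositions with slowly decaying correlations -/

section Slow

/-- A sequence of positive weights with sum one. -/
def slowWeight (i : ℕ) : ℝ := 1 / ((i + 1) * (i + 2))

theorem slowWeight_pos (i : ℕ) : 0 < slowWeight i := by unfold slowWeight; positivity

/-- The weights telescope, so the mass beyond index i is 1/(i+2), larger than the i-th weight by the
factor i + 1. This is what lets the tail dominate the errors below. -/
theorem sum_slowWeight (n : ℕ) : ∑ i ∈ Finset.range n, slowWeight i = 1 - 1 / (n + 1) := by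
  induction n with
  | zero => simp
  | succ n ih =>
    rw [Finset.sum_range_succ, ih, slowWeight]
    push_cast
    field_simp
    ring

theorem hasSum_slowWeight : HasSum slowWeight 1 := by
  rw [hasSum_iff_tendsto_nat_of_nonneg fun i => (slowWeight_pos i).le]
  simp only [sum_slowWeight]
  simpa using (tendsto_one_div_add_atTop_nhds_zero_nat (𝕜 := ℝ)).const_sub 1

theorem slowWeight_anti : Antitone slowWeight := fun i j h => by
  unfold slowWeight
  gcongr

theorem tendsto_slowWeight : Tendsto slowWeight atTop (𝓝 0) :=
  hasSum_slowWeight.summable.tendsto_atTop_zero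

/-- There are sites with gaps so large that `P i j` holds for all `j` beyond the `i`-th gap. -/
theorem exists_sites {P : ℕ → ℕ → Prop} (hP : ∀ i, ∀ᶠ j in atTop, P i j) :
    ∃ s : ℕ → ℕ, StrictMono s ∧ s 0 = 0 ∧ ∀ i j, s (i + 1) ≤ s i + j → P (i + 1) j := by
  choose N hN using fun i => eventually_atTop.1 (hP i)
  -- The gap between the sites i and i + 1 is N(i+1) + 1: past the threshold for i + 1, and
  -- positive.
  refine ⟨fun i => ∑ m ∈ Finset.range i, (N (m + 1) + 1), strictMono_nat_of_lt_succ fun i => ?_,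
    by simp, fun i j h => hN (i + 1) j ?_⟩
  · rw [Finset.sum_range_succ]; omega
  · beta_reduce at h; rw [Finset.sum_range_succ] at h; omega

theorem exists_between_sites {s : ℕ → ℕ} (hs : StrictMono s) {I j : ℕ} (hj : s I ≤ j) :
    ∃ i, I ≤ i ∧ s i ≤ j ∧ j < s (i + 1) := by
  have hex : ∃ n, j < s n := ⟨j + 1, hs.le_apply⟩
  have h1 := Nat.find_spec hex
  obtain ⟨i, hi⟩ : ∃ i, Nat.find hex = i + 1 := by
    refine Nat.exists_eq_succ_of_ne_zero fun h0 => ?_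
    rw [h0] at h1
    have := hs.monotone (Nat.zero_le I)
    omega
  have h2 := Nat.find_min hex (m := i) (by omega)
  rw [hi] at h1
  refine ⟨i, ?_, by omega, h1⟩
  by_contra h
  have := hs.monotone (show i + 1 ≤ I by omega)
  omega

/-- The amplitudes with weight `slowWeight i` at the site `s i`. -/
def slowAmplitude (s : ℕ → ℕ) : ℤ → ℂ :=
  Function.extend (fun i => (s i : ℤ)) (fun i => ((Real.sqrt (slowWeight i) : ℝ) : ℂ)) 0

variable {lam : ℂ} {s : ℕ → ℕ}

theorem slowAmplitude_injective (hs : StrictMono s) : Function.Injective fun i => (s i : ℤ) :=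
  fun _ _ h => hs.injective (Nat.cast_injective h)

theorem norm_sq_slowAmplitude (hs : StrictMono s) (i : ℕ) :
    ‖slowAmplitude s (s i)‖ ^ 2 = slowWeight i := by
  have h : slowAmplitude s (s i) = ((Real.sqrt (slowWeight i) : ℝ) : ℂ) :=
    (slowAmplitude_injective hs).extend_apply _ _ i
  rw [h, Complex.norm_real, Real.norm_eq_abs, sq_abs, Real.sq_sqrt (slowWeight_pos i).le]

theorem exists_of_slowAmplitude_ne_zero {k : ℤ} (hk : slowAmplitude s k ≠ 0) :
    ∃ i, k = s i := by
  by_contra h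
  exact hk (Function.extend_apply' _ _ _ fun ⟨i, hi⟩ => h ⟨i, hi.symm⟩)

theorem slowAmplitude_of_neg (k : ℤ) (hk : k < 0) : slowAmplitude s k = 0 := by
  by_contra h
  obtain ⟨i, rfl⟩ := exists_of_slowAmplitude_ne_zero h
  omega

theorem mean_slowAmplitude (hs : StrictMono s) (g : ℤ → ℝ) :
    mean (slowAmplitude s) g = ∑' i, slowWeight i * g (s i) := by
  simp only [← norm_sq_slowAmplitude hs]
  refine ((slowAmplitude_injective hs).tsum_eq
    (f := fun k => ‖slowAmplitude s k‖ ^ 2 * g k) fun k hk => ?_).symm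
  obtain ⟨i, rfl⟩ := exists_of_slowAmplitude_ne_zero (s := s) (k := k) fun h => by simp [h] at hk
  exact ⟨i, rfl⟩

theorem hasSum_slowAmplitude (hs : StrictMono s) :
    HasSum (fun k => ‖slowAmplitude s k‖ ^ 2) 1 := by
  rw [← (slowAmplitude_injective hs).hasSum_iff fun k hk => ?_]
  · refine hasSum_slowWeight.congr_fun fun i => norm_sq_slowAmplitude hs i
  · have : slowAmplitude s k = 0 := by
      by_contra h
      obtain ⟨i, rfl⟩ := exists_of_slowAmplitude_ne_zero h
      exact hk ⟨i, rfl⟩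
    simp [this]

theorem mean_slowAmplitude_single (hs : StrictMono s) (i : ℕ) :
    mean (slowAmplitude s) (fun k => if k = s i then 1 else 0) = slowWeight i := by
  rw [mean_slowAmplitude hs, tsum_eq_single i]
  · simp
  · intro m hm
    have : s m ≠ s i := fun h => hm (hs.injective h)
    simp [this]

theorem mean_slowAmplitude_tail (hs : StrictMono s) {i j : ℕ} (h1 : s i ≤ j) (h2 : j < s (i + 1)) :
    mean (slowAmplitude s) (fun k => if (j : ℤ) < k then 1 else 0) = 1 / (i + 2) := by
  have hlt : ∀ m, (j : ℤ) < s m ↔ i < m := fun m => by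
    constructor
    · intro h
      by_contra h'
      have := hs.monotone (show m ≤ i by omega)
      omega
    · intro h
      have := hs.monotone (show i + 1 ≤ m by omega)
      omega
  have e : mean (slowAmplitude s) (fun k => 1 - if (j : ℤ) < k then 1 else 0) =
      1 - 1 / (i + 2) := by
    rw [mean_slowAmplitude hs, tsum_eq_sum (s := Finset.range (i + 1))]
    · rw [Finset.sum_congr rfl (g := slowWeight), sum_slowWeight]
      · push_cast; ring
      · intro m hm
        rw [Finset.mem_range] at hm
        rw [if_neg (by rw [hlt]; omega)]; ring
    · intro m hm
      rw [Finset.mem_range] at hm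
      rw [if_pos (by rw [hlt]; omega)]; ring
  rw [mean_sub (hasSum_slowAmplitude hs) (.const 1) (isBdd_indicator _),
    mean_const (hasSum_slowAmplitude hs)] at e
  linarith

/-- Mass 1/2 sits at the origin, where μ^0 = 1; the other half contributes at least -|μ|/2. The sum
is at least (1 - |μ|)/2. -/
theorem muMass_slowAmplitude_pos (hs : StrictMono s) (h0 : s 0 = 0) :
    0 < muMass lam (slowAmplitude s) := by
  have hc := hasSum_slowAmplitude hs
  have hm := abs_muRatio_lt_one lam
  have hb : IsBdd fun k => (1 + |muRatio lam|) * (if k = s 0 then 1 else 0) - |muRatio lam| :=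
    ((IsBdd.const _).mul (isBdd_indicator _)).sub (.const _)
  have h := mean_mono hc hb (isBdd_toNat lam) fun k hk => by
    obtain ⟨i, rfl⟩ := exists_of_slowAmplitude_ne_zero hk
    rw [Int.toNat_natCast]
    by_cases hi : s i = s 0
    · rw [if_pos (by exact_mod_cast hi), hi, h0, pow_zero]; linarith
    · rw [if_neg (by exact_mod_cast hi), mul_zero, zero_sub]
      refine (neg_le_neg ?_).trans (neg_abs_le _)
      rw [abs_pow]
      exact pow_le_of_le_one (abs_nonneg _) hm.le (by omega)
  rw [mean_sub hc ((IsBdd.const _).mul (isBdd_indicator _)) (.const _), mean_const_mul,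
    mean_slowAmplitude_single hs, mean_const hc, ← muMass_eq lam slowAmplitude_of_neg] at h
  have : slowWeight 0 = 1 / 2 := by norm_num [slowWeight]
  rw [this] at h
  linarith

theorem leadingCorr_eq_mean {c : ℤ → ℂ} (hc : HasSum (fun k => ‖c k‖ ^ 2) 1) (j : ℤ) :
    leadingCorr lam c j = muMass lam c / muDiff lam ^ 2 * mean c (fun k =>
      (if j < k then 1 else 0) - ‖lam‖ ^ 2 / muPlus lam * (if j < k then 1 else 0)
      - (if j < k then muRatio lam ^ (k - j) else 0)
      - ‖lam‖ ^ 2 / muPlus lam * (if k ≤ j then muRatio lam ^ (j - k) else 0)) := by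
  have hD := (muDiff_pos lam).ne'
  have h1 := isBdd_indicator fun k => j < k
  have hr := IsBdd.const (‖lam‖ ^ 2 / muPlus lam)
  rw [leadingCorr_eq hc]
  simp only [density_eq lam _ j]
  rw [mean_const_mul, mean_add hc (((h1.sub (hr.mul h1)).sub (isBdd_right lam j)).sub
    (hr.mul (isBdd_left lam j))) hr, mean_const hc, ← mul_assoc (muDiff lam),
    mul_one_div_cancel hD, one_mul, add_sub_cancel_right]

theorem slowWeight_le_one (i : ℕ) : slowWeight i ≤ 1 :=
  le_hasSum hasSum_slowWeight i fun m _ => (slowWeight_pos m).le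

theorem abs_muRatio_zpow_le_slowWeight
    (hq : ∀ i m, i < m → |muRatio lam| ^ (s m - s i) ≤ slowWeight m ^ 2)
    {i m l : ℕ} (him : i < m) (hl : l ≤ m) {n : ℤ} (hn : (s m : ℤ) - s i ≤ n)
    (hs : StrictMono s) : |muRatio lam ^ n| ≤ slowWeight l ^ 2 := by
  have := hs him
  have h1 := abs_muRatio_zpow_le lam (m := ((s m - s i : ℕ) : ℤ)) (by omega)
    (show ((s m - s i : ℕ) : ℤ) ≤ n by omega)
  rw [zpow_natCast] at h1
  exact h1.trans ((hq i m him).trans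
    (pow_le_pow_left₀ (slowWeight_pos m).le (slowWeight_anti hl) 2))

/-- The indicator terms contribute 1 - |λ|²/μ₊ times the tail mass. The powers of μ can be large
only at the two occupied sites next to j, each of weight at most `slowWeight i`. At all other sites
the distance from j exceeds a gap and the power is below `slowWeight i`. -/
theorem le_abs_leadingCorr (hs : StrictMono s) (h0 : s 0 = 0)
    (hq : ∀ i m, i < m → |muRatio lam| ^ (s m - s i) ≤ slowWeight m ^ 2)
    {i j : ℕ} (h1 : s i ≤ j) (h2 : j < s (i + 1)) :
    muMass lam (slowAmplitude s) / muDiff lam ^ 2 * (|1 - ‖lam‖ ^ 2 / muPlus lam| * (1 / (i + 2)) -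
      3 * (1 + ‖lam‖ ^ 2 / muPlus lam) * slowWeight i) ≤
        |leadingCorr lam (slowAmplitude s) j| := by
  have hc := hasSum_slowAmplitude hs
  have hS := muMass_slowAmplitude_pos (lam := lam) hs h0
  have hr := sq_div_muPlus_nonneg lam
  rw [leadingCorr_eq_mean hc, abs_mul, abs_of_pos (div_pos hS (pow_pos (muDiff_pos lam) 2))]
  refine mul_le_mul_of_nonneg_left ?_ (div_pos hS (pow_pos (muDiff_pos lam) 2)).le
  set r := ‖lam‖ ^ 2 / muPlus lam
  have b1 := isBdd_indicator fun k => (j : ℤ) < k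
  have b2 := isBdd_right lam j
  have b3 := isBdd_left lam j
  have hrb := IsBdd.const r
  have b4 := ((b1.sub (hrb.mul b1)).sub b2).sub (hrb.mul b3)
  have b5 := (IsBdd.const (1 - r)).mul b1
  have b6 := isBdd_indicator fun k => k = (s i : ℤ)
  have b7 := isBdd_indicator fun k => k = (s (i + 1) : ℤ)
  have key := abs_mean_le hc (b4.sub b5) (h := fun k => (1 + r) *
    (slowWeight i + (if k = s i then 1 else 0) + (if k = s (i + 1) then 1 else 0)))
    ((IsBdd.const _).mul (((IsBdd.const _).add b6).add b7)) fun k hk => by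
    obtain ⟨m, rfl⟩ := exists_of_slowAmplitude_ne_zero hk
    have ha := slowWeight_pos i
    have ha2 : slowWeight i ^ 2 ≤ slowWeight i :=
      pow_le_of_le_one ha.le (slowWeight_le_one i) two_ne_zero
    have i1 : (0 : ℝ) ≤ if (s m : ℤ) = s i then 1 else 0 := by split_ifs <;> norm_num
    have i2 : (0 : ℝ) ≤ if (s m : ℤ) = s (i + 1) then 1 else 0 := by split_ifs <;> norm_num
    rcases lt_or_ge (j : ℤ) (s m) with h | h
    · have him : i < m := by
        by_contra h'
        have := hs.monotone (show m ≤ i by omega)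
        omega
      rw [if_pos h, if_pos h, if_neg (by omega)]
      have hx : |muRatio lam ^ ((s m : ℤ) - j)| ≤ slowWeight i +
          (if (s m : ℤ) = s i then 1 else 0) + (if (s m : ℤ) = s (i + 1) then 1 else 0) := by
        rcases Nat.lt_or_ge (i + 1) m with h3 | h3
        · have := abs_muRatio_zpow_le_slowWeight hq h3 him.le
            (n := (s m : ℤ) - j) (by omega) hs
          linarith
        · obtain rfl : m = i + 1 := by omega
          have := abs_muRatio_zpow_le lam le_rfl (show 0 ≤ (s (i + 1) : ℤ) - j by omega)
          rw [zpow_zero] at this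
          rw [if_pos rfl] at i2 ⊢
          linarith
      have e : (1 : ℝ) - r * 1 - muRatio lam ^ ((s m : ℤ) - j) - r * 0 - (1 - r) * 1 =
        -muRatio lam ^ ((s m : ℤ) - j) := by ring
      rw [e, abs_neg]
      nlinarith [abs_nonneg (muRatio lam ^ ((s m : ℤ) - j))]
    · have him : m ≤ i := by
        by_contra h'
        have := hs.monotone (show i + 1 ≤ m by omega)
        omega
      rw [if_neg (by omega), if_neg (by omega), if_pos h]
      have hx : |muRatio lam ^ ((j : ℤ) - s m)| ≤ slowWeight i +
          (if (s m : ℤ) = s i then 1 else 0) + (if (s m : ℤ) = s (i + 1) then 1 else 0) := by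
        rcases him.lt_or_eq with h3 | rfl
        · have := abs_muRatio_zpow_le_slowWeight hq h3 le_rfl
            (n := (j : ℤ) - s m) (by omega) hs
          linarith
        · have := abs_muRatio_zpow_le lam le_rfl (show 0 ≤ (j : ℤ) - s m by omega)
          rw [zpow_zero] at this
          rw [if_pos rfl] at i1 ⊢
          linarith
      have e : (0 : ℝ) - r * 0 - 0 - r * muRatio lam ^ ((j : ℤ) - s m) - (1 - r) * 0 =
        -(r * muRatio lam ^ ((j : ℤ) - s m)) := by ring
      rw [e, abs_neg, abs_mul, abs_of_nonneg hr]
      exact mul_le_mul (by linarith) hx (abs_nonneg _) (by linarith)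
  rw [mean_sub hc b4 b5, mean_const_mul, mean_const_mul, mean_slowAmplitude_tail hs h1 h2,
    mean_add hc ((IsBdd.const _).add b6) b7, mean_add hc (IsBdd.const _) b6, mean_const hc,
    mean_slowAmplitude_single hs, mean_slowAmplitude_single hs] at key
  have ha : slowWeight (i + 1) ≤ slowWeight i := slowWeight_anti (Nat.le_succ i)
  have h3 := abs_sub_abs_le_abs_sub ((1 - r) * (1 / ((i : ℝ) + 2)))
    (mean (slowAmplitude s) fun k => (if (j : ℤ) < k then 1 else 0) -
      r * (if (j : ℤ) < k then 1 else 0) - (if (j : ℤ) < k then muRatio lam ^ (k - j) else 0) -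
      r * (if k ≤ (j : ℤ) then muRatio lam ^ (j - k) else 0))
  rw [abs_sub_comm ((1 - r) * _), abs_mul,
    abs_of_pos (show (0 : ℝ) < 1 / ((i : ℝ) + 2) by positivity)] at h3
  have h4 : (1 + r) * (slowWeight i + slowWeight i + slowWeight (i + 1)) ≤
      3 * (1 + r) * slowWeight i := by nlinarith
  linarith

/-- Here the indicator terms cancel, so j is placed on an occupied site. There μ^0 = 1 contributes
the weight of this site, and all other occupied sites are at least a gap away. -/
theorem le_abs_leadingCorr_of_eq_one (hs : StrictMono s) (h0 : s 0 = 0)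
    (hq : ∀ i m, i < m → |muRatio lam| ^ (s m - s i) ≤ slowWeight m ^ 2)
    (h1 : ‖lam‖ ^ 2 / muPlus lam = 1) (i : ℕ) :
    muMass lam (slowAmplitude s) / muDiff lam ^ 2 * (slowWeight i - slowWeight i ^ 2) ≤
      |leadingCorr lam (slowAmplitude s) (s i)| := by
  have hc := hasSum_slowAmplitude hs
  have hS := muMass_slowAmplitude_pos (lam := lam) hs h0
  rw [leadingCorr_eq_mean hc, abs_mul, abs_of_pos (div_pos hS (pow_pos (muDiff_pos lam) 2)), h1]
  refine mul_le_mul_of_nonneg_left ?_ (div_pos hS (pow_pos (muDiff_pos lam) 2)).le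
  have b1 := isBdd_indicator fun k => (s i : ℤ) < k
  have b2 := isBdd_right lam (s i)
  have b3 := isBdd_left lam (s i)
  have hrb := IsBdd.const 1
  have b4 := ((b1.sub (hrb.mul b1)).sub b2).sub (hrb.mul b3)
  have b6 := isBdd_indicator fun k => k = (s i : ℤ)
  have key := abs_mean_le hc (b4.add b6) (.const (slowWeight i ^ 2)) fun k hk => by
    obtain ⟨m, rfl⟩ := exists_of_slowAmplitude_ne_zero hk
    rcases lt_trichotomy m i with h | rfl | h
    · have := hs h
      rw [if_neg (by omega), if_neg (by omega), if_pos (by omega), if_neg (by omega), mul_zero,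
        sub_zero, sub_zero, zero_sub, one_mul, add_zero, abs_neg]
      exact abs_muRatio_zpow_le_slowWeight hq h le_rfl le_rfl hs
    · simp [sq_nonneg]
    · have := hs h
      rw [if_pos (by omega), if_pos (by omega), if_neg (by omega), if_neg (by omega), mul_zero,
        mul_one, sub_self, zero_sub, sub_zero, add_zero, abs_neg]
      exact abs_muRatio_zpow_le_slowWeight hq h h.le le_rfl hs
  rw [mean_add hc b4 b6, mean_slowAmplitude_single hs, mean_const hc] at key
  have h3 := abs_le.1 key
  have h4 := neg_abs_le (mean (slowAmplitude s) fun k => (if (s i : ℤ) < k then 1 else 0) -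
      1 * (if (s i : ℤ) < k then 1 else 0) -
      (if (s i : ℤ) < k then muRatio lam ^ (k - s i) else 0) -
      1 * (if k ≤ (s i : ℤ) then muRatio lam ^ (s i - k) else 0))
  linarith [h3.1, h3.2]

/-- Substituting |λ|² = μ₊ into μ₊² = μ₊ + |λ|² gives μ₊ = 2. -/
theorem norm_sq_eq_two_of_eq_one (h : ‖lam‖ ^ 2 / muPlus lam = 1) : ‖lam‖ ^ 2 = 2 := by
  have hP := muPlus_pos lam
  have h1 : ‖lam‖ ^ 2 = muPlus lam := by rwa [div_eq_one_iff_eq hP.ne'] at h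
  have h2 := muPlus_sq lam
  rw [h1] at h2 ⊢
  nlinarith

/-- There are superpositions for which the leading term decays arbitrarily slowly. -/
theorem exists_slow_leadingCorr (lam : ℂ) {K : ℝ} (hK : 0 ≤ K) {r : ℕ → ℝ}
    (hr : Tendsto r atTop (𝓝 0)) :
    ∃ c : ℤ → ℂ, HasSum (fun k => ‖c k‖ ^ 2) 1 ∧ (∀ k < 0, c k = 0) ∧
      (∃ᶠ j : ℕ in atTop, r j + K * |muRatio lam| ^ j ≤ |leadingCorr lam c j|) ∧
      (‖lam‖ ^ 2 ≠ 2 →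
        ∀ᶠ j : ℕ in atTop, r j + K * |muRatio lam| ^ j ≤ |leadingCorr lam c j|) := by
  obtain ⟨s, hs, h0, hP⟩ := exists_sites
    (P := fun i j => r j ≤ slowWeight i ^ 2 ∧ |muRatio lam| ^ j ≤ slowWeight i ^ 2) fun i => by
    have ha : 0 < slowWeight i ^ 2 := pow_pos (slowWeight_pos i) 2
    exact ((hr.eventually_lt_const ha).mono fun _ h => h.le).and
      (((tendsto_pow_atTop_nhds_zero_of_lt_one (abs_nonneg _)
        (abs_muRatio_lt_one lam)).eventually_lt_const ha).mono fun _ h => h.le)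
  -- The distance s m - s i is at least the last gap, beyond which the condition for m holds.
  have hq : ∀ i m, i < m → |muRatio lam| ^ (s m - s i) ≤ slowWeight m ^ 2 := by
    intro i m him
    obtain ⟨m, rfl⟩ := Nat.exists_eq_succ_of_ne_zero (show m ≠ 0 by omega)
    have := hs.monotone (show i ≤ m by omega)
    exact (hP m _ (by change s (m + 1) ≤ _ + (s (m + 1) - _); omega)).2
  have hsmall : ∀ i j, 1 ≤ i → s i ≤ j →
      r j + K * |muRatio lam| ^ j ≤ (K + 1) * slowWeight i ^ 2 := by
    intro i j hi hij
    obtain ⟨i, rfl⟩ := Nat.exists_eq_succ_of_ne_zero (show i ≠ 0 by omega)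
    obtain ⟨h1, h2⟩ := hP i j (by change s (i + 1) ≤ j at hij; omega)
    have := mul_le_mul_of_nonneg_left h2 hK
    change _ ≤ (K + 1) * slowWeight (i + 1) ^ 2
    linarith
  have hσ : 0 < muMass lam (slowAmplitude s) / muDiff lam ^ 2 :=
    div_pos (muMass_slowAmplitude_pos hs h0) (pow_pos (muDiff_pos lam) 2)
  set σ := muMass lam (slowAmplitude s) / muDiff lam ^ 2 with hσdef
  have hev : ‖lam‖ ^ 2 / muPlus lam ≠ 1 → ∀ᶠ j : ℕ in atTop,
      r j + K * |muRatio lam| ^ j ≤ |leadingCorr lam (slowAmplitude s) j| := by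
    intro h1
    set q := ‖lam‖ ^ 2 / muPlus lam with hqdef
    have hx := tendsto_one_div_add_atTop_nhds_zero_nat (𝕜 := ℝ)
    -- Both sides are compared after division by the tail 1/(i+2). The errors then carry an extra
    -- factor 1/(i+1), while the main term keeps the positive limit σ |1 - q|.
    have t1 := (tendsto_slowWeight.mul hx).const_mul (K + 1)
    have t2 := ((hx.const_mul (3 * (1 + q))).const_sub |1 - q|).const_mul σ
    rw [mul_zero, mul_zero] at t1
    rw [mul_zero, sub_zero] at t2
    have hpos : 0 < σ * |1 - q| := mul_pos hσ (abs_pos.2 (sub_ne_zero.2 (Ne.symm h1)))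
    obtain ⟨I, hI⟩ := eventually_atTop.1 (t1.eventually_lt t2 hpos)
    filter_upwards [eventually_ge_atTop (s (I + 1))] with j hj
    obtain ⟨i, hi, hij, hji⟩ := exists_between_sites hs hj
    refine (hsmall i j (by omega) hij).trans
      (le_trans ?_ (le_abs_leadingCorr hs h0 hq hij hji))
    rw [← hσdef, ← hqdef]
    have h2 := mul_le_mul_of_nonneg_right (hI i (by omega)).le
      (show (0 : ℝ) ≤ 1 / ((i : ℝ) + 2) by positivity)
    have e : slowWeight i = 1 / ((i : ℝ) + 1) * (1 / ((i : ℝ) + 2)) := by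
      rw [slowWeight]; field_simp
    calc _ = (K + 1) * (slowWeight i * (1 / ((i : ℝ) + 1))) * (1 / ((i : ℝ) + 2)) := by
          rw [sq]; nth_rewrite 2 [e]; ring
      _ ≤ _ := h2
      _ = _ := by rw [e]; ring
  refine ⟨slowAmplitude s, hasSum_slowAmplitude hs, slowAmplitude_of_neg, ?_,
    fun h => hev fun h1 => h (norm_sq_eq_two_of_eq_one h1)⟩
  by_cases h1 : ‖lam‖ ^ 2 / muPlus lam = 1
  -- In the exceptional case the main term is one weight and the required bound is of the order of
  -- its square. The comparison is made only along the sites themselves, hence only for infinitely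
  -- many j.
  · have t1 := tendsto_slowWeight.const_mul (K + 1)
    have t2 := (tendsto_slowWeight.const_sub 1).const_mul σ
    rw [mul_zero] at t1
    rw [sub_zero, mul_one] at t2
    obtain ⟨I, hI⟩ := eventually_atTop.1 (t1.eventually_lt t2 hσ)
    refine frequently_atTop.2 fun n => ⟨s (I + n + 1), ?_, ?_⟩
    · have := hs.le_apply (x := I + n + 1)
      omega
    · refine (hsmall (I + n + 1) _ (by omega) le_rfl).trans
        (le_trans ?_ (le_abs_leadingCorr_of_eq_one hs h0 hq h1 _))
      rw [← hσdef]
      nlinarith [hI (I + n + 1) (by omega), slowWeight_pos (I + n + 1)]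
  · exact (hev h1).frequently

theorem IsMixture.le_norm_densityCorr {c : ℤ → ℂ} {f : QuasiLocal →ₗ[ℂ] ℂ}
    (hf : IsMixture lam c f) (hneg : ∀ k < 0, c k = 0) {j : ℕ} (hj : 1 < j) {a : ℝ}
    (ha : a + 8 * max 1 (‖lam‖ ^ 2) / muDiff lam ^ 2 * |muRatio lam| ^ j ≤
      |leadingCorr lam c j|) : a ≤ ‖densityCorr f 0 (3 * j)‖ := by
  have h1 := hf.norm_densityCorr_sub_leadingCorr_le hneg (j := j) (by exact_mod_cast hj)
  rw [zpow_natCast] at h1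
  have h2 := norm_sub_norm_le (leadingCorr lam c j : ℂ) (densityCorr f 0 (3 * j))
  rw [norm_sub_rev, Complex.norm_real, Real.norm_eq_abs] at h2
  linarith

/-- There are superpositions with arbitrarily slowly decaying density correlations. -/
theorem exists_slow_densityCorr (lam : ℂ) {r : ℕ → ℝ} (hr : Tendsto r atTop (𝓝 0)) :
    ∃ c : ℤ → ℂ, HasSum (fun k => ‖c k‖ ^ 2) 1 ∧ ∀ f, IsMixture lam c f →
      (∃ᶠ j : ℕ in atTop, r j ≤ ‖densityCorr f 0 (3 * j)‖) ∧
      (‖lam‖ ^ 2 ≠ 2 → ∀ᶠ j : ℕ in atTop, r j ≤ ‖densityCorr f 0 (3 * j)‖) := by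
  -- This is the constant of the error between correlation and leading term; requiring the leading
  -- term to exceed r j plus this error gives the bound for the correlation itself.
  have hK : 0 ≤ 8 * max 1 (‖lam‖ ^ 2) / muDiff lam ^ 2 :=
    div_nonneg (mul_nonneg (by norm_num) (zero_le_one.trans (le_max_left _ _))) (sq_nonneg _)
  obtain ⟨c, hc, hneg, h1, h2⟩ := exists_slow_leadingCorr lam hK hr
  refine ⟨c, hc, fun f hf => ⟨?_, fun h => ?_⟩⟩
  · exact (h1.and_eventually (eventually_gt_atTop 1)).mono fun j h =>
      hf.le_norm_densityCorr hneg h.2 h.1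
  · filter_upwards [h2 h, eventually_gt_atTop 1] with j h3 h4
    exact hf.le_norm_densityCorr hneg h4 h3

/-- Number operators at single sites have norm at most one and intervals of length one, so only the
constant C(1,1) enters and the bound is a fixed multiple of an exponential in j. That cannot exceed
1/(j+1) infinitely often. -/
theorem not_clustersExponentially {f : QuasiLocal →ₗ[ℂ] ℂ}
    (h : ∃ᶠ j : ℕ in atTop, 1 / ((j : ℝ) + 1) ≤ ‖densityCorr f 0 (3 * j)‖) :
    ¬ ClustersExponentially f := by
  rintro ⟨a, ha, C, hC⟩
  have hbound : ∀ j : ℕ, 0 < j →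
      ‖densityCorr f 0 (3 * j)‖ ≤ |C 1 1| * Real.exp (-(3 * a * j)) := by
    intro j hj
    have h1 := hC 0 0 (3 * j) (3 * j) (by omega) (number 0) (number_mem (by simp))
      (number (3 * j)) (number_mem (by simp))
    rw [Int.card_Icc, Int.card_Icc, show (0 + 1 - 0 : ℤ).toNat = 1 by rfl,
      show ((3 * j + 1 - 3 * j : ℤ)).toNat = 1 by omega] at h1
    refine h1.trans ?_
    have e : Real.exp (-a * (((3 * j - 0 : ℤ)) : ℝ)) = Real.exp (-(3 * a * j)) := by
      congr 1; push_cast; ring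
    rw [e]
    refine mul_le_mul_of_nonneg_right ?_ (Real.exp_nonneg _)
    calc C 1 1 * ‖number 0‖ * ‖number (3 * j)‖
        ≤ |C 1 1| * 1 * 1 := by
          gcongr
          · exact le_abs_self _
          · exact norm_number_le _
          · exact norm_number_le _
      _ = |C 1 1| := by ring
  have hlim : Tendsto (fun j : ℕ => ((j : ℝ) + 1) * (|C 1 1| * Real.exp (-(3 * a * j)))) atTop
      (𝓝 0) := by
    have hj : Tendsto (fun j : ℕ => 3 * a * (j : ℝ)) atTop atTop :=
      tendsto_natCast_atTop_atTop.const_mul_atTop (by positivity)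
    have t1 := (Real.tendsto_pow_mul_exp_neg_atTop_nhds_zero 1).comp hj
    have t0 := (Real.tendsto_pow_mul_exp_neg_atTop_nhds_zero 0).comp hj
    have t := (t1.const_mul (|C 1 1| / (3 * a))).add (t0.const_mul |C 1 1|)
    rw [mul_zero, mul_zero, add_zero] at t
    refine t.congr fun j => ?_
    simp only [Function.comp_apply, pow_one, pow_zero, one_mul]
    field_simp
  obtain ⟨j, ⟨h1, h2⟩, h3⟩ := ((h.and_eventually (hlim.eventually_lt_const one_pos)).and_eventually
    (eventually_gt_atTop 0)).exists
  have h4 := h1.trans (hbound j h3)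
  rw [div_le_iff₀ (by positivity)] at h4
  linarith

end Slow

end SpinChain

end


/-! ### Assembly of the theorem -/

theorem mainTheorem11 (lam : ℂ) :
    ∃ ω : ℤ → (QuasiLocal →ₚ[ℂ] ℂ),
      -- the infinite-volume single-void states exist as limits of the finite-volume VMD states
      (∀ k A, Tendsto (fun n : ℕ => singleVoidExpectation lam k n A) atTop (𝓝 (ω k A))) ∧
      (∀ k, IsState (ω k).toLinearMap) ∧
      -- density one-point function
      (∀ k j : ℤ, ω k (number (3 * j)) =
        (((1 - muRatio lam ^ |j - k|) / muDiff lam *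
          (if j < k then 1 else if j = k then 0 else ‖lam‖ ^ 2 / muPlus lam) : ℝ) : ℂ)) ∧
      -- density two-point function
      (∀ k j : ℤ, 1 < j →
        (j < k → ω k (number 0 * number (3 * j)) =
          ((1 / muDiff lam ^ 2 * (1 - muRatio lam ^ j) * (1 - muRatio lam ^ (k - j)) : ℝ) : ℂ)) ∧
        (0 ≤ k → k ≤ j → ω k (number 0 * number (3 * j)) =
          ω k (number 0) * ω k (number (3 * j))) ∧
        (k < 0 → ω k (number 0 * number (3 * j)) =
          ((‖lam‖ ^ 4 / (muPlus lam ^ 2 * muDiff lam ^ 2) *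
            (1 - muRatio lam ^ (j - 1)) * (1 - muRatio lam ^ (-k)) : ℝ) : ℂ))) ∧
      -- approximate factorization
      (∀ k j : ℤ, 1 < j →
        ‖ω k (number 0 * number (3 * j)) - ω k (number 0) * ω k (number (3 * j))‖ ≤
          4 * max 1 (‖lam‖ ^ 2) / muDiff lam ^ 2 * |muRatio lam| ^ j) ∧
      -- exact factorization in the case `λ = 0`
      (lam = 0 → ∀ k x y : ℤ, x ≠ y →
        ω k (number x * number y) = ω k (number x) * ω k (number y)) ∧
      -- all of these states are vector states in the GNS representation of `ω 0`
      (∃ Ω : ℤ → (ω 0).GNS, ∀ k A, ω k A = vectorFunctional (ω 0) (Ω k) A) ∧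
      (∀ Ω : ℤ → (ω 0).GNS, (∀ k A, ω k A = vectorFunctional (ω 0) (Ω k) A) →
        Orthonormal ℂ Ω ∧
        -- superpositions `∑ c_k Ω_{3k}`
        (∀ c : ℤ → ℂ, HasSum (fun k => ‖c k‖ ^ 2) 1 →
          Summable (fun k => c k • Ω k) ∧
          ∀ f : QuasiLocal →ₗ[ℂ] ℂ, f = vectorFunctional (ω 0) (∑' k, c k • Ω k) →
            IsPureState f ∧
            (∀ kappa : ℝ, 0 < kappa →
              IsGroundState lam kappa f ∧ HasZeroEnergy lam kappa f) ∧
            (∀ x : ℤ, HasSum (fun k => (‖c k‖ ^ 2 : ℂ) * ω k (number x)) (f (number x))) ∧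
            (∀ x y : ℤ, HasSum (fun k => (‖c k‖ ^ 2 : ℂ) * ω k (number x * number y))
              (f (number x * number y))) ∧
            -- the case `λ = 0`: the truncated correlation is `p(0) (1 - p(j))`
            (lam = 0 → ∀ j : ℤ, 0 < j →
              densityCorr f 0 (3 * j) =
                (((∑' k : {k : ℤ // k ≤ 0}, ‖c k‖ ^ 2) *
                  (1 - ∑' k : {k : ℤ // k ≤ j}, ‖c k‖ ^ 2) : ℝ) : ℂ) ∧
              1 - (∑' k : {k : ℤ // k ≤ j}, ‖c k‖ ^ 2) = tailMass c j) ∧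
            -- general `λ`: the double series, up to an exponentially small error
            (∀ j : ℤ, 1 < j →
              Summable (fun p : ℤ × ℤ => (‖c p.1‖ ^ 2 * ‖c p.2‖ ^ 2 : ℂ) *
                ω p.1 (number (3 * j)) * (ω p.1 (number 0) - ω p.2 (number 0))) ∧
              ‖densityCorr f 0 (3 * j) -
                  ∑' p : ℤ × ℤ, (‖c p.1‖ ^ 2 * ‖c p.2‖ ^ 2 : ℂ) *
                    ω p.1 (number (3 * j)) * (ω p.1 (number 0) - ω p.2 (number 0))‖ ≤
                4 * max 1 (‖lam‖ ^ 2) / muDiff lam ^ 2 * |muRatio lam| ^ j) ∧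
            -- coefficients supported on `k ≥ 0`
            ((∀ k < 0, c k = 0) → ∀ j : ℤ, 1 < j →
              (∑' p : ℤ × ℤ, (‖c p.1‖ ^ 2 * ‖c p.2‖ ^ 2 : ℂ) *
                  ω p.1 (number (3 * j)) * (ω p.1 (number 0) - ω p.2 (number 0)) =
                ((1 / muDiff lam ^ 2 * ∑' k : ℕ, ‖c k‖ ^ 2 * (1 - muRatio lam ^ |j - k|) *
                  (muMass lam c - muRatio lam ^ k) *
                  (if j < k then 1 else if (k : ℤ) < j then ‖lam‖ ^ 2 / muPlus lam else 0) :
                    ℝ) : ℂ)) ∧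
              -- the leading behaviour, up to an exponentially small error
              ‖densityCorr f 0 (3 * j) -
                  ((muMass lam c / muDiff lam ^ 2 *
                    (tailMass c j - ‖lam‖ ^ 2 / muPlus lam * tailMass c j
                      - (∑' k : {k : ℤ // j < k}, ‖c k‖ ^ 2 * muRatio lam ^ ((k : ℤ) - j))
                      - ‖lam‖ ^ 2 / muPlus lam *
                        ∑' k : {k : ℤ // k ≤ j}, ‖c k‖ ^ 2 * muRatio lam ^ (j - (k : ℤ))) :
                          ℝ) : ℂ)‖ ≤
                8 * max 1 (‖lam‖ ^ 2) / muDiff lam ^ 2 * |muRatio lam| ^ j ∧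
              -- the leading behaviour for small `λ`
              ‖densityCorr f 0 (3 * j) -
                  ((muMass lam c / muDiff lam ^ 2 * tailMass c j : ℝ) : ℂ)‖ ≤
                8 * max 1 (‖lam‖ ^ 2) / muDiff lam ^ 2 * |muRatio lam| ^ j +
                  2 * ‖lam‖ ^ 2 / muDiff lam ^ 2 *
                    ∑' k : ℤ, ‖c k‖ ^ 2 * |muRatio lam| ^ max (j - k) 0) ∧
            Tendsto (fun j : ℕ => densityCorr f 0 (3 * j)) atTop (𝓝 0)) ∧
        -- the decay of the density correlations can be arbitrarily slow
        (∀ r : ℕ → ℝ, Tendsto r atTop (𝓝 0) →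
          ∃ c : ℤ → ℂ, HasSum (fun k => ‖c k‖ ^ 2) 1 ∧
            (∃ᶠ j : ℕ in atTop,
              r j ≤ ‖densityCorr (vectorFunctional (ω 0) (∑' k, c k • Ω k)) 0 (3 * j)‖) ∧
            (‖lam‖ ^ 2 ≠ 2 → ∀ᶠ j : ℕ in atTop,
              r j ≤ ‖densityCorr (vectorFunctional (ω 0) (∑' k, c k • Ω k)) 0 (3 * j)‖)) ∧
        -- some superposition does not cluster exponentially
        (∃ c : ℤ → ℂ, HasSum (fun k => ‖c k‖ ^ 2) 1 ∧
          ¬ ClustersExponentially (vectorFunctional (ω 0) (∑' k, c k • Ω k)))) := by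
  refine ⟨voidState lam, tendsto_singleVoidExpectation lam, isState_voidState lam,
    fun k j => voidState_number lam k j,
    fun k j hj => ⟨voidState_number_mul_number_of_lt lam k hj,
      voidState_number_mul_number_of_mem lam k, voidState_number_mul_number_of_neg lam k hj⟩,
    fun k j hj => norm_voidState_corr_le lam k hj, ?_, exists_vectors lam, fun Ω hΩ =>
    ⟨orthonormal_of_vectorFunctional hΩ, fun c hc =>
      ⟨summable_smul_of_vectorFunctional hΩ hc, ?_⟩, fun r hr => ?_, ?_⟩⟩
  · rintro rfl k x y -
    exact voidState_zero_number_mul_number k x y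
  · rintro f rfl
    have hf := isMixture_superposition hΩ hc
    refine ⟨isPureState_vectorFunctional lam 0 (norm_tsum_smul_eq_one hΩ hc),
      fun kappa hk => ⟨isGroundState_superposition hΩ hc hk, hasZeroEnergy_superposition hΩ hc _⟩,
      hf.hasSum_number, hf.hasSum_number_mul, ?_,
      fun j hj => ⟨(hasSum_seriesCorr hc j).summable, ?_⟩,
      fun hneg j hj => ⟨?_, hf.norm_densityCorr_sub_leadingCorr_le hneg hj,
        hf.norm_densityCorr_sub_tailMass_le hneg hj⟩, hf.tendsto_densityCorr⟩
    · rintro rfl j hj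
      rw [tsum_le_eq_one_sub_tailMass hc, tsum_le_eq_one_sub_tailMass hc, sub_sub_cancel]
      exact ⟨hf.densityCorr_eq_of_zero hj, rfl⟩
    · rw [(hasSum_seriesCorr hc j).tsum_eq]
      exact hf.norm_densityCorr_sub_seriesCorr_le hj
    · rw [(hasSum_seriesCorr hc j).tsum_eq, seriesCorr_eq_of_nonneg hc hneg]
  · obtain ⟨c, hc, h⟩ := exists_slow_densityCorr lam hr
    exact ⟨c, hc, h _ (isMixture_superposition hΩ hc)⟩
  · obtain ⟨c, hc, h⟩ :=
      exists_slow_densityCorr lam (tendsto_one_div_add_atTop_nhds_zero_nat (𝕜 := ℝ))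
    exact ⟨c, hc, not_clustersExponentially (h _ (isMixture_superposition hΩ hc)).1⟩
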